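/- Let $\mathbb{T}=\mathbb{R}/2\pi\mathbb{Z}$, let $\varepsilon\in\{1,-1\}$, and consider the cubic fourth order nonlinear Schrödinger equation $$ i\partial_t u=\partial_x^4u+\varepsilon|u|^2u,\qquad u|_{t=0}=u_0,\qquad (x,t)\in\mathbb{T}\times\mathbb{R}. $$ Write $\langle x\rangle=(1+x^2)^{1/2}$, $\widehat f(n)=\frac1{2\pi}\int_{\mathbb{T}}f(x)e^{-inx}\,dx$, $\|f\|_{H^s}=\big(\sum_{n\in\mathbb{Z}}\langle n\rangle^{2s}|\widehat f(n)|^2\big)^{1/2}$ and $\|f\|_{L^2}=\|f\|_{H^0}$. For a closed interval $I\ni 0$, a solution on $I$ in $H^s$ ($s\ge0$) is a $u\in C(I;H^s(\mathbb{T}))$ with $|u|^2u\in L^1(I\times\mathbb{T})$ that satisfies, for every $t\in I$ and as an identity of Fourier coefficients, $$ u(t)=S(t)u_0-i\varepsilon\int_0^tS(t-t')|u|^2u(t')\,dt',\qquad S(t)=e^{-it\partial_x^4}. $$ Let $\|u\|_{X^{s,b}}=\|\langle n\rangle^s\langle\tau+n^4\rangle^b\widehat u(n,\tau)\|_{\ell^2_nL^2_\tau}$,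 and let $\|u\|_{X^{s,b}(I)}$ be the infimum of $\|\widetilde u\|_{X^{s,b}}$ over all extensions $\widetilde u$ of $u$ from $I$ to $\mathbb{R}$. For $s\ge0$, the uniqueness class on $I$ consists of all solutions in $C(I;H^s)$ if $s>\frac12$, and of those in $C(I;H^s)\cap X^{s,b}(I)$ if $0\le s\le\frac12$. There is $b>\frac12$ (independent of $s$ and $u_0$) such that the following hold. 1. (Local well-posedness.) There is a function $T:[0,\infty)\to(0,\infty)$ such that for every $s\ge0$ there is a constant $C$ such that for every $u_0\in H^s(\mathbb{T})$, with $T=T(\|u_0\|_{L^2})$, there is a solution $u\in C([-T,T];H^s)\cap X^{s,b}([-T,T])$ with data $u_0$; it satisfies $$ \sup_{|t|\le T}\|u(t)\|_{H^s}\le C\|u_0\|_{H^s}, $$ and it is the only solution with data $u_0$ in the uniqueness class on $[-T,T]$. 2. (Global well-posedness.) For every $s\ge0$ and $u_0\in H^s(\mathbb{T})$ there is $u\in C(\mathbb{R};H^s)$ that, for every $\tau>0$, is a solution on $[-\tau,\tau]$ with data $u_0$, lies in $X^{s,b}([-\tau,\tau])$, and is the only solution with data $u_0$ in the uniqueness class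 on $[-\tau,\tau]$. Moreover $\|u(t)\|_{L^2}=\|u_0\|_{L^2}$ for all $t\in\mathbb{R}$. 3. (Continuous dependence.) For all $s\ge0$, $\tau>0$ and $R\ge0$ there is $L$ such that, for all data $u_0,v_0\in H^s(\mathbb{T})$ with $\|u_0\|_{H^s},\|v_0\|_{H^s}\le R$, the corresponding solutions $u,v$ in the uniqueness class on $[-\tau,\tau]$ satisfy $$ \sup_{|t|\le\tau}\|u(t)-v(t)\|_{H^s}\le L\|u_0-v_0\|_{H^s}. $$ -/

import Mathlib

open MeasureTheory Set Filter Topology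
open scoped NNReal ENNReal

noncomputable section

namespace FourthOrderNLS

instance fact_two_pi_pos : Fact ((0 : ℝ) < 2 * Real.pi) := ⟨Real.two_pi_pos⟩

/-- The torus `𝕋 = ℝ / 2πℤ`. -/
abbrev Torus : Type := AddCircle (2 * Real.pi)

/-- The normalized Lebesgue measure `dx / 2π` on the torus. -/
abbrev torusMeasure : Measure Torus := AddCircle.haarAddCircle

/-- The space `L²(𝕋)` of complex-valued functions. -/
abbrev L2 : Type := Lp ℂ 2 torusMeasure

/-- The Fourier coefficient `f̂(n) = (1/2π) ∫ f(x) e^{-inx} dx`. -/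
def coeff (f : L2) (n : ℤ) : ℂ := fourierCoeff (f : Torus → ℂ) n

/-- The bracket `⟨x⟩ = (1 + x²)^{1/2}`. -/
def bracket (x : ℝ) : ℝ := (1 + x ^ 2) ^ (1 / 2 : ℝ)

/-- The `H^s` norm `(∑ₙ ⟨n⟩^{2s} |f̂(n)|²)^{1/2}`, with value `∞` outside `H^s`. -/
def hsNorm (s : ℝ) (f : L2) : ℝ≥0∞ :=
  (∑' n : ℤ, ENNReal.ofReal (bracket (n : ℝ) ^ (2 * s)) * ‖coeff f n‖ₑ ^ 2) ^ (1 / 2 : ℝ)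

/-- Membership in `H^s(𝕋)`; as `s ≥ 0` throughout, `H^s(𝕋)` is a subspace of `L²(𝕋)`. -/
def MemHs (s : ℝ) (f : L2) : Prop := hsNorm s f < ∞

/-- `u ∈ C(I; H^s(𝕋))`. -/
def ContInHs (s : ℝ) (I : Set ℝ) (u : ℝ → L2) : Prop :=
  (∀ t ∈ I, MemHs s (u t)) ∧
    ∀ t₀ ∈ I, Tendsto (fun t => hsNorm s (u t - u t₀)) (𝓝[I] t₀) (𝓝 0)

/-- The `n`-th Fourier coefficient of `|f|² f`, for `f ∈ L²(𝕋) ∩ L³(𝕋)`. -/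
def cubicCoeff (f : L2) (n : ℤ) : ℂ :=
  fourierCoeff (fun x : Torus => (((‖f x‖ ^ 2 : ℝ) : ℂ)) * f x) n

/-- The symbol `e^{-itn⁴}` of the linear propagator `S(t) = e^{-it∂ₓ⁴}`. -/
def propagator (t : ℝ) (n : ℤ) : ℂ :=
  Complex.exp (-(Complex.I * (t : ℂ) * (n : ℂ) ^ 4))

/-- `u ∈ C(I; H^s)` is a solution on the interval `I ∋ 0` of `i ∂ₜ u = ∂ₓ⁴ u + ε |u|² u`
with `u|_{t = 0} = u₀`.  The nonlinearity `|u|² u` is required to be integrable on `I × 𝕋`, so that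
its Fourier coefficients are integrable in time, and the Duhamel formula
`u(t) = S(t) u₀ - i ε ∫₀ᵗ S(t - t') |u|² u(t') dt'` holds as an identity of periodic
distributions, that is, for each Fourier coefficient. -/
structure IsSolution (ε s : ℝ) (I : Set ℝ) (u₀ : L2) (u : ℝ → L2) : Prop where
  cont : ContInHs s I u
  cubic_integrable : ∫⁻ t in I, ∫⁻ x, ‖u t x‖ₑ ^ 3 ∂torusMeasure < ∞
  duhamel : ∀ t ∈ I, ∀ n : ℤ,
    coeff (u t) n = propagator t n * coeff u₀ n
      - Complex.I * (ε : ℂ) * ∫ t' in (0 : ℝ)..t, propagator (t - t') n * cubicCoeff (u t') n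

/-- The norm `‖⟨n⟩^s ⟨τ + n⁴⟩^b g(n, τ)‖_{ℓ²ₙ L²_τ}` of a function `g(n, τ)` on `ℤ × ℝ`. -/
def xsbFourierNorm (s b : ℝ) (g : ℤ → ℝ → ℂ) : ℝ≥0∞ :=
  (∑' n : ℤ, ∫⁻ τ : ℝ,
    ENNReal.ofReal (bracket (n : ℝ) ^ (2 * s) * bracket (τ + (n : ℝ) ^ 4) ^ (2 * b))
      * ‖g n τ‖ₑ ^ 2) ^ (1 / 2 : ℝ)

/-- The space-time function whose space-time Fourier transform is `g` agrees with `u` on the time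
interval `I`.  When `b > 1/2` and `xsbFourierNorm s b g < ∞`, each `g n` is integrable, so that the
inversion integral below converges absolutely. -/
def Extends (I : Set ℝ) (u : ℝ → L2) (g : ℤ → ℝ → ℂ) : Prop :=
  (∀ n, Measurable (g n)) ∧
    ∀ t ∈ I, ∀ n : ℤ,
      coeff (u t) n =
        ((2 * Real.pi : ℝ) : ℂ)⁻¹ * ∫ τ : ℝ, Complex.exp (Complex.I * (t : ℂ) * (τ : ℂ)) * g n τ

/-- The local-in-time norm `‖u‖_{X^{s,b}(I)} = inf {‖ũ‖_{X^{s,b}} : ũ|_I = u}`, for `b > 1/2`;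
an element `ũ` of `X^{s,b}` is given by its space-time Fourier transform `g`. -/
def xsbNorm (s b : ℝ) (I : Set ℝ) (u : ℝ → L2) : ℝ≥0∞ :=
  ⨅ (g : ℤ → ℝ → ℂ) (_ : Extends I u g), xsbFourierNorm s b g

/-- The solutions on `I` among which uniqueness is claimed: all solutions in `C(I; H^s)` if
`s > 1/2`, those in `C(I; H^s) ∩ X^{s,b}(I)` if `s ≤ 1/2`. -/
def InUniquenessClass (ε s b : ℝ) (I : Set ℝ) (u₀ : L2) (u : ℝ → L2) : Prop :=
  IsSolution ε s I u₀ u ∧ (s ≤ 1 / 2 → xsbNorm s b I u < ∞)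

end FourthOrderNLS

end

/-! Pass to the interaction representation v_n(t) = e^{i n⁴ t} û(n, t). The equation becomes a sum
over (k, l) of products v_{n+k} conj(v_{n+k+l}) v_{n+l} with oscillating factor e^{iΦt}, where Φ =
kl(12(n + (k+l)/2)² + k² + l²). Hence |Φ| ≥ k²l² (`sq_mul_sq_le_abs_phase`): the only resonances are
k = 0 or l = 0, and these are bounded on ℓ² by Cauchy–Schwarz alone.

The contraction is not run in X^{s,b} but in the ℓ² sum (with weight ⟨n⟩^s) of the norm `yNorm`,
which measures bounded functions of time with half a derivative in L² in the weak sense `HalfReg`.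
This class is an algebra and admits sharp cutoffs in time, so cubic products and restrictions to
intervals cost only constants. Shifting by half a period gives a gain |Φ|^{-1/2} in an oscillatory
integral; interpolation with the trivial bound gives |I|^{5/8} |Φ|^{-3/8}
(`enorm_integral_exp_mul_le`). The factor |Φ|^{-3/8} ≤ |kl|^{-3/4} is square summable in (k, l),
which yields the trilinear estimate `l2_trilin_le`. The exponent 5/8 > 1/2 returns the integral to
`HalfReg` with a small constant on short intervals. The weight ⟨n⟩^s falls on one factor at a time,
so the smallness condition involves only the ℓ² size of the data: this gives `exists_isSol`,
`IsSol.wl2_sub_le` and uniqueness `IsSol.eqOn`.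

Mass is conserved without approximation by smooth solutions. Over [s, t] the first-order change of
∑|v_n|² is the real part of an imaginary number times a quartic sum that is real by symmetry
(`im_tsum_quart`), hence zero. What remains is quadratic in the increment, so of order |t -
s|^{5/4}, and the mass has zero derivative (`IsSol.mass_eq`). The time step then never shrinks, and
solutions extend to all times.

It remains to compare with the equation as stated. Truncated fourth powers integrate to partial sums
of the same quartic series, which bounds the space-time L⁴ norm and identifies the Duhamel integral
with `gam` (`integral_cubicCoeff_eq_gam`). Every member of the uniqueness class has finite norm: for
s ≤ 1/2 because H^b in time, b > 1/2, embeds in `HalfReg` (`exists_halfReg_invF`); for s > 1/2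
because u is bounded, which makes the coefficients Hölder of order 1/2 in time
(`l2_yn_inter_ne_top_of_contInHs`). Conversely the constructed solutions are Hölder of order 5/8 in
time, hence lie in X^{s,9/16} (`IsSol.xsbNorm_lt_top`), since 1/2 < 9/16 < 5/8. -/

noncomputable section

namespace FourthOrderNLS

/-! ### Functions of time with half a derivative in L² -/

/-- Bounded measurable functions of time with half a derivative in `L²`, in the weak (Besov) sense
`∫ |f(t+h) - f(t)|² dt ≤ A² h`. -/
def HalfReg (A : ℝ≥0∞) (f : ℝ → ℂ) : Prop :=
  Measurable f ∧ (∀ t, ‖f t‖ₑ ≤ A) ∧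
    ∀ h : ℝ, 0 < h → ∫⁻ t, ‖f (t + h) - f t‖ₑ ^ 2 ≤ A ^ 2 * ENNReal.ofReal h

lemma eLpNorm_two_sq {α : Type*} [MeasurableSpace α] (μ : Measure α) (f : α → ℂ) :
    eLpNorm f 2 μ ^ 2 = ∫⁻ x, ‖f x‖ₑ ^ 2 ∂μ := by
  have := eLpNorm_nnreal_pow_eq_lintegral (f := f) (μ := μ) (p := 2) (by norm_num)
  simp only [NNReal.coe_ofNat, ENNReal.coe_ofNat, ENNReal.rpow_ofNat] at this
  exact this

/-- Minkowski's inequality in squared form, so that the constants of `HalfReg` add without loss. -/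
lemma lintegral_sq_add_le {α : Type*} [MeasurableSpace α] {μ : Measure α} {f g : α → ℂ}
    {A B c : ℝ≥0∞} (hf : Measurable f) (hg : Measurable g)
    (h1 : ∫⁻ x, ‖f x‖ₑ ^ 2 ∂μ ≤ A ^ 2 * c) (h2 : ∫⁻ x, ‖g x‖ₑ ^ 2 ∂μ ≤ B ^ 2 * c) :
    ∫⁻ x, ‖f x + g x‖ₑ ^ 2 ∂μ ≤ (A + B) ^ 2 * c := by
  have key : ∀ x : ℝ≥0∞, (x ^ (1 / 2 : ℝ)) ^ 2 = x := fun x => by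
    rw [← ENNReal.rpow_natCast, ← ENNReal.rpow_mul]; simp
  have mono : ∀ x y : ℝ≥0∞, x ^ 2 ≤ y ^ 2 → x ≤ y := fun x y h =>
    (ENNReal.pow_le_pow_left_iff (n := 2) (by norm_num)).1 h
  have e1 : eLpNorm f 2 μ ≤ A * c ^ (1 / 2 : ℝ) := by
    apply mono; rw [eLpNorm_two_sq, mul_pow, key]; exact h1
  have e2 : eLpNorm g 2 μ ≤ B * c ^ (1 / 2 : ℝ) := by
    apply mono; rw [eLpNorm_two_sq, mul_pow, key]; exact h2
  have e3 := eLpNorm_add_le (μ := μ) hf.aestronglyMeasurable hg.aestronglyMeasurable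
    (p := 2) (by norm_num)
  calc ∫⁻ x, ‖f x + g x‖ₑ ^ 2 ∂μ = eLpNorm (f + g) 2 μ ^ 2 := by rw [eLpNorm_two_sq]; rfl
    _ ≤ (A * c ^ (1 / 2 : ℝ) + B * c ^ (1 / 2 : ℝ)) ^ 2 := by gcongr; exact e3.trans (by gcongr)
    _ = _ := by rw [← add_mul, mul_pow, key]

namespace HalfReg

variable {A B : ℝ≥0∞} {f g : ℝ → ℂ}

lemma mono (hf : HalfReg A f) (h : A ≤ B) : HalfReg B f :=
  ⟨hf.1, fun t => (hf.2.1 t).trans h, fun t ht => (hf.2.2 t ht).trans (by gcongr)⟩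

lemma zero : HalfReg 0 (fun _ => 0) := ⟨measurable_const, by simp, by simp⟩

lemma measurable_diff (hf : HalfReg A f) (h : ℝ) : Measurable fun t => f (t + h) - f t :=
  (hf.1.comp (measurable_id.add_const h)).sub hf.1

lemma add (hf : HalfReg A f) (hg : HalfReg B g) : HalfReg (A + B) (fun t => f t + g t) := by
  refine ⟨hf.1.add hg.1, fun t => (enorm_add_le _ _).trans (add_le_add (hf.2.1 t) (hg.2.1 t)),
    fun h hh => ?_⟩
  refine le_trans (le_of_eq ?_) (lintegral_sq_add_le (hf.measurable_diff h) (hg.measurable_diff h)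
    (hf.2.2 h hh) (hg.2.2 h hh))
  congr! 3 with t
  ring_nf

lemma const_mul (hf : HalfReg A f) (c : ℂ) : HalfReg (‖c‖ₑ * A) (fun t => c * f t) := by
  refine ⟨hf.1.const_mul c, fun t => ?_, fun h hh => ?_⟩
  · rw [enorm_mul]; gcongr; exact hf.2.1 t
  · simp_rw [← mul_sub, enorm_mul, mul_pow]
    rw [lintegral_const_mul _ ((hf.measurable_diff h).enorm.pow_const 2), mul_assoc]
    gcongr; exact hf.2.2 h hh

lemma conj (hf : HalfReg A f) : HalfReg A (fun t => (starRingEnd ℂ) (f t)) := by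
  refine ⟨Complex.continuous_conj.measurable.comp hf.1, fun t => ?_, fun h hh => ?_⟩
  · rw [RCLike.enorm_conj]; exact hf.2.1 t
  · simp_rw [← map_sub, RCLike.enorm_conj]; exact hf.2.2 h hh

/-- The product rule for differences puts the sup bound on one factor and the L² modulus on the
other; this is why the class carries both conditions. The factor 2 counts the two terms. -/
lemma mul (hf : HalfReg A f) (hg : HalfReg B g) : HalfReg (2 * A * B) (fun t => f t * g t) := by
  refine ⟨hf.1.mul hg.1, fun t => ?_, fun h hh => ?_⟩
  · rw [enorm_mul]
    calc ‖f t‖ₑ * ‖g t‖ₑ ≤ A * B := by gcongr; exacts [hf.2.1 t, hg.2.1 t]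
      _ = 1 * A * B := by ring
      _ ≤ _ := by gcongr; norm_num
  · have m1 : Measurable fun t => f (t + h) * (g (t + h) - g t) :=
      (hf.1.comp (measurable_id.add_const h)).mul (hg.measurable_diff h)
    have m2 : Measurable fun t => (f (t + h) - f t) * g t := (hf.measurable_diff h).mul hg.1
    have := lintegral_sq_add_le (μ := volume) (A := A * B) (B := A * B) (c := ENNReal.ofReal h)
      m1 m2 ?_ ?_
    · refine le_trans (le_of_eq ?_) (this.trans (le_of_eq ?_))
      · congr! 3 with t
        ring_nf
      · ring
    · calc ∫⁻ t, ‖f (t + h) * (g (t + h) - g t)‖ₑ ^ 2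
          ≤ ∫⁻ t, A ^ 2 * ‖g (t + h) - g t‖ₑ ^ 2 := by
            refine lintegral_mono fun t => ?_
            rw [enorm_mul, mul_pow]; gcongr; exact hf.2.1 _
        _ = A ^ 2 * ∫⁻ t, ‖g (t + h) - g t‖ₑ ^ 2 :=
            lintegral_const_mul _ ((hg.measurable_diff h).enorm.pow_const 2)
        _ ≤ A ^ 2 * (B ^ 2 * ENNReal.ofReal h) := by gcongr; exact hg.2.2 h hh
        _ = _ := by ring
    · calc ∫⁻ t, ‖(f (t + h) - f t) * g t‖ₑ ^ 2
          ≤ ∫⁻ t, B ^ 2 * ‖f (t + h) - f t‖ₑ ^ 2 := by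
            refine lintegral_mono fun t => ?_
            rw [enorm_mul, mul_pow, mul_comm]; gcongr; exact hg.2.1 _
        _ = B ^ 2 * ∫⁻ t, ‖f (t + h) - f t‖ₑ ^ 2 :=
            lintegral_const_mul _ ((hf.measurable_diff h).enorm.pow_const 2)
        _ ≤ B ^ 2 * (A ^ 2 * ENNReal.ofReal h) := by gcongr; exact hf.2.2 h hh
        _ = _ := by ring

/-- Lower semicontinuity under pointwise convergence. -/
lemma of_tendsto {F : ℕ → ℝ → ℂ} (hF : ∀ j, HalfReg A (F j))
    (hlim : ∀ t, Tendsto (fun j => F j t) atTop (𝓝 (f t))) : HalfReg A f := by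
  refine ⟨measurable_of_tendsto_metrizable (fun j => (hF j).1) (tendsto_pi_nhds.2 hlim),
    fun t => le_of_tendsto (hlim t).enorm (Eventually.of_forall fun j => (hF j).2.1 t),
    fun h hh => ?_⟩
  calc ∫⁻ t, ‖f (t + h) - f t‖ₑ ^ 2
      = ∫⁻ t, liminf (fun j => ‖F j (t + h) - F j t‖ₑ ^ 2) atTop := by
        refine lintegral_congr fun t => (Tendsto.liminf_eq ?_).symm
        exact ENNReal.Tendsto.pow ((hlim (t + h)).sub (hlim t)).enorm
    _ ≤ liminf (fun j => ∫⁻ t, ‖F j (t + h) - F j t‖ₑ ^ 2) atTop :=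
        lintegral_liminf_le fun j => ((hF j).measurable_diff h).enorm.pow_const 2
    _ ≤ A ^ 2 * ENNReal.ofReal h :=
        liminf_le_of_le (by isBoundedDefault) fun b hb => by
          obtain ⟨j, hj⟩ := hb.exists
          exact hj.trans ((hF j).2.2 h hh)

end HalfReg

/-- A shift by h can change membership in an interval only within distance h to the left of an
endpoint. -/
lemma mem_boundary_of_shift {S : Set ℝ} {a b h t : ℝ} (h1 : Ioo a b ⊆ S) (h2 : S ⊆ Icc a b)
    (hh : 0 < h) (ht : ¬ (t ∈ S ↔ t + h ∈ S)) : t ∈ Icc (a - h) a ∪ Icc (b - h) b := by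
  by_cases hS : t ∈ S
  · have hS' : t + h ∉ S := fun h' => ht ⟨fun _ => h', fun _ => hS⟩
    have := h2 hS
    right
    refine ⟨?_, this.2⟩
    by_contra hlt
    exact hS' (h1 ⟨by linarith [this.1], by linarith⟩)
  · have hS' : t + h ∈ S := by
      by_contra h'
      exact ht ⟨fun h => absurd h hS, fun h => absurd h h'⟩
    have := h2 hS'
    left
    refine ⟨by linarith [this.1], ?_⟩
    by_contra hlt
    exact hS (h1 ⟨by linarith, by linarith [this.2]⟩)

lemma volume_boundary_le (a b h : ℝ) :
    volume (Icc (a - h) a ∪ Icc (b - h) b) ≤ 2 * ENNReal.ofReal h := by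
  refine (measure_union_le _ _).trans (le_of_eq ?_)
  rw [Real.volume_Icc, Real.volume_Icc]
  ring_nf

/-- The difference of an indicator and its shift lives on a set of measure at most 2h. The supremum
over h in `HalfReg` is what admits such jumps: an indicator is not in H^{1/2}. -/
lemma halfReg_indicator_one {S : Set ℝ} {a b : ℝ} (hS : MeasurableSet S) (h1 : Ioo a b ⊆ S)
    (h2 : S ⊆ Icc a b) : HalfReg 2 (S.indicator fun _ => 1) := by
  refine ⟨measurable_const.indicator hS, fun t => ?_, fun h hh => ?_⟩
  · by_cases ht : t ∈ S <;> simp [ht]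
  · set E := Icc (a - h) a ∪ Icc (b - h) b
    have hE : MeasurableSet E := measurableSet_Icc.union measurableSet_Icc
    calc ∫⁻ t, ‖S.indicator (fun _ => (1 : ℂ)) (t + h) - S.indicator (fun _ => 1) t‖ₑ ^ 2
        ≤ ∫⁻ t, E.indicator 1 t := by
          refine lintegral_mono fun t => ?_
          by_cases ht : t ∈ E
          · by_cases h1 : t ∈ S <;> by_cases h2 : t + h ∈ S <;> simp [h1, h2, ht]
          · have := not_imp_comm.1 (mem_boundary_of_shift h1 h2 hh) ht
            by_cases h1 : t ∈ S
            · simp [h1, this.1 h1]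
            · simp [h1, mt this.2 h1]
      _ = volume E := by rw [lintegral_indicator_one hE]
      _ ≤ 2 * ENNReal.ofReal h := volume_boundary_le a b h
      _ ≤ 2 ^ 2 * ENNReal.ofReal h := by gcongr; norm_num

lemma HalfReg.indicator {A : ℝ≥0∞} {f : ℝ → ℂ} (hf : HalfReg A f) {S : Set ℝ} {a b : ℝ}
    (hS : MeasurableSet S) (h1 : Ioo a b ⊆ S) (h2 : S ⊆ Icc a b) :
    HalfReg (4 * A) (S.indicator f) := by
  have := (halfReg_indicator_one hS h1 h2).mul hf
  convert this using 1
  · ring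
  · ext t; by_cases ht : t ∈ S <;> simp [ht]

/-- A Hölder function of exponent `θ ≥ 1/2` on an interval that vanishes somewhere is small in
`HalfReg`. -/
lemma halfReg_of_holder {B a b t₀ θ : ℝ} {f : ℝ → ℂ} (hθ : 1 / 2 ≤ θ) (hB : 0 ≤ B)
    (ht₀ : t₀ ∈ Icc a b)
    (hf0 : f t₀ = 0)
    (hf : ∀ r ∈ Icc a b, ∀ r' ∈ Icc a b, ‖f r - f r'‖ ≤ B * |r - r'| ^ θ) :
    HalfReg (ENNReal.ofReal (2 * B * (b - a) ^ θ)) ((Icc a b).indicator f) := by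
  have hab : 0 ≤ b - a := by linarith [ht₀.1, ht₀.2]
  have hcont : ContinuousOn f (Icc a b) := by
    intro r hr
    rw [ContinuousWithinAt, tendsto_iff_norm_sub_tendsto_zero]
    have hlim : Tendsto (fun x => B * |x - r| ^ θ) (𝓝[Icc a b] r) (𝓝 0) := by
      have : Continuous fun x : ℝ => B * |x - r| ^ θ :=
        continuous_const.mul ((continuous_abs.comp (continuous_id.sub continuous_const)).rpow_const
          fun _ => Or.inr (by linarith))
      have h0 := this.tendsto r
      simp only [sub_self, abs_zero] at h0
      rw [Real.zero_rpow (by linarith), mul_zero] at h0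
      exact h0.mono_left nhdsWithin_le_nhds
    refine squeeze_zero' (Eventually.of_forall fun _ => norm_nonneg _) ?_ hlim
    filter_upwards [self_mem_nhdsWithin] with x hx using hf x hx r hr
  have hsup : ∀ r ∈ Icc a b, ‖f r‖ ≤ B * (b - a) ^ θ := by
    intro r hr
    have := hf r hr t₀ ht₀
    rw [hf0, sub_zero] at this
    refine this.trans (mul_le_mul_of_nonneg_left (Real.rpow_le_rpow (abs_nonneg _) ?_
      (by linarith)) hB)
    rw [abs_le]; constructor <;> linarith [hr.1, hr.2, ht₀.1, ht₀.2]
  set M := B * (b - a) ^ θ with hM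
  have hM0 : 0 ≤ M := by positivity
  refine ⟨measurable_of_restrict_of_restrict_compl (s := Icc a b) measurableSet_Icc ?_ ?_, fun t => ?_,
    fun h hh => ?_⟩
  · convert (continuousOn_iff_continuous_domRestrict.1 hcont).measurable using 1
    ext x; simp
  · convert measurable_const (a := (0 : ℂ)) using 1
    ext x; exact indicator_of_notMem x.2 f
  · rw [← ofReal_norm]
    apply ENNReal.ofReal_le_ofReal
    by_cases ht : t ∈ Icc a b
    · rw [indicator_of_mem ht]
      have := hsup t ht
      nlinarith
    · rw [indicator_of_notMem ht, norm_zero]; nlinarith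
  · set E := Icc (a - h) a ∪ Icc (b - h) b with hEdef
    have hE : MeasurableSet E := measurableSet_Icc.union measurableSet_Icc
    set g := (Icc a b).indicator f with hg
    -- If both t and t + h lie in the interval, the Hölder bound applies; if exactly one does, t
    -- lies in E, of measure at most 2h, and the sup bound M suffices.
    calc ∫⁻ t, ‖g (t + h) - g t‖ₑ ^ 2
        ≤ ∫⁻ t, (E.indicator (fun _ => ENNReal.ofReal (M ^ 2)) t
            + (Icc a (b - h)).indicator
                (fun _ => ENNReal.ofReal ((B * h ^ θ) ^ 2)) t) := by
          refine lintegral_mono fun t => ?_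
          rw [← ofReal_norm, ← ENNReal.ofReal_pow (norm_nonneg _)]
          by_cases h1 : t ∈ Icc a b <;> by_cases h2 : t + h ∈ Icc a b
          · have hm : t ∈ Icc a (b - h) := ⟨h1.1, by linarith [h2.2]⟩
            rw [indicator_of_mem hm, hg, indicator_of_mem h1, indicator_of_mem h2]
            refine le_trans (ENNReal.ofReal_le_ofReal ?_) le_add_self
            have := hf _ h2 _ h1
            rw [add_sub_cancel_left, abs_of_pos hh] at this
            gcongr
          · have hm : t ∈ E := mem_boundary_of_shift Ioo_subset_Icc_self subset_rfl hh
              (fun h => h2 (h.1 h1))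
            rw [indicator_of_mem hm, hg, indicator_of_mem h1, indicator_of_notMem h2]
            refine le_trans (ENNReal.ofReal_le_ofReal ?_) le_self_add
            rw [zero_sub, norm_neg]
            have := hsup _ h1
            gcongr
          · have hm : t ∈ E := mem_boundary_of_shift Ioo_subset_Icc_self subset_rfl hh
              (fun h => h1 (h.2 h2))
            rw [indicator_of_mem hm, hg, indicator_of_notMem h1, indicator_of_mem h2]
            refine le_trans (ENNReal.ofReal_le_ofReal ?_) le_self_add
            rw [sub_zero]
            have := hsup _ h2
            gcongr
          · rw [hg, indicator_of_notMem h1, indicator_of_notMem h2]; simp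
      _ = ENNReal.ofReal (M ^ 2) * volume E
            + ENNReal.ofReal ((B * h ^ θ) ^ 2) * volume (Icc a (b - h)) := by
          rw [lintegral_add_left (measurable_const.indicator hE), lintegral_indicator_const hE,
            lintegral_indicator_const measurableSet_Icc]
      _ ≤ ENNReal.ofReal (M ^ 2) * (2 * ENNReal.ofReal h)
            + ENNReal.ofReal (M ^ 2) * ENNReal.ofReal h := by
          refine add_le_add (mul_le_mul' le_rfl (volume_boundary_le a b h)) ?_
          · rw [Real.volume_Icc]
            rcases lt_or_ge (b - a) h with hlt | hle
            · rw [ENNReal.ofReal_of_nonpos (by linarith : b - h - a ≤ 0)]; simp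
            · rw [← ENNReal.ofReal_mul (by positivity), ← ENNReal.ofReal_mul (by positivity)]
              apply ENNReal.ofReal_le_ofReal
              -- This is where θ ≥ 1/2 enters: one power of h is split off and the remaining power
              -- 2θ - 1 ≥ 0 is bounded by that of b - a.
              have e : ∀ x : ℝ, 0 ≤ x → (x ^ θ) ^ 2 = x * x ^ (2 * θ - 1) := by
                intro x hx
                rw [← Real.rpow_natCast, ← Real.rpow_mul hx]
                rcases hx.eq_or_lt with rfl | hx
                · rw [Real.zero_rpow (by push_cast; linarith), zero_mul]
                · nth_rewrite 2 [← Real.rpow_one x]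
                  rw [← Real.rpow_add hx]; congr 1; push_cast; ring
              rw [hM, mul_pow, mul_pow, e _ hh.le, e _ hab]
              have : h ^ (2 * θ - 1) ≤ (b - a) ^ (2 * θ - 1) :=
                Real.rpow_le_rpow hh.le hle (by linarith)
              have h3 : 0 ≤ h ^ (2 * θ - 1) := by positivity
              calc B ^ 2 * (h * h ^ (2 * θ - 1)) * (b - h - a)
                  ≤ B ^ 2 * (h * (b - a) ^ (2 * θ - 1)) * (b - a) := by
                    gcongr <;> linarith
                _ = _ := by ring
      _ ≤ ENNReal.ofReal (2 * M) ^ 2 * ENNReal.ofReal h := by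
          rw [← ENNReal.ofReal_pow (by positivity)]
          have : ENNReal.ofReal ((2 * M) ^ 2) = 4 * ENNReal.ofReal (M ^ 2) := by
            rw [mul_pow, ENNReal.ofReal_mul (by norm_num)]; norm_num
          rw [this]
          calc _ = 3 * ENNReal.ofReal (M ^ 2) * ENNReal.ofReal h := by ring
            _ ≤ _ := by gcongr; norm_num
      _ = _ := by rw [hM, mul_assoc]

/-! ### The norm of the half-derivative class -/

/-- The optimal constant in `HalfReg`. -/
def yNorm (f : ℝ → ℂ) : ℝ≥0∞ := sInf {A | HalfReg A f}

lemma yNorm_le {A : ℝ≥0∞} {f : ℝ → ℂ} (h : HalfReg A f) : yNorm f ≤ A := sInf_le h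

/-- The defining inequalities are closed in the constant, so the infimum is attained. -/
lemma halfReg_yNorm {f : ℝ → ℂ} (h : yNorm f ≠ ∞) : HalfReg (yNorm f) f := by
  have hne : {A | HalfReg A f}.Nonempty := by
    by_contra hne
    rw [not_nonempty_iff_eq_empty] at hne
    exact h (by rw [yNorm, hne, sInf_empty])
  obtain ⟨u, -, hu, hmem⟩ := exists_seq_tendsto_sInf hne (OrderBot.bddBelow _)
  refine ⟨(hmem 0).1, fun t => ge_of_tendsto' hu fun j => (hmem j).2.1 t, fun r hr => ?_⟩
  refine ge_of_tendsto' (ENNReal.Tendsto.mul_const (ENNReal.Tendsto.pow hu)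
    (Or.inr ENNReal.ofReal_ne_top)) fun j => (hmem j).2.2 r hr

lemma halfReg_of_yNorm_le {A : ℝ≥0∞} {f : ℝ → ℂ} (h : yNorm f ≤ A) (hA : A ≠ ∞) : HalfReg A f :=
  (halfReg_yNorm (ne_top_of_le_ne_top hA h)).mono h

lemma enorm_le_yNorm (f : ℝ → ℂ) (t : ℝ) : ‖f t‖ₑ ≤ yNorm f := by
  by_cases h : yNorm f = ∞
  · simp [h]
  · exact (halfReg_yNorm h).2.1 t

lemma yNorm_zero : yNorm (fun _ => 0) = 0 := le_antisymm (yNorm_le HalfReg.zero) zero_le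

lemma yNorm_add_le (f g : ℝ → ℂ) : yNorm (fun t => f t + g t) ≤ yNorm f + yNorm g := by
  by_cases h : yNorm f = ∞
  · simp [h]
  by_cases h' : yNorm g = ∞
  · simp [h']
  exact yNorm_le ((halfReg_yNorm h).add (halfReg_yNorm h'))

lemma yNorm_const_mul_le (c : ℂ) (f : ℝ → ℂ) (h : yNorm f ≠ ∞) :
    yNorm (fun t => c * f t) ≤ ‖c‖ₑ * yNorm f :=
  yNorm_le ((halfReg_yNorm h).const_mul c)

lemma yNorm_sub_le (f g : ℝ → ℂ) : yNorm (fun t => f t - g t) ≤ yNorm f + yNorm g := by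
  by_cases h : yNorm f = ∞
  · simp [h]
  by_cases h' : yNorm g = ∞
  · simp [h']
  have := (halfReg_yNorm h).add ((halfReg_yNorm h').const_mul (-1))
  simpa [sub_eq_add_neg] using yNorm_le this

lemma yNorm_le_of_tendsto {A : ℝ≥0∞} {F : ℕ → ℝ → ℂ} {f : ℝ → ℂ} (hF : ∀ j, yNorm (F j) ≤ A)
    (hA : A ≠ ∞) (hlim : ∀ t, Tendsto (fun j => F j t) atTop (𝓝 (f t))) : yNorm f ≤ A :=
  yNorm_le (HalfReg.of_tendsto (fun j => halfReg_of_yNorm_le (hF j) hA) hlim)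

/-! ### Oscillatory integrals -/

/-- Non-stationary phase for functions with half a derivative. -/
lemma enorm_integral_exp_mul_sq_le {A : ℝ≥0∞} {f : ℝ → ℂ} (hf : HalfReg A f) (hA : A ≠ ∞)
    {s t Φ : ℝ} (hst : s ≤ t) (hΦ : 0 < Φ) {σ : ℝ} (hσ : σ = 1 ∨ σ = -1) :
    ‖∫ r in s..t, Complex.exp (Complex.I * ((σ * Φ * r : ℝ) : ℂ)) * f r‖ₑ ^ 2
      ≤ 8 * A ^ 2 * ENNReal.ofReal (t - s) * ENNReal.ofReal (Real.pi / Φ) := by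
  set g := (Ioc s t).indicator f with hg
  have hgr : HalfReg (4 * A) g := hf.indicator measurableSet_Ioc Ioo_subset_Ioc_self
    Ioc_subset_Icc_self
  set e : ℝ → ℂ := fun r => Complex.exp (Complex.I * ((σ * Φ * r : ℝ) : ℂ)) with he
  have he_cont : Continuous e := by fun_prop
  have he_norm : ∀ r, ‖e r‖ = 1 := fun r => by
    rw [he]; simp only; rw [mul_comm, Complex.norm_exp_ofReal_mul_I]
  -- A shift by half a period changes the sign of the exponential, so twice the integral is an
  -- integral against the difference of g.
  set h := Real.pi / Φ with hh
  have hpos : 0 < h := by positivity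
  have hshift : ∀ r, e (r + h) = - e r := by
    intro r
    have : Complex.I * ((σ * Φ * (r + h) : ℝ) : ℂ)
        = Complex.I * ((σ * Φ * r : ℝ) : ℂ) + (σ : ℂ) * (Real.pi * Complex.I) := by
      have : Φ * h = Real.pi := by rw [hh]; field_simp
      rw [mul_add, mul_assoc σ Φ h, this]; push_cast; ring
    simp only [he]
    rw [this, Complex.exp_add]
    rcases hσ with rfl | rfl
    · simp
    · simp [Complex.exp_neg]
  have hint : Integrable g := by
    refine Measure.integrableOn_of_bounded (M := A.toReal) (s := Ioc s t) (by simp)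
      hf.1.aestronglyMeasurable (Eventually.of_forall fun r => ?_) |>.integrable_indicator
      measurableSet_Ioc
    have := hf.2.1 r
    rw [← toReal_enorm]
    exact ENNReal.toReal_mono hA this
  have hint2 : Integrable fun r => e r * g r := by
    refine hint.bdd_mul (c := 1) he_cont.aestronglyMeasurable (Eventually.of_forall fun r => ?_)
    rw [he_norm]
  have hint3 : Integrable fun r => e r * g (r + h) := by
    refine (hint.comp_add_right h).bdd_mul (c := 1) he_cont.aestronglyMeasurable
      (Eventually.of_forall fun r => ?_)
    rw [he_norm]
  have e1 : ∫ r in s..t, e r * f r = ∫ r, e r * g r := by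
    rw [intervalIntegral.integral_of_le hst, ← integral_indicator measurableSet_Ioc]
    congr 1; ext r; by_cases hr : r ∈ Ioc s t <;> simp [hg, hr]
  have e2 : ∫ r, e r * g (r + h) = - ∫ r, e r * g r := by
    rw [← integral_add_right_eq_self (fun r => e r * g r) h, ← integral_neg]
    congr 1; ext r; rw [hshift]; ring
  have e3 : 2 * ∫ r, e r * g r = - ∫ r, e r * (g (r + h) - g r) := by
    simp_rw [mul_sub]
    rw [integral_sub hint3 hint2, e2]; ring
  -- The difference lives on E, and |E| ≤ 2(t - s) whatever the size of h, so half-period and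
  -- interval length need not be compared.
  set E := Ioc s t ∪ (fun r => r + h) ⁻¹' Ioc s t with hE
  have hEm : MeasurableSet E := measurableSet_Ioc.union
    (measurableSet_Ioc.preimage (measurable_id.add_const h))
  have hEv : volume E ≤ 2 * ENNReal.ofReal (t - s) := by
    refine (measure_union_le _ _).trans (le_of_eq ?_)
    rw [measure_preimage_add_right, Real.volume_Ioc]; ring
  have hvan : ∀ r, r ∉ E → g (r + h) - g r = 0 := by
    intro r hr
    have h1 : r ∉ Ioc s t := fun h' => hr (Or.inl h')
    have h2 : r + h ∉ Ioc s t := fun h' => hr (Or.inr h')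
    rw [hg, indicator_of_notMem h1, indicator_of_notMem h2, sub_zero]
  have mD := hgr.measurable_diff h
  have cs : (∫⁻ r, ‖g (r + h) - g r‖ₑ) ^ 2 ≤ volume E * ∫⁻ r, ‖g (r + h) - g r‖ₑ ^ 2 := by
    have h1 : ∫⁻ r, ‖g (r + h) - g r‖ₑ = ∫⁻ r, E.indicator 1 r * ‖g (r + h) - g r‖ₑ := by
      refine lintegral_congr fun r => ?_
      by_cases hr : r ∈ E
      · simp [hr]
      · simp [hvan r hr]
    have h2 := ENNReal.lintegral_mul_le_Lp_mul_Lq volume (p := 2) (q := 2)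
      Real.HolderConjugate.two_two ((measurable_one.indicator hEm).aemeasurable (f := E.indicator 1))
      mD.enorm.aemeasurable
    have h3 : ∫⁻ r, (E.indicator (1 : ℝ → ℝ≥0∞) r) ^ (2 : ℝ) = volume E := by
      rw [← lintegral_indicator_one hEm]
      refine lintegral_congr fun r => ?_
      by_cases hr : r ∈ E <;> simp [hr]
    rw [h1]
    simp only [Pi.mul_apply, h3] at h2
    calc _ ≤ (volume E ^ (1 / 2 : ℝ) * (∫⁻ r, ‖g (r + h) - g r‖ₑ ^ (2 : ℝ)) ^ (1 / 2 : ℝ)) ^ 2 := by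
          gcongr
      _ = _ := by
          rw [mul_pow, ← ENNReal.rpow_natCast, ← ENNReal.rpow_natCast, ← ENNReal.rpow_mul,
            ← ENNReal.rpow_mul]
          simp
  have main : (2 * ‖∫ r, e r * g r‖ₑ) ^ 2
      ≤ 2 * ENNReal.ofReal (t - s) * ((4 * A) ^ 2 * ENNReal.ofReal h) := by
    calc (2 * ‖∫ r, e r * g r‖ₑ) ^ 2 = ‖∫ r, e r * (g (r + h) - g r)‖ₑ ^ 2 := by
          rw [← enorm_neg (∫ r, e r * (g (r + h) - g r)), ← e3, enorm_mul]
          congr 2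
          rw [← ofReal_norm]; simp
      _ ≤ (∫⁻ r, ‖g (r + h) - g r‖ₑ) ^ 2 := by
          gcongr
          refine (enorm_integral_le_lintegral_enorm _).trans (lintegral_mono fun r => ?_)
          rw [enorm_mul, ← ofReal_norm, he_norm]; simp
      _ ≤ volume E * ∫⁻ r, ‖g (r + h) - g r‖ₑ ^ 2 := cs
      _ ≤ _ := by gcongr; exact hgr.2.2 h hpos
  rw [e1]
  have h4 : (4 : ℝ≥0∞) ≠ 0 := by norm_num
  rw [← ENNReal.mul_le_mul_iff_right h4 (by norm_num)]
  calc _ = (2 * ‖∫ r, e r * g r‖ₑ) ^ 2 := by ring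
    _ ≤ _ := main
    _ = _ := by ring

lemma enorm_integral_exp_mul_le_length {A : ℝ≥0∞} {f : ℝ → ℂ} (hf : ∀ r, ‖f r‖ₑ ≤ A)
    {s t : ℝ} (hst : s ≤ t) (φ : ℝ → ℝ) :
    ‖∫ r in s..t, Complex.exp (Complex.I * (φ r : ℂ)) * f r‖ₑ ≤ A * ENNReal.ofReal (t - s) := by
  rw [intervalIntegral.integral_of_le hst]
  calc _ ≤ ∫⁻ r in Ioc s t, ‖Complex.exp (Complex.I * (φ r : ℂ)) * f r‖ₑ :=
        enorm_integral_le_lintegral_enorm _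
    _ ≤ ∫⁻ _ in Ioc s t, A := by
        refine lintegral_mono fun r => ?_
        rw [enorm_mul, ← ofReal_norm, mul_comm Complex.I, Complex.norm_exp_ofReal_mul_I]
        simpa using hf r
    _ = _ := by simp

/-- Geometric interpolation, with weights 1/4 and 3/4, between the length bound and the bound with
|Φ|^{-1/2}. The exponent of the length must stay above 1/2 to regain regularity in time, and that of
|Φ| must exceed 1/4 in absolute value for the decay in k and l to be square summable; 5/8 and 3/8
meet both demands. -/
lemma enorm_integral_exp_mul_le {A : ℝ≥0∞} {f : ℝ → ℂ} (hf : HalfReg A f) (hA : A ≠ ∞)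
    {s t Φ : ℝ} (hst : s ≤ t) (hΦ : Φ ≠ 0) :
    ‖∫ r in s..t, Complex.exp (Complex.I * ((Φ * r : ℝ) : ℂ)) * f r‖ₑ
      ≤ 4 * A * ENNReal.ofReal ((t - s) ^ (5 / 8 : ℝ)) * ENNReal.ofReal (|Φ| ^ (-3 / 8 : ℝ)) := by
  have hd : 0 ≤ t - s := by linarith
  have hΦ' : 0 < |Φ| := abs_pos.2 hΦ
  set X := ‖∫ r in s..t, Complex.exp (Complex.I * ((Φ * r : ℝ) : ℂ)) * f r‖ₑ with hX
  have b1 : X ≤ A * ENNReal.ofReal (t - s) :=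
    enorm_integral_exp_mul_le_length hf.2.1 hst fun r => Φ * r
  have b2 : X ^ 2 ≤ 8 * A ^ 2 * ENNReal.ofReal (t - s) * ENNReal.ofReal (Real.pi / |Φ|) := by
    rcases abs_choice Φ with h | h
    · have := enorm_integral_exp_mul_sq_le hf hA hst hΦ' (σ := 1) (Or.inl rfl)
      rwa [h, one_mul, ← hX, ← h] at this
    · have := enorm_integral_exp_mul_sq_le hf hA hst hΦ' (σ := -1) (Or.inr rfl)
      rw [h, neg_one_mul, neg_neg, ← hX] at this
      rwa [h]
  refine (ENNReal.pow_le_pow_left_iff (n := 8) (by norm_num)).1 ?_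
  calc X ^ 8 = X ^ 2 * (X ^ 2) ^ 3 := by ring
    _ ≤ (A * ENNReal.ofReal (t - s)) ^ 2
          * (8 * A ^ 2 * ENNReal.ofReal (t - s) * ENNReal.ofReal (Real.pi / |Φ|)) ^ 3 := by
        gcongr
    _ = A ^ 8 * (512 * ENNReal.ofReal (t - s) ^ 5 * ENNReal.ofReal (Real.pi / |Φ|) ^ 3) := by ring
    _ ≤ A ^ 8 * ENNReal.ofReal (4 ^ 8 * (t - s) ^ 5 * |Φ|⁻¹ ^ 3) := by
        gcongr
        have : (512 : ℝ≥0∞) = ENNReal.ofReal 512 := by norm_num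
        rw [this, ← ENNReal.ofReal_pow hd, ← ENNReal.ofReal_pow (by positivity),
          ← ENNReal.ofReal_mul (by norm_num), ← ENNReal.ofReal_mul (by positivity)]
        apply ENNReal.ofReal_le_ofReal
        rw [div_eq_mul_inv, mul_pow]
        -- The threshold is 128 = 4⁸ / 512.
        have hpi : Real.pi ^ 3 ≤ 128 := by
          calc Real.pi ^ 3 ≤ 4 ^ 3 := by gcongr; exact Real.pi_le_four
            _ ≤ 128 := by norm_num
        have h0 : 0 ≤ (t - s) ^ 5 * |Φ|⁻¹ ^ 3 := by positivity
        nlinarith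
    _ = _ := by
        rw [mul_pow, mul_pow, mul_pow, ← ENNReal.ofReal_pow (by positivity),
          ← ENNReal.ofReal_pow (by positivity), ← Real.rpow_natCast ((t - s) ^ (5 / 8 : ℝ)),
          ← Real.rpow_mul hd, ← Real.rpow_natCast (|Φ| ^ (-3 / 8 : ℝ)), ← Real.rpow_mul hΦ'.le]
        norm_num only [Nat.cast_ofNat]
        rw [ENNReal.ofReal_mul (by positivity), ENNReal.ofReal_mul (by positivity)]
        have h5 : (t - s) ^ (5 : ℝ) = (t - s) ^ 5 := by
          rw [← Real.rpow_natCast]; norm_num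
        have h3 : |Φ| ^ (-3 : ℝ) = |Φ|⁻¹ ^ 3 := by
          rw [Real.rpow_neg hΦ'.le, inv_pow, ← Real.rpow_natCast]; norm_num
        rw [h5, h3]
        have : ENNReal.ofReal 65536 = 65536 := by norm_num
        rw [this]
        ring

/-! ### The trilinear estimate in ℓ² -/

/-- The `ℓ²` norm with values in `[0, ∞]`. -/
def l2 {ι : Type*} (a : ι → ℝ≥0∞) : ℝ≥0∞ := (∑' n, a n ^ 2) ^ (1 / 2 : ℝ)

lemma rpow_half_sq (x : ℝ≥0∞) : (x ^ (1 / 2 : ℝ)) ^ 2 = x := by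
  rw [← ENNReal.rpow_natCast, ← ENNReal.rpow_mul]; simp

lemma le_of_sq_le {x y : ℝ≥0∞} (h : x ^ 2 ≤ y ^ 2) : x ≤ y :=
  (ENNReal.pow_le_pow_left_iff (n := 2) (by norm_num)).1 h

section l2

variable {ι κ : Type*} {a b : ι → ℝ≥0∞}

lemma l2_sq (a : ι → ℝ≥0∞) : l2 a ^ 2 = ∑' n, a n ^ 2 := rpow_half_sq _

lemma l2_mono (h : ∀ n, a n ≤ b n) : l2 a ≤ l2 b := by
  unfold l2; gcongr with n; exact h n

lemma le_l2 (a : ι → ℝ≥0∞) (n : ι) : a n ≤ l2 a :=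
  le_of_sq_le (by rw [l2_sq]; exact ENNReal.le_tsum n)

lemma l2_const_mul (c : ℝ≥0∞) (a : ι → ℝ≥0∞) : l2 (fun n => c * a n) = c * l2 a := by
  have : l2 (fun n => c * a n) ^ 2 = (c * l2 a) ^ 2 := by
    rw [l2_sq, mul_pow, l2_sq, ← ENNReal.tsum_mul_left]; simp_rw [mul_pow]
  exact le_antisymm (le_of_sq_le this.le) (le_of_sq_le this.ge)

lemma l2_add_le (a b : ι → ℝ≥0∞) : l2 (fun n => a n + b n) ≤ l2 a + l2 b := by
  let _ : MeasurableSpace ι := ⊤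
  have := ENNReal.lintegral_Lp_add_le (μ := Measure.count) (p := 2) (f := a) (g := b)
    measurable_from_top.aemeasurable measurable_from_top.aemeasurable (by norm_num)
  simp only [lintegral_count, Pi.add_apply, ENNReal.rpow_ofNat] at this
  exact this

lemma tsum_mul_le_l2 (a b : ι → ℝ≥0∞) : ∑' n, a n * b n ≤ l2 a * l2 b := by
  let _ : MeasurableSpace ι := ⊤
  have := ENNReal.lintegral_mul_le_Lp_mul_Lq Measure.count (p := 2) (q := 2)
    Real.HolderConjugate.two_two (f := a) (g := b)
    measurable_from_top.aemeasurable measurable_from_top.aemeasurable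
  simp only [lintegral_count, Pi.mul_apply, ENNReal.rpow_ofNat] at this
  exact this

lemma l2_comp_equiv (e : κ ≃ ι) (a : ι → ℝ≥0∞) : l2 (fun n => a (e n)) = l2 a := by
  unfold l2; rw [e.tsum_eq (fun n => a n ^ 2)]

lemma l2_shift (a : ℤ → ℝ≥0∞) (m : ℤ) : l2 (fun n => a (m + n)) = l2 a :=
  l2_comp_equiv (Equiv.addLeft m) a

lemma l2_zero : l2 (fun _ : ι => (0 : ℝ≥0∞)) = 0 := by simp [l2]

end l2

/-- The decay `|k|^{-3/4}`, set to `0` at `k = 0`. -/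
def decay (k : ℤ) : ℝ≥0∞ := if k = 0 then 0 else ENNReal.ofReal (|(k : ℝ)| ^ (-3 / 4 : ℝ))

/-- The weight of the interaction `(n + k, n + k + l, n + l) → n`. -/
def weight (k l : ℤ) : ℝ≥0∞ :=
  (if k = 0 then 1 else 0) + (if l = 0 then 1 else 0) + decay k * decay l

/-- The majorant of the cubic interaction. -/
def trilin (a b c : ℤ → ℝ≥0∞) (n : ℤ) : ℝ≥0∞ :=
  ∑' p : ℤ × ℤ, weight p.1 p.2 * (a (n + p.1) * b (n + p.1 + p.2) * c (n + p.2))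

/-- The constant in the trilinear estimate. -/
def trilinConst : ℝ≥0∞ := 2 + ∑' k, decay k ^ 2

/-- The squared decay is |k|^{-3/2}, which is summable. -/
lemma trilinConst_ne_top : trilinConst ≠ ∞ := by
  have hs : Summable fun k : ℤ => |(k : ℝ)| ^ (-3 / 2 : ℝ) := by
    have := Real.summable_abs_int_rpow (b := 3 / 2) (by norm_num)
    convert this using 2; norm_num
  refine ENNReal.add_ne_top.2 ⟨by norm_num, ?_⟩
  refine ne_top_of_le_ne_top (hs.tsum_ofReal_ne_top) (ENNReal.tsum_le_tsum fun k => ?_)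
  unfold decay
  split_ifs with h
  · simp
  · rw [← ENNReal.ofReal_pow (by positivity), ← Real.rpow_natCast, ← Real.rpow_mul (by positivity)]
    norm_num

lemma one_le_trilinConst : 1 ≤ trilinConst := by
  unfold trilinConst
  calc (1 : ℝ≥0∞) ≤ 2 := by norm_num
    _ ≤ _ := le_self_add

/-- On k = 0, Cauchy–Schwarz in l leaves the factor a at frequency n; l = 0 is symmetric. The
remaining part is handled by Cauchy–Schwarz in (k, l) against the square-summable decay, after which
the sum over (n, k, l) factors completely, since (n, k, l) ↦ (n + k, n + k + l, n + l) is a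
bijection of ℤ³. -/
lemma l2_trilin_le (a b c : ℤ → ℝ≥0∞) :
    l2 (trilin a b c) ≤ trilinConst * (l2 a * l2 b * l2 c) := by
  set S := ∑' k, decay k ^ 2 with hS
  set Q : ℤ → ℝ≥0∞ := fun n =>
    l2 (fun p : ℤ × ℤ => a (n + p.1) * b (n + p.1 + p.2) * c (n + p.2)) with hQ
  have hpt : ∀ n, trilin a b c n ≤ l2 b * l2 c * a n + (l2 a * l2 b * c n + S * Q n) := by
    intro n
    have e1 : ∑' p : ℤ × ℤ, (if p.1 = 0 then (1 : ℝ≥0∞) else 0)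
        * (a (n + p.1) * b (n + p.1 + p.2) * c (n + p.2)) ≤ l2 b * l2 c * a n := by
      rw [ENNReal.tsum_prod', tsum_eq_single 0 (fun k hk => by simp [hk])]
      simp only [if_true, one_mul, add_zero, mul_assoc]
      rw [ENNReal.tsum_mul_left, mul_comm (a n), ← mul_assoc]
      gcongr
      have := tsum_mul_le_l2 (fun l => b (n + l)) (fun l => c (n + l))
      rwa [l2_shift, l2_shift] at this
    have e2 : ∑' p : ℤ × ℤ, (if p.2 = 0 then (1 : ℝ≥0∞) else 0)
        * (a (n + p.1) * b (n + p.1 + p.2) * c (n + p.2)) ≤ l2 a * l2 b * c n := by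
      rw [ENNReal.tsum_prod', ENNReal.tsum_comm, tsum_eq_single 0 (fun k hk => by simp [hk])]
      simp only [if_true, one_mul, add_zero]
      rw [ENNReal.tsum_mul_right]
      gcongr
      have := tsum_mul_le_l2 (fun l => a (n + l)) (fun l => b (n + l))
      rwa [l2_shift, l2_shift] at this
    have e3 : ∑' p : ℤ × ℤ, decay p.1 * decay p.2
        * (a (n + p.1) * b (n + p.1 + p.2) * c (n + p.2)) ≤ S * Q n := by
      refine (tsum_mul_le_l2 (fun p : ℤ × ℤ => decay p.1 * decay p.2) _).trans ?_
      gcongr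
      refine le_of_sq_le (le_of_eq ?_)
      rw [l2_sq, ENNReal.tsum_prod']
      simp_rw [mul_pow, ENNReal.tsum_mul_left, ENNReal.tsum_mul_right]
      rw [← hS, sq]
    unfold trilin weight
    simp_rw [add_mul]
    rw [ENNReal.tsum_add, ENNReal.tsum_add, add_assoc]
    exact add_le_add e1 (add_le_add e2 e3)
  have hQ2 : l2 Q = l2 a * l2 b * l2 c := by
    have : l2 Q ^ 2 = (l2 a * l2 b * l2 c) ^ 2 := by
      rw [l2_sq]
      simp_rw [hQ, l2_sq, mul_pow, ENNReal.tsum_prod']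
      calc ∑' (n : ℤ) (k : ℤ) (l : ℤ), a (n + k) ^ 2 * b (n + k + l) ^ 2 * c (n + l) ^ 2
          = ∑' (n : ℤ) (m : ℤ) (l : ℤ), a m ^ 2 * b (m + l) ^ 2 * c (n + l) ^ 2 := by
            congr! 2 with n
            exact (Equiv.addLeft n).tsum_eq
              (fun m => ∑' l : ℤ, a m ^ 2 * b (m + l) ^ 2 * c (n + l) ^ 2)
        _ = ∑' (m : ℤ) (l : ℤ) (n : ℤ), a m ^ 2 * b (m + l) ^ 2 * c (n + l) ^ 2 := by
            rw [ENNReal.tsum_comm]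
            congr! 2 with m
            rw [ENNReal.tsum_comm]
        _ = ∑' (m : ℤ) (l : ℤ), a m ^ 2 * b (m + l) ^ 2 * l2 c ^ 2 := by
            congr! 4 with m l
            rw [ENNReal.tsum_mul_left, l2_sq,
              (Equiv.addRight l).tsum_eq (fun n => c n ^ 2) |>.symm]
            rfl
        _ = ∑' m : ℤ, a m ^ 2 * l2 b ^ 2 * l2 c ^ 2 := by
            congr! 2 with m
            rw [ENNReal.tsum_mul_right, ENNReal.tsum_mul_left, l2_sq b,
              (Equiv.addLeft m).tsum_eq (fun n => b n ^ 2) |>.symm]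
            rfl
        _ = l2 a ^ 2 * l2 b ^ 2 * l2 c ^ 2 := by
            rw [ENNReal.tsum_mul_right, ENNReal.tsum_mul_right, ← l2_sq]
    exact le_antisymm (le_of_sq_le this.le) (le_of_sq_le this.ge)
  calc l2 (trilin a b c)
      ≤ l2 (fun n => l2 b * l2 c * a n + (l2 a * l2 b * c n + S * Q n)) := l2_mono hpt
    _ ≤ l2 b * l2 c * l2 a + (l2 a * l2 b * l2 c + S * l2 Q) := by
        refine (l2_add_le _ _).trans (add_le_add (l2_const_mul _ _).le ?_)
        refine (l2_add_le _ _).trans (add_le_add (l2_const_mul _ _).le (l2_const_mul _ _).le)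
    _ = trilinConst * (l2 a * l2 b * l2 c) := by rw [hQ2, trilinConst]; ring

/-! ### Sobolev weights -/

/-- The weight `⟨n⟩^s`. -/
def wt (s : ℝ) (n : ℤ) : ℝ≥0∞ := ENNReal.ofReal (bracket n ^ s)

lemma bracket_eq_sqrt (x : ℝ) : bracket x = Real.sqrt (1 + x ^ 2) := by
  rw [bracket, Real.sqrt_eq_rpow]

lemma one_le_bracket (x : ℝ) : 1 ≤ bracket x := by
  rw [bracket_eq_sqrt]; exact Real.one_le_sqrt.2 (by nlinarith)

lemma bracket_sq (x : ℝ) : bracket x ^ 2 = 1 + x ^ 2 := by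
  rw [bracket_eq_sqrt, Real.sq_sqrt (by positivity)]

lemma wt_zero (n : ℤ) : wt 0 n = 1 := by simp [wt]

lemma wt_ne_top (s : ℝ) (n : ℤ) : wt s n ≠ ∞ := ENNReal.ofReal_ne_top

lemma one_le_wt {s : ℝ} (hs : 0 ≤ s) (n : ℤ) : 1 ≤ wt s n := by
  rw [wt, ENNReal.one_le_ofReal]; exact Real.one_le_rpow (one_le_bracket _) hs

/-- Since n = (n + k) - (n + k + l) + (n + l), one of the three interacting frequencies has size at
least |n|/3. -/
lemma wt_le_add {s : ℝ} (hs : 0 ≤ s) (n k l : ℤ) :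
    wt s n ≤ ENNReal.ofReal (3 ^ s) * (wt s (n + k) + wt s (n + k + l) + wt s (n + l)) := by
  have key : bracket n ≤ 3 * max (bracket (n + k : ℤ)) (max (bracket (n + k + l : ℤ))
      (bracket (n + l : ℤ))) := by
    set m := max (bracket (n + k : ℤ)) (max (bracket (n + k + l : ℤ)) (bracket (n + l : ℤ))) with hm
    have h1 : bracket (n + k : ℤ) ≤ m := le_max_left _ _
    have h2 : bracket (n + k + l : ℤ) ≤ m := (le_max_left _ _).trans (le_max_right _ _)
    have h3 : bracket (n + l : ℤ) ≤ m := (le_max_right _ _).trans (le_max_right _ _)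
    have p1 := one_le_bracket (n + k : ℤ)
    have p2 := one_le_bracket (n + k + l : ℤ)
    have p3 := one_le_bracket (n + l : ℤ)
    have q1 := pow_le_pow_left₀ (by linarith) h1 2
    have q2 := pow_le_pow_left₀ (by linarith) h2 2
    have q3 := pow_le_pow_left₀ (by linarith) h3 2
    rw [bracket_sq] at q1 q2 q3
    push_cast at q1 q2 q3
    refine (sq_le_sq₀ (by linarith [one_le_bracket (n : ℝ)]) (by linarith)).1 ?_
    rw [bracket_sq]
    nlinarith [sq_nonneg ((n : ℝ) + k + (n + k + l)), sq_nonneg ((n : ℝ) + l + (n + k + l)),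
      sq_nonneg ((k : ℝ) - l)]
  have hb : ∀ x : ℝ, 0 ≤ bracket x ^ s := fun x =>
    Real.rpow_nonneg (zero_le_one.trans (one_le_bracket x)) s
  have hb0 : ∀ x : ℝ, 0 ≤ bracket x := fun x => zero_le_one.trans (one_le_bracket x)
  unfold wt
  rw [← ENNReal.ofReal_add (hb _) (hb _), ← ENNReal.ofReal_add (add_nonneg (hb _) (hb _)) (hb _),
    ← ENNReal.ofReal_mul (by positivity)]
  apply ENNReal.ofReal_le_ofReal
  have h1 := Real.rpow_le_rpow (hb0 n) key hs
  rw [Real.mul_rpow (by norm_num) (le_max_of_le_left (hb0 _))] at h1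
  refine h1.trans ?_
  gcongr
  rcases max_choice (bracket (n + k : ℤ)) (max (bracket (n + k + l : ℤ)) (bracket (n + l : ℤ)))
    with h | h
  · rw [h]; linarith [hb (n + k : ℤ), hb (n + k + l : ℤ), hb (n + l : ℤ)]
  · rw [h]
    rcases max_choice (bracket (n + k + l : ℤ)) (bracket (n + l : ℤ)) with h | h
    · rw [h]; linarith [hb (n + k : ℤ), hb (n + k + l : ℤ), hb (n + l : ℤ)]
    · rw [h]; linarith [hb (n + k : ℤ), hb (n + k + l : ℤ), hb (n + l : ℤ)]

lemma wt_mul_trilin_le {s : ℝ} (hs : 0 ≤ s) (a b c : ℤ → ℝ≥0∞) (n : ℤ) :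
    wt s n * trilin a b c n ≤ ENNReal.ofReal (3 ^ s) *
      (trilin (fun m => wt s m * a m) b c n + trilin a (fun m => wt s m * b m) c n
        + trilin a b (fun m => wt s m * c m) n) := by
  unfold trilin
  rw [← ENNReal.tsum_add, ← ENNReal.tsum_add, ← ENNReal.tsum_mul_left, ← ENNReal.tsum_mul_left]
  refine ENNReal.tsum_le_tsum fun p => ?_
  calc _ ≤ ENNReal.ofReal (3 ^ s) * (wt s (n + p.1) + wt s (n + p.1 + p.2) + wt s (n + p.2))
        * (weight p.1 p.2 * (a (n + p.1) * b (n + p.1 + p.2) * c (n + p.2))) := by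
        gcongr; exact wt_le_add hs n p.1 p.2
    _ = _ := by ring

/-- The weighted `ℓ²` norm. -/
def wl2 (s : ℝ) (a : ℤ → ℝ≥0∞) : ℝ≥0∞ := l2 fun n => wt s n * a n

lemma wl2_zero (a : ℤ → ℝ≥0∞) : wl2 0 a = l2 a := by simp [wl2, wt_zero]

lemma wl2_mono {s : ℝ} {a b : ℤ → ℝ≥0∞} (h : ∀ n, a n ≤ b n) : wl2 s a ≤ wl2 s b :=
  l2_mono fun n => by gcongr; exact h n

lemma l2_le_wl2 {s : ℝ} (hs : 0 ≤ s) (a : ℤ → ℝ≥0∞) : l2 a ≤ wl2 s a :=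
  l2_mono fun n => le_mul_of_one_le_left' (one_le_wt hs n)

lemma wl2_add_le (s : ℝ) (a b : ℤ → ℝ≥0∞) : wl2 s (fun n => a n + b n) ≤ wl2 s a + wl2 s b := by
  unfold wl2; simp_rw [mul_add]; exact l2_add_le _ _

lemma wl2_const_mul (s : ℝ) (c : ℝ≥0∞) (a : ℤ → ℝ≥0∞) :
    wl2 s (fun n => c * a n) = c * wl2 s a := by
  unfold wl2; rw [← l2_const_mul]; simp_rw [mul_left_comm]

/-- A tame estimate: each term is linear in the weighted norm and the other two factors are measured
in ℓ² only. This is why the existence time is governed by the L² size of the data. -/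
lemma wl2_trilin_le {s : ℝ} (hs : 0 ≤ s) (a b c : ℤ → ℝ≥0∞) :
    wl2 s (trilin a b c) ≤ ENNReal.ofReal (3 ^ s) * trilinConst *
      (wl2 s a * l2 b * l2 c + l2 a * wl2 s b * l2 c + l2 a * l2 b * wl2 s c) := by
  calc wl2 s (trilin a b c)
      ≤ l2 fun n => ENNReal.ofReal (3 ^ s) *
        ((trilin (fun m => wt s m * a m) b c n + trilin a (fun m => wt s m * b m) c n)
          + trilin a b (fun m => wt s m * c m) n) := l2_mono (wt_mul_trilin_le hs a b c)
    _ ≤ ENNReal.ofReal (3 ^ s) * (trilinConst * (wl2 s a * l2 b * l2 c)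
          + trilinConst * (l2 a * wl2 s b * l2 c) + trilinConst * (l2 a * l2 b * wl2 s c)) := by
        rw [l2_const_mul]
        gcongr
        refine (l2_add_le _ _).trans (add_le_add ((l2_add_le _ _).trans (add_le_add ?_ ?_)) ?_) <;>
          exact l2_trilin_le _ _ _
    _ = _ := by ring

/-! ### Resonances and the time-integrated nonlinearity -/

/-- The resonance function `n⁴ - (n+k)⁴ + (n+k+l)⁴ - (n+l)⁴`. -/
def phase (n k l : ℤ) : ℝ :=
  (n : ℝ) ^ 4 - ((n + k : ℤ) : ℝ) ^ 4 + ((n + k + l : ℤ) : ℝ) ^ 4 - ((n + l : ℤ) : ℝ) ^ 4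

/-- The resonance function factors as kl times a positive quadratic form that is at least k² + l² ≥
|kl|, uniformly in n. -/
lemma sq_mul_sq_le_abs_phase (n k l : ℤ) : ((k : ℝ) ^ 2 * (l : ℝ) ^ 2) ≤ |phase n k l| := by
  have e : phase n k l = (k * l : ℝ) *
      (12 * ((n : ℝ) + (k + l) / 2) ^ 2 + k ^ 2 + l ^ 2) := by
    unfold phase; push_cast; ring
  rw [e, abs_mul]
  have h1 : |(k * l : ℝ)| ≤ |12 * ((n : ℝ) + (k + l) / 2) ^ 2 + k ^ 2 + l ^ 2| := by
    rw [abs_of_nonneg (by positivity : 0 ≤ 12 * ((n : ℝ) + (k + l) / 2) ^ 2 + k ^ 2 + l ^ 2)]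
    rw [abs_le]
    constructor <;> nlinarith [sq_nonneg ((k : ℝ) + l), sq_nonneg ((k : ℝ) - l),
      sq_nonneg ((n : ℝ) + (k + l) / 2)]
  calc (k : ℝ) ^ 2 * (l : ℝ) ^ 2 = |(k * l : ℝ)| * |(k * l : ℝ)| := by rw [abs_mul_abs_self]; ring
    _ ≤ _ := by gcongr

lemma phase_decay_le (n k l : ℤ) (hk : k ≠ 0) (hl : l ≠ 0) :
    phase n k l ≠ 0 ∧ ENNReal.ofReal (|phase n k l| ^ (-3 / 8 : ℝ)) ≤ decay k * decay l := by
  have h := sq_mul_sq_le_abs_phase n k l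
  have hk' : (0 : ℝ) < |(k : ℝ)| := by positivity
  have hl' : (0 : ℝ) < |(l : ℝ)| := by positivity
  have hpos : (0 : ℝ) < (k : ℝ) ^ 2 * (l : ℝ) ^ 2 := by positivity
  refine ⟨fun h0 => by rw [h0, abs_zero] at h; linarith, ?_⟩
  rw [decay, decay, if_neg hk, if_neg hl, ← ENNReal.ofReal_mul (by positivity)]
  apply ENNReal.ofReal_le_ofReal
  refine (Real.rpow_le_rpow_of_nonpos hpos h (by norm_num)).trans (le_of_eq ?_)
  rw [← sq_abs (k : ℝ), ← sq_abs (l : ℝ), Real.mul_rpow (by positivity) (by positivity),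
    ← Real.rpow_natCast, ← Real.rpow_natCast, ← Real.rpow_mul hk'.le, ← Real.rpow_mul hl'.le]
  norm_num

/-- The modulus of continuity in time of the cubic interaction. -/
def gain (d : ℝ) : ℝ := max (d ^ (5 / 8 : ℝ)) d

lemma gain_of_le_one {d : ℝ} (hd : 0 ≤ d) (h1 : d ≤ 1) : gain d = d ^ (5 / 8 : ℝ) := by
  refine max_eq_left ?_
  rcases hd.eq_or_lt with rfl | h
  · positivity
  · calc d = d ^ (1 : ℝ) := (Real.rpow_one d).symm
      _ ≤ _ := Real.rpow_le_rpow_of_exponent_ge h h1 (by norm_num)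

/-- Families of Fourier coefficients depending on time. -/
abbrev Family : Type := ℤ → ℝ → ℂ

/-- The sequence of `yNorm`s of a family. -/
def yn (v : Family) (n : ℤ) : ℝ≥0∞ := yNorm (v n)

lemma intervalIntegrable_exp_mul {A : ℝ≥0∞} {f : ℝ → ℂ} (hm : Measurable f)
    (hf : ∀ r, ‖f r‖ₑ ≤ A) (hA : A ≠ ∞) (Φ s t : ℝ) :
    IntervalIntegrable (fun r => Complex.exp (Complex.I * ((Φ * r : ℝ) : ℂ)) * f r) volume s t := by
  rw [intervalIntegrable_iff]
  refine Measure.integrableOn_of_bounded (M := A.toReal) (by simp) ?_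
    (Eventually.of_forall fun r => ?_)
  · exact (Continuous.aestronglyMeasurable (by fun_prop)).mul hm.aestronglyMeasurable
  · rw [norm_mul, mul_comm Complex.I, Complex.norm_exp_ofReal_mul_I, one_mul, ← toReal_enorm]
    exact ENNReal.toReal_mono hA (hf r)

/-- One cubic product of coefficients. -/
def cub (v₁ v₂ v₃ : Family) (n : ℤ) (p : ℤ × ℤ) (r : ℝ) : ℂ :=
  v₁ (n + p.1) r * (starRingEnd ℂ) (v₂ (n + p.1 + p.2) r) * v₃ (n + p.2) r

/-- One interaction integrated in time. -/
def osc (v₁ v₂ v₃ : Family) (n : ℤ) (p : ℤ × ℤ) (s t : ℝ) : ℂ :=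
  ∫ r in s..t, Complex.exp (Complex.I * ((phase n p.1 p.2 * r : ℝ) : ℂ)) * cub v₁ v₂ v₃ n p r

/-- The time-integrated cubic nonlinearity in the interaction representation. -/
def gam (v₁ v₂ v₃ : Family) (n : ℤ) (s t : ℝ) : ℂ := ∑' p : ℤ × ℤ, osc v₁ v₂ v₃ n p s t

/-- The resonant cases k = 0 and l = 0 use the length of the interval alone, the others the
oscillation; these are the two entries of `gain`. -/
lemma enorm_integral_phase_le {A : ℝ≥0∞} {f : ℝ → ℂ} (hf : HalfReg A f) (hA : A ≠ ∞) (n k l : ℤ)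
    (s t : ℝ) :
    ‖∫ r in s..t, Complex.exp (Complex.I * ((phase n k l * r : ℝ) : ℂ)) * f r‖ₑ
      ≤ 4 * ENNReal.ofReal (gain |t - s|) * (weight k l * A) := by
  wlog hst : s ≤ t generalizing s t
  · rw [intervalIntegral.integral_symm, enorm_neg, abs_sub_comm]
    exact this t s (le_of_not_ge hst)
  rw [abs_of_nonneg (by linarith : 0 ≤ t - s)]
  have hres : 1 ≤ weight k l → ‖∫ r in s..t, Complex.exp (Complex.I *
      ((phase n k l * r : ℝ) : ℂ)) * f r‖ₑ ≤ 4 * ENNReal.ofReal (gain (t - s)) * (weight k l * A) := by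
    intro h1
    refine (enorm_integral_exp_mul_le_length hf.2.1 hst fun r => phase n k l * r).trans ?_
    calc A * ENNReal.ofReal (t - s) = 1 * ENNReal.ofReal (t - s) * (1 * A) := by ring
      _ ≤ _ := by gcongr; exacts [by norm_num, le_max_right _ _]
  by_cases hk : k = 0
  · refine hres ?_; simp only [weight, hk, if_true]; rw [add_assoc]; exact le_self_add
  by_cases hl : l = 0
  · refine hres ?_; simp only [weight, hl, if_true]; rw [add_comm (ite _ _ _), add_assoc]
    exact le_self_add
  obtain ⟨h0, h1⟩ := phase_decay_le n k l hk hl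
  refine (enorm_integral_exp_mul_le hf hA hst h0).trans ?_
  calc _ = 4 * ENNReal.ofReal ((t - s) ^ (5 / 8 : ℝ)) *
        (ENNReal.ofReal (|phase n k l| ^ (-3 / 8 : ℝ)) * A) := by ring
    _ ≤ _ := by
      gcongr
      · exact le_max_left _ _
      · exact h1.trans le_add_self

section bounds

variable {v₁ v₂ v₃ : Family}

lemma yn_ne_top {v : Family} (h : l2 (yn v) ≠ ∞) (n : ℤ) : yn v n ≠ ∞ :=
  ne_top_of_le_ne_top h (le_l2 _ n)

/-- Two applications of the product rule, hence the factor 4. -/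
lemma halfReg_cub (h₁ : l2 (yn v₁) ≠ ∞) (h₂ : l2 (yn v₂) ≠ ∞) (h₃ : l2 (yn v₃) ≠ ∞) (n : ℤ)
    (p : ℤ × ℤ) :
    HalfReg (4 * (yn v₁ (n + p.1) * yn v₂ (n + p.1 + p.2) * yn v₃ (n + p.2)))
      (cub v₁ v₂ v₃ n p) := by
  have := ((halfReg_yNorm (yn_ne_top h₁ (n + p.1))).mul
    (halfReg_yNorm (yn_ne_top h₂ (n + p.1 + p.2))).conj).mul (halfReg_yNorm (yn_ne_top h₃ (n + p.2)))
  refine this.mono (le_of_eq ?_)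
  unfold yn; ring

lemma cub_const_ne_top (h₁ : l2 (yn v₁) ≠ ∞) (h₂ : l2 (yn v₂) ≠ ∞) (h₃ : l2 (yn v₃) ≠ ∞) (n : ℤ)
    (p : ℤ × ℤ) : 4 * (yn v₁ (n + p.1) * yn v₂ (n + p.1 + p.2) * yn v₃ (n + p.2)) ≠ ∞ :=
  ENNReal.mul_ne_top (by norm_num) (ENNReal.mul_ne_top (ENNReal.mul_ne_top (yn_ne_top h₁ _)
    (yn_ne_top h₂ _)) (yn_ne_top h₃ _))

lemma intervalIntegrable_osc (h₁ : l2 (yn v₁) ≠ ∞) (h₂ : l2 (yn v₂) ≠ ∞) (h₃ : l2 (yn v₃) ≠ ∞)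
    (n : ℤ) (p : ℤ × ℤ) (s t : ℝ) :
    IntervalIntegrable (fun r => Complex.exp (Complex.I * ((phase n p.1 p.2 * r : ℝ) : ℂ))
      * cub v₁ v₂ v₃ n p r) volume s t :=
  intervalIntegrable_exp_mul (halfReg_cub h₁ h₂ h₃ n p).1 (halfReg_cub h₁ h₂ h₃ n p).2.1
    (cub_const_ne_top h₁ h₂ h₃ n p) _ _ _

lemma enorm_osc_le (h₁ : l2 (yn v₁) ≠ ∞) (h₂ : l2 (yn v₂) ≠ ∞) (h₃ : l2 (yn v₃) ≠ ∞) (n : ℤ)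
    (p : ℤ × ℤ) (s t : ℝ) :
    ‖osc v₁ v₂ v₃ n p s t‖ₑ ≤ 16 * ENNReal.ofReal (gain |t - s|) *
      (weight p.1 p.2 * (yn v₁ (n + p.1) * yn v₂ (n + p.1 + p.2) * yn v₃ (n + p.2))) := by
  refine (enorm_integral_phase_le (halfReg_cub h₁ h₂ h₃ n p) (cub_const_ne_top h₁ h₂ h₃ n p)
    n p.1 p.2 s t).trans (le_of_eq ?_)
  ring

lemma trilin_ne_top {a b c : ℤ → ℝ≥0∞} (ha : l2 a ≠ ∞) (hb : l2 b ≠ ∞) (hc : l2 c ≠ ∞) (n : ℤ) :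
    trilin a b c n ≠ ∞ :=
  ne_top_of_le_ne_top (ENNReal.mul_ne_top trilinConst_ne_top
    (ENNReal.mul_ne_top (ENNReal.mul_ne_top ha hb) hc)) ((le_l2 _ n).trans (l2_trilin_le a b c))

lemma tsum_enorm_osc_le (h₁ : l2 (yn v₁) ≠ ∞) (h₂ : l2 (yn v₂) ≠ ∞) (h₃ : l2 (yn v₃) ≠ ∞) (n : ℤ)
    (s t : ℝ) : ∑' p, ‖osc v₁ v₂ v₃ n p s t‖ₑ
      ≤ 16 * ENNReal.ofReal (gain |t - s|) * trilin (yn v₁) (yn v₂) (yn v₃) n := by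
  unfold trilin
  rw [← ENNReal.tsum_mul_left]
  exact ENNReal.tsum_le_tsum fun p => enorm_osc_le h₁ h₂ h₃ n p s t

lemma summable_of_tsum_enorm {ι : Type*} {f : ι → ℂ} (h : ∑' i, ‖f i‖ₑ ≠ ∞) : Summable f :=
  (tsum_enorm_ne_top_iff_summable_norm.1 h).of_norm

lemma summable_osc (h₁ : l2 (yn v₁) ≠ ∞) (h₂ : l2 (yn v₂) ≠ ∞) (h₃ : l2 (yn v₃) ≠ ∞) (n : ℤ)
    (s t : ℝ) : Summable fun p => osc v₁ v₂ v₃ n p s t :=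
  summable_of_tsum_enorm (ne_top_of_le_ne_top (ENNReal.mul_ne_top (ENNReal.mul_ne_top
    (by norm_num) ENNReal.ofReal_ne_top) (trilin_ne_top h₁ h₂ h₃ n))
    (tsum_enorm_osc_le h₁ h₂ h₃ n s t))

lemma enorm_gam_le (h₁ : l2 (yn v₁) ≠ ∞) (h₂ : l2 (yn v₂) ≠ ∞) (h₃ : l2 (yn v₃) ≠ ∞) (n : ℤ)
    (s t : ℝ) : ‖gam v₁ v₂ v₃ n s t‖ₑ
      ≤ 16 * ENNReal.ofReal (gain |t - s|) * trilin (yn v₁) (yn v₂) (yn v₃) n :=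
  enorm_tsum_le_tsum_enorm.trans (tsum_enorm_osc_le h₁ h₂ h₃ n s t)

lemma gam_add_adjacent (h₁ : l2 (yn v₁) ≠ ∞) (h₂ : l2 (yn v₂) ≠ ∞) (h₃ : l2 (yn v₃) ≠ ∞) (n : ℤ)
    (s t u : ℝ) : gam v₁ v₂ v₃ n s t + gam v₁ v₂ v₃ n t u = gam v₁ v₂ v₃ n s u := by
  unfold gam
  rw [← (summable_osc h₁ h₂ h₃ n s t).tsum_add (summable_osc h₁ h₂ h₃ n t u)]
  congr 1; ext p
  exact intervalIntegral.integral_add_adjacent_intervals (intervalIntegrable_osc h₁ h₂ h₃ n p s t)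
    (intervalIntegrable_osc h₁ h₂ h₃ n p t u)

lemma gam_self (n : ℤ) (s : ℝ) : gam v₁ v₂ v₃ n s s = 0 := by simp [gam, osc]

lemma osc_congr {w₁ w₂ w₃ : Family} {a b : ℝ} (e₁ : ∀ n, EqOn (v₁ n) (w₁ n) (Icc a b))
    (e₂ : ∀ n, EqOn (v₂ n) (w₂ n) (Icc a b)) (e₃ : ∀ n, EqOn (v₃ n) (w₃ n) (Icc a b))
    (n : ℤ) (p : ℤ × ℤ) {s t : ℝ} (hs : s ∈ Icc a b) (ht : t ∈ Icc a b) :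
    osc v₁ v₂ v₃ n p s t = osc w₁ w₂ w₃ n p s t := by
  refine intervalIntegral.integral_congr fun r hr => ?_
  have hr' := uIcc_subset_Icc hs ht hr
  simp only [cub, e₁ _ hr', e₂ _ hr', e₃ _ hr']

lemma gam_congr {w₁ w₂ w₃ : Family} {a b : ℝ} (e₁ : ∀ n, EqOn (v₁ n) (w₁ n) (Icc a b))
    (e₂ : ∀ n, EqOn (v₂ n) (w₂ n) (Icc a b)) (e₃ : ∀ n, EqOn (v₃ n) (w₃ n) (Icc a b))
    (n : ℤ) {s t : ℝ} (hs : s ∈ Icc a b) (ht : t ∈ Icc a b) :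
    gam v₁ v₂ v₃ n s t = gam w₁ w₂ w₃ n s t :=
  tsum_congr fun p => osc_congr e₁ e₂ e₃ n p hs ht

lemma l2_yn_sub_ne_top {v w : Family} (hv : l2 (yn v) ≠ ∞) (hw : l2 (yn w) ≠ ∞) :
    l2 (yn (v - w)) ≠ ∞ :=
  ne_top_of_le_ne_top (ENNReal.add_ne_top.2 ⟨hv, hw⟩)
    ((l2_mono fun n => yNorm_sub_le (v n) (w n)).trans (l2_add_le _ _))

/-- Telescoping in the three slots; the absolute convergence of all five series comes from the
trilinear estimate. -/
lemma gam_sub {v w : Family} (hv : l2 (yn v) ≠ ∞) (hw : l2 (yn w) ≠ ∞) (n : ℤ) (s t : ℝ) :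
    gam v v v n s t - gam w w w n s t
      = gam (v - w) v v n s t + gam w (v - w) v n s t + gam w w (v - w) n s t := by
  have hd := l2_yn_sub_ne_top hv hw
  unfold gam
  rw [← (summable_osc hv hv hv n s t).tsum_sub (summable_osc hw hw hw n s t),
    ← (summable_osc hd hv hv n s t).tsum_add (summable_osc hw hd hv n s t),
    ← ((summable_osc hd hv hv n s t).add (summable_osc hw hd hv n s t)).tsum_add
      (summable_osc hw hw hd n s t)]
  congr 1; ext p
  unfold osc
  rw [← intervalIntegral.integral_sub (intervalIntegrable_osc hv hv hv n p s t)
      (intervalIntegrable_osc hw hw hw n p s t),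
    ← intervalIntegral.integral_add (intervalIntegrable_osc hd hv hv n p s t)
      (intervalIntegrable_osc hw hd hv n p s t),
    ← intervalIntegral.integral_add ((intervalIntegrable_osc hd hv hv n p s t).add
      (intervalIntegrable_osc hw hd hv n p s t)) (intervalIntegrable_osc hw hw hd n p s t)]
  congr 1; ext r
  simp only [cub, Pi.sub_apply, map_sub]
  ring

/-- The time-integrated nonlinearity is small on short intervals. -/
lemma yNorm_gam_le (h₁ : l2 (yn v₁) ≠ ∞) (h₂ : l2 (yn v₂) ≠ ∞) (h₃ : l2 (yn v₃) ≠ ∞) (n : ℤ)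
    {a b t₀ : ℝ} (ht₀ : t₀ ∈ Icc a b) (hab : b - a ≤ 1) :
    yNorm ((Icc a b).indicator fun t => gam v₁ v₂ v₃ n t₀ t)
      ≤ 32 * ENNReal.ofReal ((b - a) ^ (5 / 8 : ℝ)) * trilin (yn v₁) (yn v₂) (yn v₃) n := by
  set M := trilin (yn v₁) (yn v₂) (yn v₃) n with hM
  have hMt : M ≠ ∞ := trilin_ne_top h₁ h₂ h₃ n
  refine (yNorm_le (halfReg_of_holder (θ := 5 / 8) (by norm_num) (B := 16 * M.toReal) (by positivity) ht₀ (gam_self n t₀)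
    fun r hr r' hr' => ?_)).trans (le_of_eq ?_)
  · have e : gam v₁ v₂ v₃ n t₀ r - gam v₁ v₂ v₃ n t₀ r' = gam v₁ v₂ v₃ n r' r := by
      rw [← gam_add_adjacent h₁ h₂ h₃ n t₀ r' r]; ring
    have hle := enorm_gam_le h₁ h₂ h₃ n r' r
    have h1 : |r - r'| ≤ 1 := by rw [abs_le]; constructor <;> linarith [hr.1, hr.2, hr'.1, hr'.2]
    rw [gain_of_le_one (abs_nonneg _) h1, ← hM] at hle
    rw [e, ← toReal_enorm]
    refine (ENNReal.toReal_mono (ENNReal.mul_ne_top (ENNReal.mul_ne_top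
      (by norm_num) ENNReal.ofReal_ne_top) hMt) hle).trans (le_of_eq ?_)
    rw [ENNReal.toReal_mul, ENNReal.toReal_mul, ENNReal.toReal_ofReal (by positivity)]
    norm_num; ring
  · rw [ENNReal.ofReal_mul (by positivity), ENNReal.ofReal_mul (by positivity),
      ENNReal.ofReal_mul (by positivity), ENNReal.ofReal_toReal hMt]
    norm_num
    ring

end bounds

/-! ### Local theory in the interaction representation -/

/-- Restriction of a family to a time interval, extended by zero. -/
def cut (a b : ℝ) (v : Family) : Family := fun n => (Icc a b).indicator (v n)

/-- Solutions on `[a, b]` of the equation in the interaction representation, with coefficient `c`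
in front of the nonlinearity. -/
structure IsSol (c : ℂ) (a b : ℝ) (v : Family) : Prop where
  fin : l2 (yn (cut a b v)) ≠ ∞
  eq : ∀ n, ∀ s ∈ Icc a b, ∀ t ∈ Icc a b,
    v n t - v n s = c * gam (cut a b v) (cut a b v) (cut a b v) n s t

/-- The sequence of absolute values of Fourier coefficients. -/
def mag (φ : ℤ → ℂ) (n : ℤ) : ℝ≥0∞ := ‖φ n‖ₑ

lemma cut_eqOn (a b : ℝ) (v : Family) (n : ℤ) : EqOn (cut a b v n) (v n) (Icc a b) :=
  fun _ ht => indicator_of_mem ht _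

lemma cut_cut {a b a' b' : ℝ} (h : Icc a' b' ⊆ Icc a b) (v : Family) :
    cut a' b' (cut a b v) = cut a' b' v := by
  ext n t
  by_cases ht : t ∈ Icc a' b'
  · simp only [cut, indicator_of_mem ht, indicator_of_mem (h ht)]
  · simp only [cut, indicator_of_notMem ht]

lemma cut_sub (a b : ℝ) (v w : Family) : cut a b (v - w) = cut a b v - cut a b w := by
  ext n t
  by_cases ht : t ∈ Icc a b
  · simp only [cut, indicator_of_mem ht, Pi.sub_apply]
  · simp only [cut, indicator_of_notMem ht, Pi.sub_apply, sub_self]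

lemma yn_cut_le (a b : ℝ) (v : Family) (n : ℤ) : yn (cut a b v) n ≤ 4 * yn v n := by
  by_cases h : yNorm (v n) = ∞
  · simp [yn, h]
  · exact yNorm_le ((halfReg_yNorm h).indicator measurableSet_Icc Ioo_subset_Icc_self subset_rfl)

/-- Restricting to a subinterval multiplies by an indicator, which is bounded but not contractive
for `yNorm`; the loss of 4 recurs whenever norms on nested intervals are compared. -/
lemma wl2_yn_cut_le {a b a' b' : ℝ} (h : Icc a' b' ⊆ Icc a b) (s : ℝ) (v : Family) :
    wl2 s (yn (cut a' b' v)) ≤ 4 * wl2 s (yn (cut a b v)) := by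
  rw [← wl2_const_mul, ← cut_cut h]
  exact wl2_mono (yn_cut_le a' b' _)

lemma l2_yn_cut_le {a b a' b' : ℝ} (h : Icc a' b' ⊆ Icc a b) (v : Family) :
    l2 (yn (cut a' b' v)) ≤ 4 * l2 (yn (cut a b v)) := by
  simpa only [wl2_zero] using wl2_yn_cut_le h 0 v

lemma IsSol.restrict {c : ℂ} {a b a' b' : ℝ} {v : Family} (hv : IsSol c a b v)
    (h : Icc a' b' ⊆ Icc a b) : IsSol c a' b' v := by
  refine ⟨ne_top_of_le_ne_top (ENNReal.mul_ne_top (by norm_num) hv.fin) (l2_yn_cut_le h v),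
    fun n s hs t ht => ?_⟩
  rw [hv.eq n s (h hs) t (h ht)]
  have e : ∀ n, EqOn (cut a b v n) (cut a' b' v n) (Icc a' b') := fun n r hr => by
    rw [cut_eqOn a b v n (h hr), cut_eqOn a' b' v n hr]
  rw [gam_congr e e e n hs ht]

lemma mag_le_yn_cut {a b t : ℝ} (ht : t ∈ Icc a b) (v : Family) (n : ℤ) :
    mag (fun m => v m t) n ≤ yn (cut a b v) n := by
  have := enorm_le_yNorm (cut a b v n) t
  rwa [cut_eqOn a b v n ht] at this

/-- The constant in the local theory in `H^s`. -/
def locConst (s : ℝ) : ℝ≥0∞ := 96 * ENNReal.ofReal (3 ^ s) * trilinConst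

/-- The bound for one Picard step. The datum enters as a constant times an indicator, whose
`HalfReg` size is 2. -/
lemma yn_affine_le {c : ℂ} (hc : ‖c‖ₑ ≤ 1) {v : Family} (hv : l2 (yn v) ≠ ∞) {a b t₀ : ℝ}
    (ht₀ : t₀ ∈ Icc a b) (hab : b - a ≤ 1) (φ : ℤ → ℂ) (n : ℤ) :
    yNorm ((Icc a b).indicator fun t => φ n + c * gam v v v n t₀ t)
      ≤ 2 * mag φ n + 32 * ENNReal.ofReal ((b - a) ^ (5 / 8 : ℝ))
        * trilin (yn v) (yn v) (yn v) n := by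
  have e : ((Icc a b).indicator fun t => φ n + c * gam v v v n t₀ t)
      = fun t => φ n * (Icc a b).indicator (fun _ => 1) t
        + c * (Icc a b).indicator (fun t => gam v v v n t₀ t) t := by
    ext t; by_cases ht : t ∈ Icc a b
    · simp only [indicator_of_mem ht, mul_one]
    · simp only [indicator_of_notMem ht, mul_zero, add_zero]
  have h1 := yNorm_gam_le hv hv hv n ht₀ hab
  have h2 : yNorm ((Icc a b).indicator fun t => gam v v v n t₀ t) ≠ ∞ :=
    ne_top_of_le_ne_top (ENNReal.mul_ne_top (ENNReal.mul_ne_top (by norm_num)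
      ENNReal.ofReal_ne_top) (trilin_ne_top hv hv hv n)) h1
  rw [e]
  refine (yNorm_add_le _ _).trans (add_le_add ?_ ((yNorm_const_mul_le c _ h2).trans ?_))
  · rw [mul_comm]
    exact yNorm_le ((halfReg_indicator_one measurableSet_Icc Ioo_subset_Icc_self
      subset_rfl).const_mul (φ n))
  · exact (mul_le_of_le_one_left' hc).trans h1

lemma wl2_trilin_diag_le {s : ℝ} (hs : 0 ≤ s) (a : ℤ → ℝ≥0∞) (d : ℝ≥0∞) :
    wl2 s (fun n => 32 * d * trilin a a a n) ≤ locConst s * d * l2 a ^ 2 * wl2 s a := by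
  rw [wl2_const_mul]
  refine (mul_le_mul' le_rfl (wl2_trilin_le hs a a a)).trans (le_of_eq ?_)
  rw [locConst]; ring

lemma yn_gam_sub_le {c : ℂ} (hc : ‖c‖ₑ ≤ 1) {v w : Family} (hv : l2 (yn v) ≠ ∞)
    (hw : l2 (yn w) ≠ ∞) {a b t₀ : ℝ} (ht₀ : t₀ ∈ Icc a b) (hab : b - a ≤ 1) (n : ℤ) :
    yNorm ((Icc a b).indicator fun t => c * (gam v v v n t₀ t - gam w w w n t₀ t))
      ≤ 32 * ENNReal.ofReal ((b - a) ^ (5 / 8 : ℝ)) *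
        (trilin (yn (v - w)) (yn v) (yn v) n + trilin (yn w) (yn (v - w)) (yn v) n
          + trilin (yn w) (yn w) (yn (v - w)) n) := by
  have hd := l2_yn_sub_ne_top hv hw
  have e : ((Icc a b).indicator fun t => c * (gam v v v n t₀ t - gam w w w n t₀ t))
      = fun t => c * (((Icc a b).indicator (fun t => gam (v - w) v v n t₀ t) t
        + (Icc a b).indicator (fun t => gam w (v - w) v n t₀ t) t)
        + (Icc a b).indicator (fun t => gam w w (v - w) n t₀ t) t) := by
    ext t; by_cases ht : t ∈ Icc a b
    · simp only [indicator_of_mem ht, gam_sub hv hw]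
    · simp only [indicator_of_notMem ht, mul_zero, add_zero]
  have key : yNorm (fun t => ((Icc a b).indicator (fun t => gam (v - w) v v n t₀ t) t
        + (Icc a b).indicator (fun t => gam w (v - w) v n t₀ t) t)
        + (Icc a b).indicator (fun t => gam w w (v - w) n t₀ t) t)
      ≤ 32 * ENNReal.ofReal ((b - a) ^ (5 / 8 : ℝ)) *
        (trilin (yn (v - w)) (yn v) (yn v) n + trilin (yn w) (yn (v - w)) (yn v) n
          + trilin (yn w) (yn w) (yn (v - w)) n) := by
    rw [mul_add, mul_add]
    refine (yNorm_add_le _ _).trans (add_le_add ((yNorm_add_le _ _).trans (add_le_add ?_ ?_)) ?_)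
    · exact yNorm_gam_le hd hv hv n ht₀ hab
    · exact yNorm_gam_le hw hd hv n ht₀ hab
    · exact yNorm_gam_le hw hw hd n ht₀ hab
  rw [e]
  refine (yNorm_const_mul_le c _ (ne_top_of_le_ne_top (ENNReal.mul_ne_top (ENNReal.mul_ne_top
    (by norm_num) ENNReal.ofReal_ne_top) (ENNReal.add_ne_top.2 ⟨ENNReal.add_ne_top.2
    ⟨trilin_ne_top hd hv hv n, trilin_ne_top hw hd hv n⟩, trilin_ne_top hw hw hd n⟩)) key)).trans ?_
  exact (mul_le_of_le_one_left' hc).trans key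

/-- Any level above the lower limit bounds a subsequence, and closedness of `HalfReg` under
pointwise limits applies along it. -/
lemma yNorm_le_liminf {F : ℕ → ℝ → ℂ} {f : ℝ → ℂ}
    (hlim : ∀ t, Tendsto (fun j => F j t) atTop (𝓝 (f t))) :
    yNorm f ≤ liminf (fun j => yNorm (F j)) atTop := by
  refine le_of_forall_gt fun B hB => ?_
  obtain ⟨B', hB1, hB2⟩ := exists_between hB
  have hfreq := frequently_lt_of_liminf_lt (by isBoundedDefault) hB1
  obtain ⟨ψ, hψ, hle⟩ := extraction_of_frequently_atTop hfreq
  exact (yNorm_le_of_tendsto (fun j => (hle j).le) (ne_top_of_lt hB2)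
    fun t => (hlim t).comp hψ.tendsto_atTop).trans_lt hB2

/-- Fatou's lemma for the sum over frequencies. It carries bounds to limits that are known only
pointwise, so no completeness of the function space is needed. -/
lemma wl2_le_of_tendsto {A : ℝ≥0∞} {F : ℕ → Family} {v : Family} {s : ℝ}
    (hF : ∀ j, wl2 s (yn (F j)) ≤ A)
    (hlim : ∀ n t, Tendsto (fun j => F j n t) atTop (𝓝 (v n t))) : wl2 s (yn v) ≤ A := by
  refine le_of_sq_le ?_
  rw [wl2, l2_sq]
  let _ : MeasurableSpace ℤ := ⊤
  have hpt : ∀ n, (wt s n * yn v n) ^ 2 ≤ liminf (fun j => (wt s n * yn (F j) n) ^ 2) atTop := by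
    intro n
    have h1 := yNorm_le_liminf (hlim n)
    have hcont : Continuous fun x : ℝ≥0∞ => (wt s n * x) ^ 2 :=
      (ENNReal.continuous_pow 2).comp (ENNReal.continuous_const_mul (wt_ne_top s n))
    have hmono : Monotone fun x : ℝ≥0∞ => (wt s n * x) ^ 2 := fun x y hxy => by
      simp only; gcongr
    have := hmono.map_liminf_of_continuousAt (F := atTop) (fun j => yNorm (F j n))
      hcont.continuousAt
    exact (hmono h1).trans this.le
  calc ∑' n, (wt s n * yn v n) ^ 2
      ≤ ∑' n, liminf (fun j => (wt s n * yn (F j) n) ^ 2) atTop := ENNReal.tsum_le_tsum hpt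
    _ ≤ liminf (fun j => ∑' n, (wt s n * yn (F j) n) ^ 2) atTop := by
        have := lintegral_liminf_le (μ := (Measure.count : Measure ℤ)) (u := atTop)
          (f := fun j n => (wt s n * yn (F j) n) ^ 2) fun j => measurable_from_top
        simpa only [lintegral_count] using this
    _ ≤ A ^ 2 := by
        refine liminf_le_of_le (by isBoundedDefault) fun B hB => ?_
        obtain ⟨j, hj⟩ := hB.exists
        refine hj.trans ?_
        rw [← l2_sq]
        gcongr
        exact hF j

lemma locConst_ne_top (s : ℝ) : locConst s ≠ ∞ :=
  ENNReal.mul_ne_top (ENNReal.mul_ne_top (by norm_num) ENNReal.ofReal_ne_top) trilinConst_ne_top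

lemma locConst_zero_le {s : ℝ} (hs : 0 ≤ s) : locConst 0 ≤ locConst s := by
  unfold locConst
  gcongr
  norm_num

/-- Absorption into the left side, legitimate because X is finite. -/
lemma half_mul_le {X A : ℝ≥0∞} (hX : X ≠ ∞) (h : X ≤ A + 2⁻¹ * X) : X ≤ 2 * A := by
  have h2 : X = 2⁻¹ * X + 2⁻¹ * X := by rw [← add_mul, ENNReal.inv_two_add_inv_two, one_mul]
  have hf : 2⁻¹ * X ≠ ∞ := ENNReal.mul_ne_top (by norm_num) hX
  have h3 : 2⁻¹ * X ≤ A := by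
    rw [h2, mul_add] at h
    refine (ENNReal.add_le_add_iff_right hf).1 ?_
    calc _ = X := h2.symm
      _ ≤ _ := by rw [h2, mul_add]; exact h
  calc X = 2 * (2⁻¹ * X) := by
        rw [← mul_assoc, ENNReal.mul_inv_cancel (by norm_num) (by norm_num), one_mul]
    _ ≤ 2 * A := by gcongr

/-- Local existence, with a time of existence that depends on the `L²` size only, apart from
the constant `locConst s`. -/
theorem exists_isSol {c : ℂ} (hc : ‖c‖ₑ ≤ 1) {s : ℝ} (hs : 0 ≤ s) {a b t₀ : ℝ}
    (ht₀ : t₀ ∈ Icc a b) (hab : b - a ≤ 1) {K Ks : ℝ≥0∞} (hK : K ≠ ∞) (hKs : Ks ≠ ∞)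
    (hsmall : locConst s * ENNReal.ofReal ((b - a) ^ (5 / 8 : ℝ)) * (16 * K ^ 2) ≤ 2⁻¹)
    {φ : ℤ → ℂ} (hφ : l2 (mag φ) ≤ K) (hφs : wl2 s (mag φ) ≤ Ks) :
    ∃ v : Family, IsSol c a b v ∧ (∀ n, v n t₀ = φ n) ∧ wl2 s (yn (cut a b v)) ≤ 4 * Ks ∧
      l2 (yn (cut a b v)) ≤ 4 * K := by
  set d := ENNReal.ofReal ((b - a) ^ (5 / 8 : ℝ)) with hd
  -- The Picard map. Cutting off inside P makes its fixed point vanish outside [a, b], so that it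
  -- equals its own restriction.
  set P : Family → Family := fun v n =>
    (Icc a b).indicator fun t => φ n + c * gam v v v n t₀ t with hP
  have hsmall0 : locConst 0 * d * (16 * K ^ 2) ≤ 2⁻¹ :=
    le_trans (by gcongr; exact locConst_zero_le hs) hsmall
  have h4K : 4 * K ≠ ∞ := ENNReal.mul_ne_top (by norm_num) hK
  have h4Ks : 4 * Ks ≠ ∞ := ENNReal.mul_ne_top (by norm_num) hKs
  -- Invariance of the ball of radius 4L, to be used with σ = 0 and with σ = s. The smallness
  -- involves (4K)² = 16K², the ℓ² size, in both cases.
  have step : ∀ (σ : ℝ) (_ : 0 ≤ σ) (L : ℝ≥0∞) (_ : wl2 σ (mag φ) ≤ L)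
      (_ : locConst σ * d * (16 * K ^ 2) ≤ 2⁻¹) (v : Family), l2 (yn v) ≤ 4 * K →
      wl2 σ (yn v) ≤ 4 * L → wl2 σ (yn (P v)) ≤ 4 * L := by
    intro σ hσ L hL hsm v hv hvσ
    calc wl2 σ (yn (P v)) ≤ wl2 σ (fun n => 2 * mag φ n + 32 * d * trilin (yn v) (yn v) (yn v) n) :=
          wl2_mono fun n => yn_affine_le hc (ne_top_of_le_ne_top h4K hv) ht₀ hab φ n
      _ ≤ 2 * L + locConst σ * d * (4 * K) ^ 2 * (4 * L) := by
          refine (wl2_add_le _ _ _).trans (add_le_add ?_ ?_)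
          · rw [wl2_const_mul]; gcongr
          · refine (wl2_trilin_diag_le hσ _ _).trans ?_
            gcongr
      _ = 2 * L + locConst σ * d * (16 * K ^ 2) * (4 * L) := by ring
      _ ≤ 2 * L + 2⁻¹ * (4 * L) := by gcongr
      _ = 4 * L := by
          have : (2⁻¹ : ℝ≥0∞) * 4 = 2 := by
            rw [show (4 : ℝ≥0∞) = 2 * 2 by norm_num, ← mul_assoc,
              ENNReal.inv_mul_cancel (by norm_num) (by norm_num), one_mul]
          rw [← mul_assoc, this]; ring
  -- Only the unweighted norm has to contract; the bound with weight ⟨n⟩^s survives in the limit by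
  -- lower semicontinuity.
  have contr : ∀ v w : Family, l2 (yn v) ≤ 4 * K → l2 (yn w) ≤ 4 * K →
      l2 (yn (P v - P w)) ≤ 2⁻¹ * l2 (yn (v - w)) := by
    intro v w hv hw
    have hv' := ne_top_of_le_ne_top h4K hv
    have hw' := ne_top_of_le_ne_top h4K hw
    calc l2 (yn (P v - P w))
        ≤ l2 fun n => 32 * d * ((trilin (yn (v - w)) (yn v) (yn v) n
          + trilin (yn w) (yn (v - w)) (yn v) n) + trilin (yn w) (yn w) (yn (v - w)) n) := by
          refine l2_mono fun n => ?_
          refine le_trans (le_of_eq ?_) (yn_gam_sub_le hc hv' hw' ht₀ hab n)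
          unfold yn
          congr 1
          ext t
          by_cases ht : t ∈ Icc a b
          · simp only [hP, Pi.sub_apply, indicator_of_mem ht]; ring
          · simp only [hP, Pi.sub_apply, indicator_of_notMem ht, sub_self]
      _ ≤ 32 * d * (trilinConst * (l2 (yn (v - w)) * (4 * K) * (4 * K))
            + trilinConst * ((4 * K) * l2 (yn (v - w)) * (4 * K))
            + trilinConst * ((4 * K) * (4 * K) * l2 (yn (v - w)))) := by
          rw [l2_const_mul]
          gcongr
          refine (l2_add_le _ _).trans (add_le_add ((l2_add_le _ _).trans (add_le_add ?_ ?_)) ?_)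
          · exact (l2_trilin_le _ _ _).trans (by gcongr)
          · exact (l2_trilin_le _ _ _).trans (by gcongr)
          · exact (l2_trilin_le _ _ _).trans (by gcongr)
      _ = locConst 0 * d * (16 * K ^ 2) * l2 (yn (v - w)) := by
          rw [locConst, Real.rpow_zero, ENNReal.ofReal_one]; ring
      _ ≤ _ := by gcongr
  set u : ℕ → Family := fun j => P^[j] 0 with hu
  have hu_succ : ∀ j, u (j + 1) = P (u j) := fun j => Function.iterate_succ_apply' P j 0
  have h0 : yn (0 : Family) = fun _ => 0 := by ext n; exact yNorm_zero
  have bd0 : ∀ j, l2 (yn (u j)) ≤ 4 * K := by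
    intro j
    induction j with
    | zero => simp only [hu, Function.iterate_zero, id, h0, l2_zero]; exact zero_le
    | succ j ih =>
      rw [hu_succ, ← wl2_zero]
      exact step 0 le_rfl K (by rwa [wl2_zero]) hsmall0 _ ih (by rwa [wl2_zero])
  have bds : ∀ j, wl2 s (yn (u j)) ≤ 4 * Ks := by
    intro j
    induction j with
    | zero => simp only [hu, Function.iterate_zero, id, h0, wl2, mul_zero, l2_zero]; exact zero_le
    | succ j ih =>
      rw [hu_succ]
      exact step s hs Ks hφs hsmall _ (bd0 j) ih
  have diff : ∀ j, l2 (yn (u (j + 1) - u j)) ≤ 4 * K * 2⁻¹ ^ j := by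
    intro j
    induction j with
    | zero =>
      have : u 0 = 0 := rfl
      rw [this, sub_zero, pow_zero, mul_one]; exact bd0 1
    | succ j ih =>
      rw [hu_succ (j + 1), hu_succ j]
      refine (contr _ _ (hu_succ j ▸ bd0 (j + 1)) (bd0 j)).trans ?_
      rw [← hu_succ j]
      calc _ ≤ 2⁻¹ * (4 * K * 2⁻¹ ^ j) := by gcongr
        _ = _ := by ring
  have diff2 : ∀ m j, l2 (yn (u (j + m) - u j)) ≤ 8 * K * 2⁻¹ ^ j := by
    intro m
    induction m with
    | zero => intro j; rw [add_zero, sub_self, h0, l2_zero]; exact zero_le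
    | succ m ih =>
      intro j
      have e : u (j + (m + 1)) - u j = (u (j + 1 + m) - u (j + 1)) + (u (j + 1) - u j) := by
        rw [show j + (m + 1) = j + 1 + m by ring]; abel
      calc l2 (yn (u (j + (m + 1)) - u j))
          ≤ l2 (yn (u (j + 1 + m) - u (j + 1))) + l2 (yn (u (j + 1) - u j)) := by
            rw [e]
            exact (l2_mono fun n => yNorm_add_le _ _).trans (l2_add_le _ _)
        _ ≤ 8 * K * 2⁻¹ ^ (j + 1) + 4 * K * 2⁻¹ ^ j := add_le_add (ih (j + 1)) (diff j)
        _ = (8 * 2⁻¹ + 4) * K * 2⁻¹ ^ j := by ring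
        _ = _ := by
            have : (8 * 2⁻¹ + 4 : ℝ≥0∞) = 8 := by
              rw [show (8 : ℝ≥0∞) = 4 * 2 by norm_num, mul_assoc,
                ENNReal.mul_inv_cancel (by norm_num) (by norm_num)]; norm_num
            rw [this]
  have hpt : ∀ n t, ∃ z, Tendsto (fun j => u j n t) atTop (𝓝 z) := by
    intro n t
    refine cauchySeq_tendsto_of_complete (cauchySeq_of_le_geometric (1 / 2) (4 * K).toReal
      (by norm_num) fun j => ?_)
    have h1 : ‖u (j + 1) n t - u j n t‖ₑ ≤ 4 * K * 2⁻¹ ^ j :=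
      (enorm_le_yNorm ((u (j + 1) - u j) n) t).trans ((le_l2 _ n).trans (diff j))
    rw [dist_comm, dist_eq_norm, ← toReal_enorm]
    refine (ENNReal.toReal_mono (ENNReal.mul_ne_top h4K (by simp)) h1).trans (le_of_eq ?_)
    rw [ENNReal.toReal_mul, ENNReal.toReal_pow]; norm_num
  choose v hv using hpt
  have hvK : l2 (yn v) ≤ 4 * K := by
    rw [← wl2_zero]
    exact wl2_le_of_tendsto (fun j => by rw [wl2_zero]; exact bd0 j) hv
  have hvs : wl2 s (yn v) ≤ 4 * Ks := wl2_le_of_tendsto bds hv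
  have hconv : ∀ j, l2 (yn (v - u j)) ≤ 8 * K * 2⁻¹ ^ j := by
    intro j
    rw [← wl2_zero]
    refine wl2_le_of_tendsto (F := fun m => u (j + m) - u j)
      (fun m => by rw [wl2_zero]; exact diff2 m j) fun n t => ?_
    exact ((hv n t).comp (tendsto_atTop_mono (fun m => Nat.le_add_left m j) tendsto_id)).sub_const _
  have hfix : P v = v := by
    ext n t
    have h1 : Tendsto (fun j => u (j + 1) n t) atTop (𝓝 (v n t)) :=
      (hv n t).comp (tendsto_add_atTop_nat 1)
    have h2 : Tendsto (fun j => u (j + 1) n t) atTop (𝓝 (P v n t)) := by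
      rw [tendsto_iff_edist_tendsto_0]
      have hlim : Tendsto (fun j : ℕ => 8 * K * 2⁻¹ ^ j) atTop (𝓝 0) := by
        have := ENNReal.Tendsto.const_mul (a := 8 * K)
          (ENNReal.tendsto_pow_atTop_nhds_zero_of_lt_one (r := 2⁻¹) (by norm_num))
          (Or.inr (ENNReal.mul_ne_top (by norm_num) hK))
        simpa using this
      refine tendsto_of_tendsto_of_tendsto_of_le_of_le tendsto_const_nhds hlim (fun _ => zero_le)
        fun j => ?_
      rw [edist_comm, edist_eq_enorm_sub, hu_succ]
      calc ‖P v n t - P (u j) n t‖ₑ ≤ l2 (yn (P v - P (u j))) :=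
            (enorm_le_yNorm ((P v - P (u j)) n) t).trans (le_l2 (yn (P v - P (u j))) n)
        _ ≤ 2⁻¹ * l2 (yn (v - u j)) := contr _ _ hvK (bd0 j)
        _ ≤ 1 * (8 * K * 2⁻¹ ^ j) := by
            gcongr
            · norm_num
            · exact hconv j
        _ = _ := one_mul _
    exact tendsto_nhds_unique h2 h1
  have hcut : cut a b v = v := by
    ext n t
    by_cases ht : t ∈ Icc a b
    · simp only [cut, indicator_of_mem ht]
    · rw [← hfix]; simp only [cut, hP, indicator_of_notMem ht]
  have hval : ∀ n, ∀ t ∈ Icc a b, v n t = φ n + c * gam v v v n t₀ t := by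
    intro n t ht
    calc v n t = P v n t := by rw [hfix]
      _ = _ := by simp only [hP, indicator_of_mem ht]
  have hfin := ne_top_of_le_ne_top h4K hvK
  refine ⟨v, ⟨by rw [hcut]; exact hfin, fun n r hr t ht => ?_⟩, fun n => ?_, by rwa [hcut],
    by rwa [hcut]⟩
  · rw [hcut, hval n t ht, hval n r hr, ← gam_add_adjacent hfin hfin hfin n t₀ r t]; ring
  · rw [hval n t₀ ht₀, gam_self]; simp

/-- Lipschitz dependence of solutions on short time intervals. -/
theorem IsSol.wl2_sub_le {c : ℂ} (hc : ‖c‖ₑ ≤ 1) {s : ℝ} (hs : 0 ≤ s) {a b t₀ : ℝ}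
    (ht₀ : t₀ ∈ Icc a b) (hab : b - a ≤ 1) {M : ℝ≥0∞} (hM : M ≠ ∞)
    (hsmall : locConst s * ENNReal.ofReal ((b - a) ^ (5 / 8 : ℝ)) * (3 * M ^ 2) ≤ 2⁻¹)
    {v w : Family} (hv : IsSol c a b v) (hw : IsSol c a b w)
    (hvM : wl2 s (yn (cut a b v)) ≤ M) (hwM : wl2 s (yn (cut a b w)) ≤ M) :
    wl2 s (yn (cut a b (v - w))) ≤ 4 * wl2 s (mag fun n => v n t₀ - w n t₀) := by
  set d := ENNReal.ofReal ((b - a) ^ (5 / 8 : ℝ)) with hd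
  set V := cut a b v with hV
  set W := cut a b w with hW
  have hVW : cut a b (v - w) = V - W := cut_sub a b v w
  have hV2 : l2 (yn V) ≤ M := (l2_le_wl2 hs _).trans hvM
  have hW2 : l2 (yn W) ≤ M := (l2_le_wl2 hs _).trans hwM
  have hD2 : l2 (yn (V - W)) ≤ wl2 s (yn (V - W)) := l2_le_wl2 hs _
  -- Finiteness of the difference is needed to absorb half of it below.
  have hDfin : wl2 s (yn (V - W)) ≠ ∞ := by
    refine ne_top_of_le_ne_top (ENNReal.add_ne_top.2 ⟨hM, hM⟩) ((wl2_mono fun n =>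
      yNorm_sub_le (V n) (W n)).trans ((wl2_add_le s _ _).trans (add_le_add hvM hwM)))
  set D := wl2 s (yn (V - W)) with hDdef
  rw [hVW]
  have hpt : ∀ n, yn (V - W) n ≤ 2 * mag (fun n => v n t₀ - w n t₀) n
      + 32 * d * ((trilin (yn (V - W)) (yn V) (yn V) n
          + trilin (yn W) (yn (V - W)) (yn V) n) + trilin (yn W) (yn W) (yn (V - W)) n) := by
    intro n
    have e : (V - W) n = fun t => (v n t₀ - w n t₀) * (Icc a b).indicator (fun _ => 1) t
        + (Icc a b).indicator (fun t => c * (gam V V V n t₀ t - gam W W W n t₀ t)) t := by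
      ext t; by_cases ht : t ∈ Icc a b
      · have h1 := hv.eq n t₀ ht₀ t ht
        have h2 := hw.eq n t₀ ht₀ t ht
        have h3 : V n t = v n t := cut_eqOn a b v n ht
        have h4 : W n t = w n t := cut_eqOn a b w n ht
        simp only [Pi.sub_apply, indicator_of_mem ht, h3, h4]
        linear_combination h1 - h2
      · simp only [Pi.sub_apply, indicator_of_notMem ht, hV, hW, cut]; simp
    rw [yn, e]
    refine (yNorm_add_le _ _).trans (add_le_add ?_ (yn_gam_sub_le hc hv.fin hw.fin ht₀ hab n))
    rw [mul_comm]
    exact yNorm_le ((halfReg_indicator_one measurableSet_Icc Ioo_subset_Icc_self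
      subset_rfl).const_mul _)
  have e4 : 4 * wl2 s (mag fun n => v n t₀ - w n t₀)
      = 2 * (2 * wl2 s (mag fun n => v n t₀ - w n t₀)) := by ring
  rw [e4]
  refine half_mul_le hDfin ?_
  -- The three terms of the tame estimate are merged by bounding ℓ² norms by weighted ones; together
  -- with the three slots of the difference this gives 32 · 3 · 3 M² = 96 · 3M².
  have htri : ∀ x y z : ℤ → ℝ≥0∞, ∀ X Y Z : ℝ≥0∞, wl2 s x ≤ X → wl2 s y ≤ Y → wl2 s z ≤ Z →
      wl2 s (trilin x y z) ≤ ENNReal.ofReal (3 ^ s) * trilinConst * (3 * (X * Y * Z)) := by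
    intro x y z X Y Z hx hy hz
    refine (wl2_trilin_le hs x y z).trans ?_
    calc _ ≤ ENNReal.ofReal (3 ^ s) * trilinConst * (X * Y * Z + X * Y * Z + X * Y * Z) := by
          have hx' := (l2_le_wl2 hs x).trans hx
          have hy' := (l2_le_wl2 hs y).trans hy
          have hz' := (l2_le_wl2 hs z).trans hz
          gcongr
      _ = _ := by ring
  calc D ≤ wl2 s fun n => 2 * mag (fun n => v n t₀ - w n t₀) n
      + 32 * d * ((trilin (yn (V - W)) (yn V) (yn V) n
          + trilin (yn W) (yn (V - W)) (yn V) n) + trilin (yn W) (yn W) (yn (V - W)) n) :=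
        wl2_mono hpt
    _ ≤ 2 * wl2 s (mag fun n => v n t₀ - w n t₀) + 32 * d *
        ((ENNReal.ofReal (3 ^ s) * trilinConst * (3 * (D * M * M))
          + ENNReal.ofReal (3 ^ s) * trilinConst * (3 * (M * D * M)))
          + ENNReal.ofReal (3 ^ s) * trilinConst * (3 * (M * M * D))) := by
        refine (wl2_add_le _ _ _).trans (add_le_add (wl2_const_mul _ _ _).le ?_)
        rw [wl2_const_mul]
        gcongr
        refine (wl2_add_le _ _ _).trans (add_le_add ((wl2_add_le _ _ _).trans (add_le_add ?_ ?_)) ?_)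
        · exact htri _ _ _ _ _ _ le_rfl hvM hvM
        · exact htri _ _ _ _ _ _ hwM le_rfl hvM
        · exact htri _ _ _ _ _ _ hwM hwM le_rfl
    _ = 2 * wl2 s (mag fun n => v n t₀ - w n t₀) + locConst s * d * (3 * M ^ 2) * D := by
        rw [locConst]; ring
    _ ≤ _ := by gcongr

/-! ### Conservation of mass -/

/-- One quartic interaction integrated in time. -/
def quart (v w : Family) (n : ℤ) (p : ℤ × ℤ) (s t : ℝ) : ℂ :=
  ∫ r in s..t, Complex.exp (Complex.I * ((phase n p.1 p.2 * r : ℝ) : ℂ))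
    * (cub v v v n p r * (starRingEnd ℂ) (w n r))

section quart

variable {v w : Family}

lemma halfReg_quart (hv : l2 (yn v) ≠ ∞) (hw : l2 (yn w) ≠ ∞) (n : ℤ) (p : ℤ × ℤ) :
    HalfReg (8 * ((yn v (n + p.1) * yn v (n + p.1 + p.2) * yn v (n + p.2)) * yn w n))
      (fun r => cub v v v n p r * (starRingEnd ℂ) (w n r)) :=
  ((halfReg_cub hv hv hv n p).mul (halfReg_yNorm (yn_ne_top hw n)).conj).mono
    (le_of_eq (by unfold yn; ring))

lemma quart_const_ne_top (hv : l2 (yn v) ≠ ∞) (hw : l2 (yn w) ≠ ∞) (n : ℤ) (p : ℤ × ℤ) :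
    8 * ((yn v (n + p.1) * yn v (n + p.1 + p.2) * yn v (n + p.2)) * yn w n) ≠ ∞ :=
  ENNReal.mul_ne_top (by norm_num) (ENNReal.mul_ne_top (ENNReal.mul_ne_top (ENNReal.mul_ne_top
    (yn_ne_top hv _) (yn_ne_top hv _)) (yn_ne_top hv _)) (yn_ne_top hw _))

lemma tsum_enorm_quart_le (hv : l2 (yn v) ≠ ∞) (hw : l2 (yn w) ≠ ∞) (n : ℤ) (s t : ℝ) :
    ∑' p, ‖quart v w n p s t‖ₑ
      ≤ 32 * ENNReal.ofReal (gain |t - s|) * (trilin (yn v) (yn v) (yn v) n * yn w n) := by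
  unfold trilin
  rw [← ENNReal.tsum_mul_right, ← ENNReal.tsum_mul_left]
  refine ENNReal.tsum_le_tsum fun p => ?_
  refine (enorm_integral_phase_le (halfReg_quart hv hw n p) (quart_const_ne_top hv hw n p)
    n p.1 p.2 s t).trans (le_of_eq ?_)
  ring

lemma tsum_tsum_enorm_quart_le (hv : l2 (yn v) ≠ ∞) (hw : l2 (yn w) ≠ ∞) (s t : ℝ) :
    ∑' n, ∑' p, ‖quart v w n p s t‖ₑ ≤ 32 * ENNReal.ofReal (gain |t - s|) *
      (l2 (trilin (yn v) (yn v) (yn v)) * l2 (yn w)) := by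
  refine (ENNReal.tsum_le_tsum fun n => tsum_enorm_quart_le hv hw n s t).trans ?_
  rw [ENNReal.tsum_mul_left]
  gcongr
  exact tsum_mul_le_l2 _ _

lemma l2_trilin_ne_top {a b c : ℤ → ℝ≥0∞} (ha : l2 a ≠ ∞) (hb : l2 b ≠ ∞) (hc : l2 c ≠ ∞) :
    l2 (trilin a b c) ≠ ∞ :=
  ne_top_of_le_ne_top (ENNReal.mul_ne_top trilinConst_ne_top
    (ENNReal.mul_ne_top (ENNReal.mul_ne_top ha hb) hc)) (l2_trilin_le a b c)

lemma summable_quart (hv : l2 (yn v) ≠ ∞) (hw : l2 (yn w) ≠ ∞) (s t : ℝ) :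
    Summable fun q : ℤ × ℤ × ℤ => quart v w q.1 q.2 s t := by
  refine summable_of_tsum_enorm ?_
  rw [ENNReal.tsum_prod']
  exact ne_top_of_le_ne_top (ENNReal.mul_ne_top (ENNReal.mul_ne_top (by norm_num)
    ENNReal.ofReal_ne_top) (ENNReal.mul_ne_top (l2_trilin_ne_top hv hv hv) hw))
    (tsum_tsum_enorm_quart_le hv hw s t)

/-- Conjugation exchanges the pair (n + k, n + l) with the pair (n, n + k + l) and reverses the sign
of the phase; the substitution restores the original form. -/
lemma conj_quart (v : Family) (n k l : ℤ) (s t : ℝ) :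
    (starRingEnd ℂ) (quart v v n (k, l) s t) = quart v v (n + k) (-k, l) s t := by
  unfold quart
  rw [← intervalIntegral.intervalIntegral_conj]
  congr 1
  ext r
  have h1 : n + k + -k = n := by ring
  have h2 : n + k + l = n + l + k := by ring
  have hph : phase (n + k) (-k) l = - phase n k l := by
    unfold phase; push_cast; ring
  simp only [cub, h1, hph, map_mul, Complex.conj_conj, ← Complex.exp_conj, Complex.conj_I,
    Complex.conj_ofReal]
  have e : -Complex.I * ((phase n k l * r : ℝ) : ℂ)
      = Complex.I * ((-phase n k l * r : ℝ) : ℂ) := by push_cast; ring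
  rw [e]; ring

/-- The substitution `(n, k, l) ↦ (n + k, -k, l)`, which exchanges the two conjugate pairs. -/
def pairSwap : ℤ × ℤ × ℤ ≃ ℤ × ℤ × ℤ where
  toFun q := (q.1 + q.2.1, -q.2.1, q.2.2)
  invFun q := (q.1 + q.2.1, -q.2.1, q.2.2)
  left_inv q := by simp
  right_inv q := by simp

/-- The sum equals its own conjugate after a bijection of the index set. This is the cancellation
behind conservation of mass. -/
lemma im_tsum_quart (v : Family) (s t : ℝ) :
    (∑' q : ℤ × ℤ × ℤ, quart v v q.1 q.2 s t).im = 0 := by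
  rw [← Complex.conj_eq_iff_im, Complex.conj_tsum,
    ← pairSwap.tsum_eq fun q : ℤ × ℤ × ℤ => quart v v q.1 q.2 s t]
  exact tsum_congr fun q => conj_quart v q.1 q.2.1 q.2.2 s t

end quart

/-- The mass of a family at a given time. -/
def mass (v : Family) (t : ℝ) : ℝ := ∑' n, ‖v n t‖ ^ 2

lemma summable_of_tsum_sq {f : ℤ → ℂ} (h : l2 (mag f) ≠ ∞) : Summable fun n => ‖f n‖ ^ 2 := by
  have h2 : ∑' n, ENNReal.ofReal (‖f n‖ ^ 2) ≠ ∞ := by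
    have := ENNReal.pow_ne_top (n := 2) h
    rw [l2_sq] at this
    convert this using 3 with n
    rw [mag, ← ofReal_norm, ENNReal.ofReal_pow (norm_nonneg _)]
  have := ENNReal.summable_toReal h2
  convert this using 2 with n
  rw [ENNReal.toReal_ofReal (by positivity)]

lemma IsSol.l2_mag_ne_top {c : ℂ} {a b t : ℝ} {v : Family} (hv : IsSol c a b v)
    (ht : t ∈ Icc a b) : l2 (mag fun n => v n t) ≠ ∞ :=
  ne_top_of_le_ne_top hv.fin (l2_mono (mag_le_yn_cut ht v))

/-- The modulus of continuity of the mass. -/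
lemma IsSol.abs_mass_sub_le {ε : ℝ} (hε : |ε| ≤ 1) {a b : ℝ} {v : Family}
    (hv : IsSol (-(Complex.I * ε)) a b v) {s t : ℝ} (hs : s ∈ Icc a b) (ht : t ∈ Icc a b)
    (hst : s ≤ t) (hst1 : t - s ≤ 1) :
    |mass v t - mass v s| ≤ 2304 * (l2 (trilin (yn (cut a b v)) (yn (cut a b v))
      (yn (cut a b v)))).toReal ^ 2 * ((t - s) ^ (5 / 8 : ℝ)) ^ 2 := by
  set c : ℂ := -(Complex.I * ε) with hc
  have hcn : ‖c‖ ≤ 1 := by rw [hc]; simpa using hε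
  have hce : ‖c‖ₑ ≤ 1 := by
    rw [← ofReal_norm, ← ENNReal.ofReal_one]; exact ENNReal.ofReal_le_ofReal hcn
  set V := cut a b v with hV
  have hVf : l2 (yn V) ≠ ∞ := hv.fin
  set X := trilin (yn V) (yn V) (yn V) with hX
  have hXf : l2 X ≠ ∞ := l2_trilin_ne_top hVf hVf hVf
  set d := ENNReal.ofReal ((t - s) ^ (5 / 8 : ℝ)) with hd
  have hgain : ENNReal.ofReal (gain |t - s|) = d := by
    rw [abs_of_nonneg (by linarith), gain_of_le_one (by linarith) hst1]
  have hsub : Icc s t ⊆ Icc a b := Icc_subset_Icc hs.1 ht.2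
  -- The increment from time s, of order (t - s)^{5/8} in the half-derivative norm.
  set W : Family := fun n => (Icc s t).indicator fun r => v n r - v n s with hW
  have hWn : ∀ n, yn W n ≤ 32 * d * X n := by
    intro n
    have e : W n = fun r => c * (Icc s t).indicator (fun r => gam V V V n s r) r := by
      ext r
      by_cases hr : r ∈ Icc s t
      · simp only [hW, indicator_of_mem hr]; exact hv.eq n s hs r (hsub hr)
      · simp only [hW, indicator_of_notMem hr, mul_zero]
    have h1 := yNorm_gam_le hVf hVf hVf n (left_mem_Icc.2 hst) hst1
    rw [yn, e]
    refine (yNorm_const_mul_le c _ (ne_top_of_le_ne_top ?_ h1)).trans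
      ((mul_le_of_le_one_left' hce).trans h1)
    exact ENNReal.mul_ne_top (ENNReal.mul_ne_top (by norm_num) ENNReal.ofReal_ne_top)
      (trilin_ne_top hVf hVf hVf n)
  have hWl : l2 (yn W) ≤ 32 * d * l2 X := (l2_mono hWn).trans (l2_const_mul _ _).le
  have hWf : l2 (yn W) ≠ ∞ := ne_top_of_le_ne_top (ENNReal.mul_ne_top (ENNReal.mul_ne_top
    (by norm_num) ENNReal.ofReal_ne_top) hXf) hWl
  have sQ := summable_quart hVf hVf s t
  have sR := summable_quart hVf hWf s t
  set D : ℤ → ℂ := fun n => v n t - v n s with hD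
  set q : ℤ → ℂ := fun n => ∑' p, quart V V n p s t with hq
  set ρ : ℤ → ℂ := fun n => ∑' p, quart V W n p s t with hρ
  have hq_sum : Summable q := sQ.prod
  have hρ_sum : Summable ρ := sR.prod
  have hqt : (∑' n, q n).im = 0 := by
    rw [hq, ← sQ.tsum_prod]; exact im_tsum_quart V s t
  -- The frozen factor v n s is v n r minus the increment: the first part gives the symmetric
  -- quartic form q, the second the error ρ, which is of second order in (t - s)^{5/8}.
  have hDq : ∀ n, (starRingEnd ℂ) (v n s) * D n = c * (q n - ρ n) := by
    intro n
    have e1 : D n = c * gam V V V n s t := hv.eq n s hs t ht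
    rw [e1, hq, hρ]
    simp only
    rw [← (sQ.prod_factor n).tsum_sub (sR.prod_factor n), gam, mul_left_comm, ← tsum_mul_left]
    congr 2
    ext p
    unfold quart osc
    have i1 := intervalIntegrable_exp_mul (halfReg_quart hVf hVf n p).1
      (halfReg_quart hVf hVf n p).2.1 (quart_const_ne_top hVf hVf n p) (phase n p.1 p.2) s t
    have i2 := intervalIntegrable_exp_mul (halfReg_quart hVf hWf n p).1
      (halfReg_quart hVf hWf n p).2.1 (quart_const_ne_top hVf hWf n p) (phase n p.1 p.2) s t
    rw [← intervalIntegral.integral_const_mul, ← intervalIntegral.integral_sub i1 i2]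
    refine intervalIntegral.integral_congr fun r hr => ?_
    rw [uIcc_of_le hst] at hr
    have h1 : V n r = v n r := cut_eqOn a b v n (hsub hr)
    have h2 : W n r = v n r - v n s := indicator_of_mem hr _
    simp only [h1, h2, map_sub]
    ring
  have hDn : ∀ n, ‖D n‖ₑ ≤ 16 * d * X n := by
    intro n
    have e1 : D n = c * gam V V V n s t := hv.eq n s hs t ht
    rw [e1, enorm_mul, ← hgain]
    exact (mul_le_of_le_one_left' hce).trans (enorm_gam_le hVf hVf hVf n s t)
  have hDl : l2 (mag D) ≤ 16 * d * l2 X := (l2_mono hDn).trans (l2_const_mul _ _).le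
  have hD_sum : Summable fun n => ‖D n‖ ^ 2 := summable_of_tsum_sq (ne_top_of_le_ne_top
    (ENNReal.mul_ne_top (ENNReal.mul_ne_top (by norm_num) ENNReal.ofReal_ne_top) hXf) hDl)
  have hpt : ∀ n, ‖v n t‖ ^ 2 - ‖v n s‖ ^ 2
      = 2 * (c * q n).re + (‖D n‖ ^ 2 - 2 * (c * ρ n).re) := by
    intro n
    have e1 : v n t = v n s + D n := by rw [hD]; ring
    have e2 : ((starRingEnd ℂ) (v n s) * D n).re = (c * q n).re - (c * ρ n).re := by
      rw [hDq n, mul_sub, Complex.sub_re]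
    rw [e1, Complex.sq_norm, Complex.sq_norm, Complex.sq_norm, Complex.normSq_add]
    have e3 : (v n s * (starRingEnd ℂ) (D n)).re = ((starRingEnd ℂ) (v n s) * D n).re := by
      simp [Complex.mul_re]
    rw [e3, e2]; ring
  -- The first-order change vanishes: c is purely imaginary and the total of q is real.
  have hcq : (∑' n, (c * q n).re) = 0 := by
    rw [← Complex.re_tsum (hq_sum.mul_left c), tsum_mul_left, hc, Complex.mul_re, hqt]
    simp
  have s1 : Summable fun n => 2 * (c * q n).re :=
    ((Complex.hasSum_re (hq_sum.mul_left c).hasSum).summable).mul_left 2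
  have s2 : Summable fun n => 2 * (c * ρ n).re :=
    ((Complex.hasSum_re (hρ_sum.mul_left c).hasSum).summable).mul_left 2
  have hmain : mass v t - mass v s = ∑' n, ‖D n‖ ^ 2 - 2 * (c * ∑' n, ρ n).re := by
    unfold mass
    rw [← (summable_of_tsum_sq (hv.l2_mag_ne_top ht)).tsum_sub
      (summable_of_tsum_sq (hv.l2_mag_ne_top hs)), tsum_congr hpt,
      s1.tsum_add (hD_sum.sub s2), tsum_mul_left, hcq, hD_sum.tsum_sub s2, tsum_mul_left,
      ← Complex.re_tsum (hρ_sum.mul_left c), tsum_mul_left]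
    ring
  have hd0 : 0 ≤ (t - s) ^ (5 / 8 : ℝ) := Real.rpow_nonneg (by linarith) _
  have hdt : d.toReal = (t - s) ^ (5 / 8 : ℝ) := ENNReal.toReal_ofReal hd0
  have b1 : ∑' n, ‖D n‖ ^ 2 ≤ 256 * (l2 X).toReal ^ 2 * ((t - s) ^ (5 / 8 : ℝ)) ^ 2 := by
    have h1 : ENNReal.ofReal (∑' n, ‖D n‖ ^ 2) = l2 (mag D) ^ 2 := by
      rw [ENNReal.ofReal_tsum_of_nonneg (fun n => by positivity) hD_sum, l2_sq]
      congr 1; ext n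
      rw [mag, ← ofReal_norm, ENNReal.ofReal_pow (norm_nonneg _)]
    have h2 : ENNReal.ofReal (∑' n, ‖D n‖ ^ 2) ≤ (16 * d * l2 X) ^ 2 := by rw [h1]; gcongr
    have h3 := ENNReal.toReal_mono (ENNReal.pow_ne_top (ENNReal.mul_ne_top (ENNReal.mul_ne_top
      (by norm_num) ENNReal.ofReal_ne_top) hXf)) h2
    rw [ENNReal.toReal_ofReal (tsum_nonneg fun n => by positivity)] at h3
    refine h3.trans (le_of_eq ?_)
    rw [ENNReal.toReal_pow, ENNReal.toReal_mul, ENNReal.toReal_mul, hdt, ENNReal.toReal_ofNat]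
    ring
  have b2 : ‖∑' n, ρ n‖ ≤ 1024 * (l2 X).toReal ^ 2 * ((t - s) ^ (5 / 8 : ℝ)) ^ 2 := by
    have h2 : ‖∑' n, ρ n‖ₑ ≤ 32 * d * (l2 X * (32 * d * l2 X)) := by
      refine enorm_tsum_le_tsum_enorm.trans ((ENNReal.tsum_le_tsum fun n =>
        enorm_tsum_le_tsum_enorm).trans ((tsum_tsum_enorm_quart_le hVf hWf s t).trans ?_))
      rw [hgain]; gcongr
    have h3 := ENNReal.toReal_mono (ENNReal.mul_ne_top (ENNReal.mul_ne_top (by norm_num)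
      ENNReal.ofReal_ne_top) (ENNReal.mul_ne_top hXf (ENNReal.mul_ne_top (ENNReal.mul_ne_top
      (by norm_num) ENNReal.ofReal_ne_top) hXf))) h2
    rw [toReal_enorm] at h3
    refine h3.trans (le_of_eq ?_)
    simp only [ENNReal.toReal_mul, ENNReal.toReal_ofReal hd0, ENNReal.toReal_ofNat]
    ring
  have b3 : |(c * ∑' n, ρ n).re| ≤ 1024 * (l2 X).toReal ^ 2 * ((t - s) ^ (5 / 8 : ℝ)) ^ 2 := by
    refine (Complex.abs_re_le_norm _).trans ?_
    rw [norm_mul]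
    exact (mul_le_of_le_one_left (norm_nonneg _) hcn).trans b2
  have b4 : 0 ≤ ∑' n, ‖D n‖ ^ 2 := tsum_nonneg fun n => by positivity
  rw [hmain, abs_le]
  rw [abs_le] at b3
  constructor <;> nlinarith [b3.1, b3.2]

/-- Conservation of mass. -/
theorem IsSol.mass_eq {ε : ℝ} (hε : |ε| ≤ 1) {a b : ℝ} {v : Family}
    (hv : IsSol (-(Complex.I * ε)) a b v) {s t : ℝ} (hs : s ∈ Icc a b) (ht : t ∈ Icc a b) :
    mass v s = mass v t := by
  set C := 2304 * (l2 (trilin (yn (cut a b v)) (yn (cut a b v)) (yn (cut a b v)))).toReal ^ 2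
  have hC : 0 ≤ C := by positivity
  -- Twice 5/8 exceeds 1, so the mass is Hölder of order 5/4; the spare factor |y - x|^{1/4} makes
  -- its derivative vanish.
  have hb : ∀ x ∈ Icc a b, ∀ y ∈ Icc a b, |y - x| ≤ 1 →
      |mass v y - mass v x| ≤ C * |y - x| * |y - x| ^ (1 / 4 : ℝ) := by
    have e : ∀ x : ℝ, 0 ≤ x → (x ^ (5 / 8 : ℝ)) ^ 2 = x * x ^ (1 / 4 : ℝ) := by
      intro x hx
      rw [← Real.rpow_natCast, ← Real.rpow_mul hx]
      rcases hx.eq_or_lt with rfl | hx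
      · norm_num
      · nth_rewrite 2 [← Real.rpow_one x]
        rw [← Real.rpow_add hx]; norm_num
    intro x hx y hy hxy
    rcases le_total x y with h | h
    · rw [abs_of_nonneg (by linarith : 0 ≤ y - x)] at hxy ⊢
      have := hv.abs_mass_sub_le hε hx hy h hxy
      rwa [e _ (by linarith), ← mul_assoc] at this
    · rw [abs_sub_comm y x] at hxy ⊢
      rw [abs_sub_comm (mass v y)]
      rw [abs_of_nonneg (by linarith : 0 ≤ x - y)] at hxy ⊢
      have := hv.abs_mass_sub_le hε hy hx h hxy
      rwa [e _ (by linarith), ← mul_assoc] at this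
  have hder : ∀ x ∈ Icc a b, HasDerivWithinAt (mass v) 0 (Icc a b) x := by
    intro x hx
    rw [hasDerivWithinAt_iff_tendsto]
    have hlim : Tendsto (fun y : ℝ => C * |y - x| ^ (1 / 4 : ℝ)) (𝓝[Icc a b] x) (𝓝 0) := by
      have : Continuous fun y : ℝ => C * |y - x| ^ (1 / 4 : ℝ) :=
        continuous_const.mul ((continuous_abs.comp (continuous_id.sub continuous_const)).rpow_const
          fun _ => Or.inr (by norm_num))
      have h0 := this.tendsto x
      simp only [sub_self, abs_zero] at h0
      rw [Real.zero_rpow (by norm_num), mul_zero] at h0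
      exact h0.mono_left nhdsWithin_le_nhds
    refine squeeze_zero' (Eventually.of_forall fun y => by positivity) ?_ hlim
    have hnear : ∀ᶠ y in 𝓝[Icc a b] x, |y - x| ≤ 1 := by
      refine nhdsWithin_le_nhds (Metric.closedBall_mem_nhds x one_pos |> fun h => ?_)
      filter_upwards [h] with y hy
      rwa [Metric.mem_closedBall, Real.dist_eq] at hy
    filter_upwards [self_mem_nhdsWithin, hnear] with y hy hy1
    rw [smul_zero, sub_zero, Real.norm_eq_abs, Real.norm_eq_abs]
    have h1 := hb x hx y hy hy1
    rcases eq_or_ne (y - x) 0 with h0 | h0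
    · rw [h0]; simp
    · have hpos : 0 < |y - x| := abs_pos.2 h0
      rw [inv_mul_le_iff₀ hpos]
      linarith
  have hconst := constant_of_derivWithin_zero (f := mass v) (a := a) (b := b)
    (fun x hx => (hder x hx).differentiableWithinAt) fun x hx =>
      (hder x (Ico_subset_Icc_self hx)).derivWithin
        (uniqueDiffOn_Icc (hx.1.trans_lt hx.2) x (Ico_subset_Icc_self hx))
  rw [hconst s hs, hconst t ht]

lemma l2_mag_eq_of_mass_eq {f g : ℤ → ℂ} (hf : l2 (mag f) ≠ ∞) (hg : l2 (mag g) ≠ ∞)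
    (h : ∑' n, ‖f n‖ ^ 2 = ∑' n, ‖g n‖ ^ 2) : l2 (mag f) = l2 (mag g) := by
  have key : ∀ f : ℤ → ℂ, l2 (mag f) ≠ ∞ → l2 (mag f) ^ 2 = ENNReal.ofReal (∑' n, ‖f n‖ ^ 2) := by
    intro f hf
    rw [ENNReal.ofReal_tsum_of_nonneg (fun n => by positivity) (summable_of_tsum_sq hf), l2_sq]
    congr 1; ext n
    rw [mag, ← ofReal_norm, ENNReal.ofReal_pow (norm_nonneg _)]
  have e : l2 (mag f) ^ 2 = l2 (mag g) ^ 2 := by rw [key f hf, key g hg, h]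
  exact le_antisymm (le_of_sq_le e.le) (le_of_sq_le e.ge)

lemma IsSol.l2_mag_eq {ε : ℝ} (hε : |ε| ≤ 1) {a b : ℝ} {v : Family}
    (hv : IsSol (-(Complex.I * ε)) a b v) {s t : ℝ} (hs : s ∈ Icc a b) (ht : t ∈ Icc a b) :
    l2 (mag fun n => v n s) = l2 (mag fun n => v n t) :=
  l2_mag_eq_of_mass_eq (hv.l2_mag_ne_top hs) (hv.l2_mag_ne_top ht) (hv.mass_eq hε hs ht)

/-! ### Time steps, uniqueness and gluing -/

/-- A bound over short time steps propagates along an interval. -/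
lemma le_pow_mul_of_step {e : ℝ → ℝ≥0∞} {C : ℝ≥0∞} {a b δ : ℝ}
    (h : ∀ t ∈ Icc a b, ∀ t' ∈ Icc a b, |t - t'| ≤ δ → e t ≤ C * e t') (m : ℕ) :
    ∀ t ∈ Icc a b, ∀ t' ∈ Icc a b, |t - t'| ≤ m * δ → e t ≤ C ^ m * e t' := by
  induction m with
  | zero =>
    intro t _ t' _ hd
    have : t = t' := by
      rw [Nat.cast_zero, zero_mul] at hd
      exact sub_eq_zero.1 (abs_nonpos_iff.1 hd)
    simp [this]
  | succ m ih =>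
    intro t ht t' ht' hd
    have hm : (0 : ℝ) < m + 1 := by positivity
    -- The point that cuts off the last of m + 1 equal pieces, each of length at most δ.
    set u := t' + (m / (m + 1) : ℝ) * (t - t') with hu
    have h0 : (0 : ℝ) ≤ m / (m + 1) := by positivity
    have h1 : (m / (m + 1) : ℝ) ≤ 1 := by rw [div_le_one hm]; linarith
    have humem : u ∈ Icc a b := by
      have := (convex_Icc a b) ht' ht (sub_nonneg.2 h1) h0 (by ring)
      convert this using 1
      simp only [smul_eq_mul, hu]; ring
    push_cast at hd
    have e1 : t - u = (1 / (m + 1) : ℝ) * (t - t') := by rw [hu]; field_simp; ring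
    have e2 : u - t' = (m / (m + 1) : ℝ) * (t - t') := by rw [hu]; ring
    have d1 : |t - u| ≤ δ := by
      rw [e1, abs_mul, abs_of_pos (by positivity : (0 : ℝ) < 1 / (m + 1)), one_div,
        inv_mul_le_iff₀ hm]
      exact hd
    have d2 : |u - t'| ≤ m * δ := by
      rw [e2, abs_mul, abs_of_nonneg h0]
      calc (m / (m + 1) : ℝ) * |t - t'| ≤ (m / (m + 1) : ℝ) * ((m + 1) * δ) := by gcongr
        _ = m * δ := by field_simp
    calc e t ≤ C * e u := h t ht u humem d1
      _ ≤ C * (C ^ m * e t') := by gcongr; exact ih u humem t' ht' d2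
      _ = _ := by ring

/-- The length of the time steps in the `H^s` theory for `L²` size `K`. -/
def stepTime (s K : ℝ) : ℝ := (32 * (locConst s).toReal * (1 + K ^ 2)) ^ (-(8 / 5) : ℝ)

lemma one_le_locConst {s : ℝ} (hs : 0 ≤ s) : 1 ≤ (locConst s).toReal := by
  rw [← ENNReal.toReal_one]
  refine ENNReal.toReal_mono (locConst_ne_top s) (le_trans ?_ (locConst_zero_le hs))
  rw [locConst, Real.rpow_zero, ENNReal.ofReal_one, mul_one]
  calc (1 : ℝ≥0∞) = 1 * 1 := (one_mul 1).symm
    _ ≤ 96 * trilinConst := by gcongr; exacts [by norm_num, one_le_trilinConst]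

lemma stepTime_pos {s : ℝ} (hs : 0 ≤ s) (K : ℝ) : 0 < stepTime s K := by
  have := one_le_locConst hs
  unfold stepTime; positivity

lemma stepTime_le_one {s : ℝ} (hs : 0 ≤ s) (K : ℝ) : stepTime s K ≤ 1 := by
  have := one_le_locConst hs
  refine Real.rpow_le_one_of_one_le_of_nonpos ?_ (by norm_num)
  nlinarith [sq_nonneg K]

/-- The ratio of the L² step to the H^s step does not depend on K. Hence an existence time chosen at
regularity 0 is covered by a number of H^s steps that depends on s only. -/
lemma stepTime_zero_eq {s : ℝ} (hs : 0 ≤ s) (K : ℝ) :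
    stepTime 0 K = ((locConst s).toReal / (locConst 0).toReal) ^ (8 / 5 : ℝ) * stepTime s K := by
  have h1 := one_le_locConst hs
  have h0 := one_le_locConst le_rfl
  have hK : 0 < 1 + K ^ 2 := by positivity
  unfold stepTime
  rw [Real.rpow_neg (by positivity), Real.rpow_neg (by positivity), ← Real.inv_rpow (by positivity),
    ← Real.inv_rpow (by positivity), ← Real.mul_rpow (by positivity) (by positivity)]
  congr 1
  field_simp

/-- The exponent -8/5 inverts the power 5/8 of the length, and 32 = 2 · 16 produces the bound 1/2; 1
+ K² in place of K² keeps the step finite at K = 0. -/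
lemma stepTime_small {s : ℝ} (hs : 0 ≤ s) {K : ℝ≥0∞} (hK : K ≠ ∞) {a b : ℝ} (hab : a ≤ b)
    (h : b - a ≤ stepTime s K.toReal) :
    locConst s * ENNReal.ofReal ((b - a) ^ (5 / 8 : ℝ)) * (16 * K ^ 2) ≤ 2⁻¹ := by
  have hL := one_le_locConst hs
  set L := (locConst s).toReal with hLdef
  set k := K.toReal with hk
  have hk0 : 0 ≤ k := ENNReal.toReal_nonneg
  have e1 : locConst s = ENNReal.ofReal L := (ENNReal.ofReal_toReal (locConst_ne_top s)).symm
  have e2 : K = ENNReal.ofReal k := (ENNReal.ofReal_toReal hK).symm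
  have e3 : (16 : ℝ≥0∞) = ENNReal.ofReal 16 := by norm_num
  have e4 : (2⁻¹ : ℝ≥0∞) = ENNReal.ofReal 2⁻¹ := by
    rw [ENNReal.ofReal_inv_of_pos (by norm_num)]; norm_num
  rw [e1, e2, e3, e4, ← ENNReal.ofReal_pow hk0, ← ENNReal.ofReal_mul (by positivity),
    ← ENNReal.ofReal_mul (by positivity), ← ENNReal.ofReal_mul (by
      have : 0 ≤ (b - a) ^ (5 / 8 : ℝ) := Real.rpow_nonneg (by linarith) _
      positivity)]
  apply ENNReal.ofReal_le_ofReal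
  have h1 : (b - a) ^ (5 / 8 : ℝ) ≤ (32 * L * (1 + k ^ 2))⁻¹ := by
    calc (b - a) ^ (5 / 8 : ℝ) ≤ stepTime s k ^ (5 / 8 : ℝ) :=
          Real.rpow_le_rpow (by linarith) h (by norm_num)
      _ = _ := by
          unfold stepTime
          rw [← Real.rpow_mul (by positivity)]
          norm_num
          rw [Real.rpow_neg_one]
          simp [hLdef]
  calc L * (b - a) ^ (5 / 8 : ℝ) * (16 * k ^ 2)
      ≤ L * (32 * L * (1 + k ^ 2))⁻¹ * (16 * k ^ 2) := by gcongr
    _ = (k ^ 2 / (1 + k ^ 2)) * 2⁻¹ := by field_simp; ring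
    _ ≤ 1 * 2⁻¹ := by
        gcongr
        rw [div_le_one (by positivity)]; linarith
    _ = _ := one_mul _

lemma stepTime_small' {s : ℝ} (hs : 0 ≤ s) {K : ℝ≥0∞} (hK : K ≠ ∞) {a b : ℝ} (hab : a ≤ b)
    (h : b - a ≤ stepTime s K.toReal) :
    locConst s * ENNReal.ofReal ((b - a) ^ (5 / 8 : ℝ)) * (3 * K ^ 2) ≤ 2⁻¹ :=
  le_trans (by gcongr; norm_num) (stepTime_small hs hK hab h)

lemma mag_sub_le_yn_cut {a b t : ℝ} (ht : t ∈ Icc a b) (v w : Family) (n : ℤ) :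
    mag (fun m => v m t - w m t) n ≤ yn (cut a b (v - w)) n :=
  mag_le_yn_cut ht (v - w) n

section solutions

variable {c : ℂ} {a b : ℝ} {v w : Family}

/-- Lipschitz dependence of solutions on the data, on long time intervals. -/
theorem IsSol.wl2_sub_le_pow (hc : ‖c‖ₑ ≤ 1) {s : ℝ} (hs : 0 ≤ s) (hv : IsSol c a b v)
    (hw : IsSol c a b w) {M : ℝ≥0∞} (hM : M ≠ ∞) {δ : ℝ} (hδ : δ ≤ stepTime s M.toReal)
    (hvM : ∀ a' b', a' ≤ b' → b' - a' ≤ δ → Icc a' b' ⊆ Icc a b → wl2 s (yn (cut a' b' v)) ≤ M)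
    (hwM : ∀ a' b', a' ≤ b' → b' - a' ≤ δ → Icc a' b' ⊆ Icc a b → wl2 s (yn (cut a' b' w)) ≤ M)
    (m : ℕ) {t t' : ℝ} (ht : t ∈ Icc a b) (ht' : t' ∈ Icc a b) (hm : |t - t'| ≤ m * δ) :
    wl2 s (mag fun n => v n t - w n t) ≤ 4 ^ m * wl2 s (mag fun n => v n t' - w n t') := by
  refine le_pow_mul_of_step (e := fun t => wl2 s (mag fun n => v n t - w n t))
    (fun t ht t' ht' hd => ?_) m t ht t' ht' hm
  have hsub : Icc (min t t') (max t t') ⊆ Icc a b :=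
    Icc_subset_Icc (le_min ht.1 ht'.1) (max_le ht.2 ht'.2)
  have hle : min t t' ≤ max t t' := min_le_max
  have hlen : max t t' - min t t' ≤ δ := by rwa [max_sub_min_eq_abs, abs_sub_comm]
  have mt : t ∈ Icc (min t t') (max t t') := ⟨min_le_left _ _, le_max_left _ _⟩
  have mt' : t' ∈ Icc (min t t') (max t t') := ⟨min_le_right _ _, le_max_right _ _⟩
  refine (wl2_mono (mag_sub_le_yn_cut mt v w)).trans ?_
  exact IsSol.wl2_sub_le hc hs mt' (hlen.trans (hδ.trans (stepTime_le_one hs _))) hM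
    (stepTime_small' hs hM hle (hlen.trans hδ)) (hv.restrict hsub) (hw.restrict hsub)
    (hvM _ _ hle hlen hsub) (hwM _ _ hle hlen hsub)

lemma exists_nat_mul_ge {δ : ℝ} (hδ : 0 < δ) (x : ℝ) : ∃ m : ℕ, x ≤ m * δ := by
  obtain ⟨m, hm⟩ := exists_nat_ge (x / δ)
  exact ⟨m, (div_le_iff₀ hδ).1 hm⟩

/-- Uniqueness. -/
theorem IsSol.eqOn (hc : ‖c‖ₑ ≤ 1) (hv : IsSol c a b v) (hw : IsSol c a b w) {t₀ : ℝ}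
    (ht₀ : t₀ ∈ Icc a b) (h : ∀ n, v n t₀ = w n t₀) (n : ℤ) : EqOn (v n) (w n) (Icc a b) := by
  intro t ht
  -- The factor 4 pays for restriction, so that M bounds both solutions on every subinterval.
  set M := 4 * (l2 (yn (cut a b v)) + l2 (yn (cut a b w))) with hM
  have hMf : M ≠ ∞ := ENNReal.mul_ne_top (by norm_num) (ENNReal.add_ne_top.2 ⟨hv.fin, hw.fin⟩)
  obtain ⟨m, hm⟩ := exists_nat_mul_ge (stepTime_pos le_rfl M.toReal) |t - t₀|
  have key := IsSol.wl2_sub_le_pow hc le_rfl hv hw hMf le_rfl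
    (fun a' b' _ _ hsub => by
      rw [wl2_zero]
      exact (l2_yn_cut_le hsub v).trans (by rw [hM]; gcongr; exact le_self_add))
    (fun a' b' _ _ hsub => by
      rw [wl2_zero]
      exact (l2_yn_cut_le hsub w).trans (by rw [hM]; gcongr; exact le_add_self)) m ht ht₀ hm
  have hz : (mag fun n => v n t₀ - w n t₀) = fun _ => 0 := by
    ext n; simp [mag, h n]
  rw [hz, wl2_zero, wl2_zero, l2_zero, mul_zero] at key
  have h1 := (le_l2 (mag fun n => v n t - w n t) n).trans key
  have h2 : ‖v n t - w n t‖ₑ = 0 := le_antisymm h1 zero_le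
  rwa [enorm_eq_zero, sub_eq_zero] at h2

lemma cut_congr (h : ∀ n, EqOn (v n) (w n) (Icc a b)) : cut a b v = cut a b w := by
  ext n t
  by_cases ht : t ∈ Icc a b
  · simp only [cut, indicator_of_mem ht, h n ht]
  · simp only [cut, indicator_of_notMem ht]

lemma IsSol.congr (hv : IsSol c a b v) (h : ∀ n, EqOn (v n) (w n) (Icc a b)) : IsSol c a b w := by
  have e := cut_congr h
  refine ⟨e ▸ hv.fin, fun n s hs t ht => ?_⟩
  rw [← e, ← h n ht, ← h n hs]
  exact hv.eq n s hs t ht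

/-- The right piece is taken half-open so that the common endpoint is not counted twice; this second
cutoff costs the factor 4. -/
lemma wl2_yn_cut_union_le {d : ℝ} (hab : a ≤ b) (hbd : b ≤ d) (s : ℝ) (v : Family) :
    wl2 s (yn (cut a d v)) ≤ wl2 s (yn (cut a b v)) + 4 * wl2 s (yn (cut b d v)) := by
  rw [← wl2_const_mul]
  refine le_trans (wl2_mono fun n => ?_) (wl2_add_le s _ _)
  have e : cut a d v n = fun t => cut a b v n t + (Ioc b d).indicator (cut b d v n) t := by
    ext t
    by_cases h1 : t ∈ Icc a b
    · have h2 : t ∈ Icc a d := ⟨h1.1, h1.2.trans hbd⟩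
      have h3 : t ∉ Ioc b d := fun h => absurd h1.2 (not_le.2 h.1)
      simp only [cut, indicator_of_mem h1, indicator_of_mem h2, indicator_of_notMem h3, add_zero]
    · by_cases h2 : t ∈ Icc a d
      · have h4 : b < t := by
          by_contra h
          exact h1 ⟨h2.1, not_lt.1 h⟩
        have h3 : t ∈ Ioc b d := ⟨h4, h2.2⟩
        have h5 : t ∈ Icc b d := ⟨h4.le, h2.2⟩
        simp only [cut, indicator_of_notMem h1, indicator_of_mem h2, indicator_of_mem h3,
          indicator_of_mem h5, zero_add]
      · have h3 : t ∉ Ioc b d := fun h => h2 ⟨hab.trans h.1.le, h.2⟩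
        simp only [cut, indicator_of_notMem h1, indicator_of_notMem h2, indicator_of_notMem h3,
          add_zero]
  rw [yn, e]
  refine (yNorm_add_le _ _).trans (add_le_add le_rfl ?_)
  by_cases h : yNorm (cut b d v n) = ∞
  · simp [yn, h]
  · exact yNorm_le ((halfReg_yNorm h).indicator measurableSet_Ioc Ioo_subset_Ioc_self
      Ioc_subset_Icc_self)

/-- Solutions on adjacent intervals combine. -/
lemma IsSol.union {d : ℝ} (hab : a ≤ b) (hbd : b ≤ d) (h1 : IsSol c a b v) (h2 : IsSol c b d v) :
    IsSol c a d v := by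
  have hfin : l2 (yn (cut a d v)) ≠ ∞ := by
    have := wl2_yn_cut_union_le hab hbd 0 v
    simp only [wl2_zero] at this
    exact ne_top_of_le_ne_top (ENNReal.add_ne_top.2 ⟨h1.fin,
      ENNReal.mul_ne_top (by norm_num) h2.fin⟩) this
  refine ⟨hfin, fun n s hs t ht => ?_⟩
  have ev : ∀ n, EqOn (cut a b v n) (cut a d v n) (Icc a b) := fun n r hr => by
    rw [cut_eqOn a b v n hr, cut_eqOn a d v n ⟨hr.1, hr.2.trans hbd⟩]
  have ew : ∀ n, EqOn (cut b d v n) (cut a d v n) (Icc b d) := fun n r hr => by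
    rw [cut_eqOn b d v n hr, cut_eqOn a d v n ⟨hab.trans hr.1, hr.2⟩]
  -- Every time is compared with the junction b, so only one of the two equations is needed for each
  -- comparison.
  have key : ∀ r ∈ Icc a d,
      v n r - v n b = c * gam (cut a d v) (cut a d v) (cut a d v) n b r := by
    intro r hr
    rcases le_total r b with h | h
    · rw [h1.eq n b ⟨hab, le_rfl⟩ r ⟨hr.1, h⟩, gam_congr ev ev ev n ⟨hab, le_rfl⟩ ⟨hr.1, h⟩]
    · rw [h2.eq n b ⟨le_rfl, hbd⟩ r ⟨h, hr.2⟩, gam_congr ew ew ew n ⟨le_rfl, hbd⟩ ⟨h, hr.2⟩]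
  have e1 := key t ht
  have e2 := key s hs
  have e3 := gam_add_adjacent hfin hfin hfin n b s t
  linear_combination e1 - e2 - c * e3

lemma IsSol.glue {d : ℝ} (hab : a ≤ b) (hbd : b ≤ d) (h1 : IsSol c a b v) (h2 : IsSol c b d w)
    (h : ∀ n, v n b = w n b) :
    ∃ u : Family, IsSol c a d u ∧ (∀ n, EqOn (v n) (u n) (Icc a b)) ∧
      (∀ n, EqOn (w n) (u n) (Icc b d)) := by
  have e1 : ∀ n, EqOn (v n) (fun t => if t ≤ b then v n t else w n t) (Icc a b) :=
    fun n t ht => (if_pos ht.2).symm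
  have e2 : ∀ n, EqOn (w n) (fun t => if t ≤ b then v n t else w n t) (Icc b d) := by
    intro n t ht
    rcases ht.1.eq_or_lt with rfl | hlt
    · simp [h n]
    · exact (if_neg (not_le.2 hlt)).symm
  exact ⟨fun n t => if t ≤ b then v n t else w n t,
    IsSol.union hab hbd (h1.congr e1) (h2.congr e2), e1, e2⟩

end solutions

/-! ### Global existence -/

section global

variable {ε : ℝ}

lemma enorm_coeff_le (hε : |ε| ≤ 1) : ‖-(Complex.I * (ε : ℂ))‖ₑ ≤ 1 := by
  rw [← ofReal_norm, ← ENNReal.ofReal_one]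
  exact ENNReal.ofReal_le_ofReal (by simpa using hε)

/-- Persistence of regularity with a time step that depends on the mass only. -/
theorem IsSol.wl2_yn_cut_le_data (hε : |ε| ≤ 1) {s : ℝ} (hs : 0 ≤ s) {a b a' b' t : ℝ}
    {v : Family} (hv : IsSol (-(Complex.I * ε)) a b v) {K : ℝ≥0∞} (hK : K ≠ ∞)
    (hvK : l2 (mag fun n => v n t) ≤ K) (hsub : Icc a' b' ⊆ Icc a b) (ht : t ∈ Icc a' b')
    (hlen : b' - a' ≤ stepTime s K.toReal) :
    wl2 s (yn (cut a' b' v)) ≤ 4 * wl2 s (mag fun n => v n t) := by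
  by_cases hfin : wl2 s (mag fun n => v n t) = ∞
  · simp [hfin]
  -- The local solution launched from the values at t coincides with v by uniqueness, and v inherits
  -- its H^s bound.
  obtain ⟨w, hw, hwt, hws, -⟩ := exists_isSol (enorm_coeff_le hε) hs ht
    (hlen.trans (stepTime_le_one hs _)) hK hfin (stepTime_small hs hK (ht.1.trans ht.2) hlen)
    hvK le_rfl
  rw [cut_congr (IsSol.eqOn (enorm_coeff_le hε) (hv.restrict hsub) hw ht fun n => (hwt n).symm)]
  exact hws

/-- Existence on long time intervals. -/
lemma exists_isSol_nat (hε : |ε| ≤ 1) {s : ℝ} (hs : 0 ≤ s) {φ : ℤ → ℂ}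
    (hφ : wl2 s (mag φ) ≠ ∞) (m : ℕ) :
    ∃ v : Family, IsSol (-(Complex.I * ε)) (-(m * stepTime s (l2 (mag φ)).toReal))
      (m * stepTime s (l2 (mag φ)).toReal) v ∧ (∀ n, v n 0 = φ n) ∧
      wl2 s (yn (cut (-(m * stepTime s (l2 (mag φ)).toReal))
        (m * stepTime s (l2 (mag φ)).toReal) v)) ≠ ∞ := by
  have hK : l2 (mag φ) ≠ ∞ := ne_top_of_le_ne_top hφ (l2_le_wl2 hs _)
  have hc := enorm_coeff_le hε
  set K := l2 (mag φ) with hKdef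
  set δ := stepTime s K.toReal with hδ
  have hδ0 : 0 < δ := stepTime_pos hs _
  have hδ1 : δ ≤ 1 := stepTime_le_one hs _
  induction m with
  | zero =>
    obtain ⟨v, h1, h2, h3, -⟩ := exists_isSol hc hs (left_mem_Icc.2 (le_refl (0 : ℝ)))
      (by norm_num) hK hφ (stepTime_small hs hK le_rfl (by rw [sub_zero]; exact hδ0.le)) le_rfl
      le_rfl
    refine ⟨v, by simpa using h1, h2, ?_⟩
    simp only [Nat.cast_zero, zero_mul, neg_zero]
    exact ne_top_of_le_ne_top (ENNReal.mul_ne_top (by norm_num) hφ) h3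
  | succ m ih =>
    obtain ⟨v, hv, hv0, hvs⟩ := ih
    set τ := m * δ with hτ
    have hτ0 : 0 ≤ τ := by positivity
    have hτs : ((m + 1 : ℕ) : ℝ) * δ = τ + δ := by push_cast; ring
    rw [hτs]
    have m0 : (0 : ℝ) ∈ Icc (-τ) τ := ⟨by linarith, hτ0⟩
    have mr : τ ∈ Icc (-τ) τ := ⟨by linarith, le_rfl⟩
    have ml : -τ ∈ Icc (-τ) τ := ⟨le_rfl, by linarith⟩
    -- Conservation of mass keeps the ℓ² size equal to K, so both new pieces may have the same
    -- length δ.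
    have hmass : ∀ t ∈ Icc (-τ) τ, l2 (mag fun n => v n t) = K := by
      intro t ht
      rw [hv.l2_mag_eq hε ht m0, hKdef]
      simp_rw [hv0]
    have hfs : ∀ t ∈ Icc (-τ) τ, wl2 s (mag fun n => v n t) ≠ ∞ := fun t ht =>
      ne_top_of_le_ne_top hvs (wl2_mono (mag_le_yn_cut ht v))
    obtain ⟨wr, hwr, hwr0, hwrs, -⟩ := exists_isSol hc hs (a := τ) (b := τ + δ)
      (left_mem_Icc.2 (by linarith)) (by linarith) hK (hfs τ mr)
      (stepTime_small hs hK (by linarith) (by linarith)) (hmass τ mr).le le_rfl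
    obtain ⟨wl, hwl, hwl0, hwls, -⟩ := exists_isSol hc hs (a := -(τ + δ)) (b := -τ)
      (right_mem_Icc.2 (by linarith)) (by linarith) hK (hfs (-τ) ml)
      (stepTime_small hs hK (by linarith) (by linarith)) (hmass (-τ) ml).le le_rfl
    obtain ⟨u, hu, hu1, hu2⟩ := IsSol.glue (by linarith) (by linarith) hv hwr
      fun n => (hwr0 n).symm
    obtain ⟨z, hz, hz1, hz2⟩ := IsSol.glue (by linarith) (by linarith) hwl hu
      fun n => by rw [hwl0, ← hu1 n ml]
    refine ⟨z, hz, fun n => ?_, ?_⟩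
    · rw [← hz2 n ⟨m0.1, by linarith⟩, ← hu1 n m0, hv0]
    · refine ne_top_of_le_ne_top ?_ (wl2_yn_cut_union_le (a := -(τ + δ)) (b := -τ) (d := τ + δ)
        (by linarith) (by linarith) s z)
      rw [← cut_congr hz1, ← cut_congr hz2]
      refine ENNReal.add_ne_top.2 ⟨ne_top_of_le_ne_top (ENNReal.mul_ne_top (by norm_num)
        (hfs (-τ) ml)) hwls, ENNReal.mul_ne_top (by norm_num) ?_⟩
      refine ne_top_of_le_ne_top ?_ (wl2_yn_cut_union_le (a := -τ) (b := τ) (d := τ + δ)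
        (by linarith) (by linarith) s u)
      rw [← cut_congr hu1, ← cut_congr hu2]
      exact ENNReal.add_ne_top.2 ⟨hvs, ENNReal.mul_ne_top (by norm_num) (ne_top_of_le_ne_top
        (ENNReal.mul_ne_top (by norm_num) (hfs τ mr)) hwrs)⟩

/-- Global existence. -/
theorem exists_isSol_global (hε : |ε| ≤ 1) {s : ℝ} (hs : 0 ≤ s) {φ : ℤ → ℂ}
    (hφ : wl2 s (mag φ) ≠ ∞) :
    ∃ v : Family, (∀ n, v n 0 = φ n) ∧ ∀ τ : ℝ, 0 ≤ τ →
      IsSol (-(Complex.I * ε)) (-τ) τ v ∧ wl2 s (yn (cut (-τ) τ v)) ≠ ∞ := by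
  have hc := enorm_coeff_le hε
  choose V hV hV0 hVs using exists_isSol_nat hε hs hφ
  set δ := stepTime s (l2 (mag φ)).toReal with hδ
  have hδ0 : 0 < δ := stepTime_pos hs _
  have hcons : ∀ m m' : ℕ, m ≤ m' → ∀ n, EqOn (V m n) (V m' n) (Icc (-(m * δ)) (m * δ)) := by
    intro m m' hmm
    have h1 : (m : ℝ) * δ ≤ m' * δ := by gcongr
    have h0 : 0 ≤ m * δ := by positivity
    exact IsSol.eqOn hc (hV m) ((hV m').restrict (Icc_subset_Icc (by linarith) h1))
      (t₀ := 0) ⟨by linarith, h0⟩ fun n => by rw [hV0, hV0]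
  -- The index is the least number of steps whose interval contains t; uniqueness makes the choice
  -- immaterial.
  set v : Family := fun n t => V ⌈|t| / δ⌉₊ n t with hv
  have hveq : ∀ m : ℕ, ∀ n, EqOn (V m n) (v n) (Icc (-(m * δ)) (m * δ)) := by
    intro m n t ht
    have h1 : |t| ≤ m * δ := abs_le.2 ht
    have h2 : ⌈|t| / δ⌉₊ ≤ m := Nat.ceil_le.2 ((div_le_iff₀ hδ0).2 h1)
    have h3 : |t| ≤ ⌈|t| / δ⌉₊ * δ := (div_le_iff₀ hδ0).1 (Nat.le_ceil _)
    exact (hcons _ m h2 n (abs_le.1 h3)).symm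
  refine ⟨v, fun n => ?_, fun τ hτ => ?_⟩
  · rw [← hveq 0 n (by simp), hV0]
  · obtain ⟨m, hm⟩ := exists_nat_mul_ge hδ0 τ
    have hsub : Icc (-τ) τ ⊆ Icc (-(m * δ)) (m * δ) := Icc_subset_Icc (by linarith) hm
    refine ⟨((hV m).congr (hveq m)).restrict hsub, ?_⟩
    refine ne_top_of_le_ne_top ?_ (wl2_yn_cut_le hsub s v)
    rw [← cut_congr (hveq m)]
    exact ENNReal.mul_ne_top (by norm_num) (hVs m)

end global

/-! ### The Fourier transform in time and the spaces H^b -/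

open scoped FourierTransform in
/-- Plancherel's identity for functions in `L¹ ∩ L²`. -/
theorem lintegral_enorm_fourier_sq {f : ℝ → ℂ} (hf : Integrable f) (hf2 : MemLp f 2) :
    ∫⁻ ξ, ‖𝓕 f ξ‖ₑ ^ 2 = ∫⁻ x, ‖f x‖ₑ ^ 2 := by
  have hcont : Continuous (𝓕 f) := VectorFourier.fourierIntegral_continuous
    Real.continuous_fourierChar (by fun_prop) hf
  -- The L² Fourier transform is identified with the integral one by testing against smooth
  -- compactly supported functions, where both obey the multiplication formula.
  have hae : ∀ᵐ ξ, (𝓕 (hf2.toLp f) : Lp ℂ 2 (volume : Measure ℝ)) ξ = 𝓕 f ξ := by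
    refine ae_eq_of_integral_contDiff_smul_eq ?_ hcont.locallyIntegrable fun g hg hgc => ?_
    · exact (Lp.memLp _).locallyIntegrable (by norm_num)
    · have hgc' : HasCompactSupport (fun x => (g x : ℂ)) := hgc.comp_left Complex.ofReal_zero
      have hg' : ContDiff ℝ ((⊤ : ℕ∞) : WithTop ℕ∞) (fun x => (g x : ℂ)) := Complex.ofRealCLM.contDiff.comp hg
      set G := hgc'.toSchwartzMap hg' with hG
      have hGx : ∀ x, G x = (g x : ℂ) := fun x => rfl
      have e1 := DFunLike.congr_fun
        (Lp.fourier_toTemperedDistribution_eq (hf2.toLp f : Lp ℂ 2 (volume : Measure ℝ))) G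
      rw [TemperedDistribution.fourier_apply, Lp.toTemperedDistribution_apply,
        Lp.toTemperedDistribution_apply] at e1
      have e2 : ∫ x, (𝓕 G) x • (hf2.toLp f) x = ∫ x, (𝓕 G) x • f x := by
        refine integral_congr_ae ?_
        filter_upwards [hf2.coeFn_toLp] with x hx
        rw [hx]
      have e3 : ∫ ξ, 𝓕 (G : ℝ → ℂ) ξ • f ξ = ∫ x, G x • 𝓕 f x := by
        have := VectorFourier.integral_fourierIntegral_smul_eq_flip (L := innerₗ ℝ)
          (μ := volume) (ν := volume) Real.continuous_fourierChar (by fun_prop)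
          (G.integrable) hf
        rw [flip_innerₗ] at this
        exact this
      simp only [hGx] at e1 e3
      calc ∫ x, g x • (𝓕 (hf2.toLp f) : Lp ℂ 2 (volume : Measure ℝ)) x
          = ∫ x, (g x : ℂ) • (𝓕 (hf2.toLp f) : Lp ℂ 2 (volume : Measure ℝ)) x := by simp
        _ = ∫ x, (g x : ℂ) • 𝓕 f x := by
          rw [← e1, e2, ← e3, SchwartzMap.fourier_coe]
        _ = _ := by simp
  have hn := Lp.norm_fourier_eq (hf2.toLp f : Lp ℂ 2 (volume : Measure ℝ))
  rw [Lp.norm_def, Lp.norm_def, eLpNorm_congr_ae hae, eLpNorm_congr_ae hf2.coeFn_toLp] at hn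
  have h1 : eLpNorm (𝓕 f) 2 volume ≠ ∞ := by
    rw [← eLpNorm_congr_ae hae]; exact (Lp.memLp _).2.ne
  rw [ENNReal.toReal_eq_toReal_iff' h1 hf2.2.ne] at hn
  rw [← eLpNorm_two_sq, ← eLpNorm_two_sq, hn]

/-- The inverse Fourier transform in time, normalized as in `Extends`. -/
def invF (G : ℝ → ℂ) (t : ℝ) : ℂ :=
  ((2 * Real.pi : ℝ) : ℂ)⁻¹ * ∫ τ : ℝ, Complex.exp (Complex.I * (t : ℂ) * (τ : ℂ)) * G τ

/-- The Fourier transform in time. -/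
def fwdF (f : ℝ → ℂ) (τ : ℝ) : ℂ := ∫ t : ℝ, Complex.exp (-(Complex.I * (t : ℂ) * (τ : ℂ))) * f t

open scoped FourierTransform in
lemma fwdF_eq (f : ℝ → ℂ) (τ : ℝ) : fwdF f τ = 𝓕 f ((2 * Real.pi)⁻¹ * τ) := by
  rw [Real.fourier_eq', fwdF]
  congr 1; ext t
  rw [smul_eq_mul]
  congr 2
  have : (Real.pi : ℂ) ≠ 0 := by exact_mod_cast Real.pi_ne_zero
  simp only [RCLike.inner_apply, conj_trivial]
  push_cast
  field_simp

lemma invF_eq (G : ℝ → ℂ) (t : ℝ) : invF G t = ((2 * Real.pi : ℝ) : ℂ)⁻¹ * fwdF G (-t) := by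
  unfold invF fwdF
  congr 3; ext τ
  congr 2
  push_cast; ring

lemma lintegral_comp_mul_left_eq (f : ℝ → ℝ≥0∞) {a : ℝ} (ha : 0 < a) :
    ∫⁻ x, f (a * x) = ENNReal.ofReal a⁻¹ * ∫⁻ x, f x := by
  have h := Real.map_volume_mul_left ha.ne'
  have e := (Homeomorph.mulLeft₀ a ha.ne').measurableEmbedding.lintegral_map f (μ := volume)
  simp only [Homeomorph.coe_mulLeft₀] at e
  rw [← e, h, lintegral_smul_measure, abs_of_pos (inv_pos.2 ha)]
  rfl

lemma lintegral_fwdF_sq {f : ℝ → ℂ} (hf : Integrable f) (hf2 : MemLp f 2) :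
    ∫⁻ τ, ‖fwdF f τ‖ₑ ^ 2 = ENNReal.ofReal (2 * Real.pi) * ∫⁻ x, ‖f x‖ₑ ^ 2 := by
  simp_rw [fwdF_eq]
  rw [lintegral_comp_mul_left_eq (fun ξ => ‖FourierTransform.fourier f ξ‖ₑ ^ 2) (by positivity),
    inv_inv, lintegral_enorm_fourier_sq hf hf2]

lemma lintegral_invF_sq_le {G : ℝ → ℂ} (hG : Integrable G) (hG2 : MemLp G 2) :
    ∫⁻ t, ‖invF G t‖ₑ ^ 2 ≤ ENNReal.ofReal (2 * Real.pi)⁻¹ * ∫⁻ x, ‖G x‖ₑ ^ 2 := by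
  have hpi : 0 < 2 * Real.pi := by positivity
  have e : ‖((2 * Real.pi : ℝ) : ℂ)⁻¹‖ₑ = ENNReal.ofReal (2 * Real.pi)⁻¹ := by
    rw [← ofReal_norm, norm_inv, Complex.norm_real, Real.norm_of_nonneg hpi.le]
  simp_rw [invF_eq, enorm_mul, mul_pow, e]
  rw [lintegral_const_mul' _ _ (by simp), lintegral_neg_eq_self (fun t => ‖fwdF G t‖ₑ ^ 2)
    , lintegral_fwdF_sq hG hG2, ← mul_assoc, sq, mul_assoc (ENNReal.ofReal (2 * Real.pi)⁻¹),
    ← ENNReal.ofReal_mul (by positivity : 0 ≤ (2 * Real.pi)⁻¹), inv_mul_cancel₀ hpi.ne',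
    ENNReal.ofReal_one, mul_one]

lemma continuous_fwdF {f : ℝ → ℂ} (hf : Integrable f) : Continuous (fwdF f) := by
  have hcont : Continuous (FourierTransform.fourier f) := VectorFourier.fourierIntegral_continuous
    Real.continuous_fourierChar (by fun_prop) hf
  have : fwdF f = fun τ => FourierTransform.fourier f ((2 * Real.pi)⁻¹ * τ) := funext (fwdF_eq f)
  rw [this]
  exact hcont.comp (continuous_const.mul continuous_id)

lemma continuous_invF {f : ℝ → ℂ} (hf : Integrable f) : Continuous (invF f) := by
  have : invF f = fun τ => ((2 * Real.pi : ℝ) : ℂ)⁻¹ * fwdF f (-τ) := funext (invF_eq f)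
  rw [this]
  exact continuous_const.mul ((continuous_fwdF hf).comp continuous_neg)

lemma invF_fwdF {f : ℝ → ℂ} (hc : Continuous f) (hf : Integrable f) (hF : Integrable (fwdF f)) :
    invF (fwdF f) = f := by
  have hpi : 0 < 2 * Real.pi := by positivity
  have hF' : Integrable (FourierTransform.fourier f) := by
    have := hF.comp_mul_left' hpi.ne'
    refine this.congr (Eventually.of_forall fun τ => ?_)
    simp only [fwdF_eq]
    rw [inv_mul_cancel_left₀ hpi.ne']
  have h := hc.fourierInv_fourier_eq hf hF'
  ext t
  rw [← congrFun h t, Real.fourierInv_eq', invF]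
  have hsub := Measure.integral_comp_mul_left
    (fun τ => Complex.exp (Complex.I * (t : ℂ) * (τ : ℂ)) * fwdF f τ) (2 * Real.pi)
  rw [abs_of_pos (inv_pos.2 hpi)] at hsub
  have e : ((2 * Real.pi : ℝ) : ℂ)⁻¹ * ∫ τ : ℝ,
      Complex.exp (Complex.I * (t : ℂ) * (τ : ℂ)) * fwdF f τ
      = (2 * Real.pi)⁻¹ • ∫ τ : ℝ, Complex.exp (Complex.I * (t : ℂ) * (τ : ℂ)) * fwdF f τ := by
    rw [Complex.real_smul]; push_cast; rfl
  rw [e, ← hsub]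
  congr 1; ext ξ
  rw [fwdF_eq, inv_mul_cancel_left₀ hpi.ne', smul_eq_mul]
  congr 2
  simp only [RCLike.inner_apply, conj_trivial]
  push_cast; ring

/-- The squared `H^b` norm in time, on the Fourier side. -/
def hbSq (b : ℝ) (G : ℝ → ℂ) : ℝ≥0∞ :=
  ∫⁻ τ, ENNReal.ofReal (bracket τ ^ (2 * b)) * ‖G τ‖ₑ ^ 2

lemma lintegral_mul_sq_le {α : Type*} [MeasurableSpace α] (μ : Measure α) {f g : α → ℝ≥0∞}
    (hf : AEMeasurable f μ) (hg : AEMeasurable g μ) :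
    (∫⁻ x, f x * g x ∂μ) ^ 2 ≤ (∫⁻ x, f x ^ 2 ∂μ) * ∫⁻ x, g x ^ 2 ∂μ := by
  have h := ENNReal.lintegral_mul_le_Lp_mul_Lq μ Real.HolderConjugate.two_two hf hg
  simp only [Pi.mul_apply, ENNReal.rpow_ofNat] at h
  calc _ ≤ ((∫⁻ x, f x ^ 2 ∂μ) ^ (1 / 2 : ℝ) * (∫⁻ x, g x ^ 2 ∂μ) ^ (1 / 2 : ℝ)) ^ 2 := by gcongr
    _ = _ := by rw [mul_pow, rpow_half_sq, rpow_half_sq]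

/-- The product of the bounds 2 and |x|: a single power of |x| for the square corresponds to half a
derivative. -/
lemma norm_exp_sub_one_sq_le (x : ℝ) : ‖Complex.exp (Complex.I * (x : ℂ)) - 1‖ ^ 2 ≤ 2 * |x| := by
  have h1 : ‖Complex.exp (Complex.I * (x : ℂ)) - 1‖ ≤ |x| := by
    have := Real.norm_exp_I_mul_ofReal_sub_one_le (x := x)
    simpa using this
  have h2 : ‖Complex.exp (Complex.I * (x : ℂ)) - 1‖ ≤ 2 := by
    refine (norm_sub_le _ _).trans ?_
    rw [mul_comm, Complex.norm_exp_ofReal_mul_I, norm_one]; norm_num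
  rw [sq]
  exact mul_le_mul h2 h1 (norm_nonneg _) (by norm_num)

lemma continuous_bracket_rpow (r : ℝ) : Continuous fun τ : ℝ => bracket τ ^ r := by
  have : Continuous bracket := by
    have e : bracket = fun x => Real.sqrt (1 + x ^ 2) := funext bracket_eq_sqrt
    rw [e]; fun_prop
  exact this.rpow_const fun x => Or.inl (by have := one_le_bracket x; positivity)

lemma lintegral_bracket_ne_top {b : ℝ} (hb : 1 / 2 < b) :
    ∫⁻ τ : ℝ, ENNReal.ofReal (bracket τ ^ (-(2 * b))) ≠ ∞ := by
  have hi : Integrable fun x : ℝ => (1 + ‖x‖ ^ 2) ^ (-(2 * b) / 2) :=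
    integrable_rpow_neg_one_add_norm_sq (by simp; linarith)
  have := hi.lintegral_lt_top
  refine ne_of_lt (lt_of_le_of_lt (lintegral_mono fun x => ENNReal.ofReal_le_ofReal ?_) this)
  rw [bracket, ← Real.rpow_mul (by positivity), Real.norm_eq_abs, sq_abs]
  ring_nf
  exact le_rfl

/-- Cauchy–Schwarz after inserting ⟨τ⟩^{-b}⟨τ⟩^b; the first factor is finite for b > 1/2. -/
lemma lintegral_enorm_le_hbSq (b : ℝ) {G : ℝ → ℂ} (hG : Measurable G) :
    ∫⁻ τ, ‖G τ‖ₑ ≤ (∫⁻ τ : ℝ, ENNReal.ofReal (bracket τ ^ (-(2 * b)))) ^ (1 / 2 : ℝ)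
      * hbSq b G ^ (1 / 2 : ℝ) := by
  have hb0 : ∀ x, 0 < bracket x := fun x => zero_lt_one.trans_le (one_le_bracket x)
  refine le_of_sq_le ?_
  rw [mul_pow, rpow_half_sq, rpow_half_sq]
  have m1 : Measurable fun τ : ℝ => ENNReal.ofReal (bracket τ ^ (-b)) :=
    (continuous_bracket_rpow _).measurable.ennreal_ofReal
  have m2 : Measurable fun τ : ℝ => ENNReal.ofReal (bracket τ ^ b) * ‖G τ‖ₑ :=
    (continuous_bracket_rpow _).measurable.ennreal_ofReal.mul hG.enorm
  have := lintegral_mul_sq_le volume m1.aemeasurable m2.aemeasurable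
  refine le_trans (le_of_eq ?_) (this.trans (le_of_eq ?_))
  · congr 1
    refine lintegral_congr fun τ => ?_
    rw [← mul_assoc, ← ENNReal.ofReal_mul (Real.rpow_nonneg (hb0 τ).le _),
      ← Real.rpow_add (hb0 τ)]
    simp
  · congr 1
    · refine lintegral_congr fun τ => ?_
      rw [← ENNReal.ofReal_pow (Real.rpow_nonneg (hb0 τ).le _), ← Real.rpow_natCast,
        ← Real.rpow_mul (hb0 τ).le]
      congr 2; push_cast; ring
    · refine lintegral_congr fun τ => ?_
      rw [mul_pow, ← ENNReal.ofReal_pow (Real.rpow_nonneg (hb0 τ).le _), ← Real.rpow_natCast,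
        ← Real.rpow_mul (hb0 τ).le]
      congr 3; push_cast; ring

lemma integrable_of_hbSq {b : ℝ} (hb : 1 / 2 < b) {G : ℝ → ℂ} (hG : Measurable G)
    (h : hbSq b G ≠ ∞) : Integrable G :=
  ⟨hG.aestronglyMeasurable, lt_of_le_of_lt (lintegral_enorm_le_hbSq b hG)
    (ENNReal.mul_lt_top (ENNReal.rpow_lt_top_of_nonneg (by norm_num) (lintegral_bracket_ne_top hb))
      (ENNReal.rpow_lt_top_of_nonneg (by norm_num) h))⟩

/-- Functions in `H^b`, `b > 1/2`, are bounded and have half a derivative. -/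
theorem exists_halfReg_invF {b : ℝ} (hb : 1 / 2 < b) :
    ∃ C : ℝ≥0∞, C ≠ ∞ ∧ ∀ G : ℝ → ℂ, Measurable G → hbSq b G ≠ ∞ →
      HalfReg (C * hbSq b G ^ (1 / 2 : ℝ)) (invF G) := by
  set S := ∫⁻ τ : ℝ, ENNReal.ofReal (bracket τ ^ (-(2 * b))) with hS
  have hSf : S ≠ ∞ := lintegral_bracket_ne_top hb
  refine ⟨S ^ (1 / 2 : ℝ) + 1, ENNReal.add_ne_top.2 ⟨ENNReal.rpow_ne_top_of_nonneg (by norm_num)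
    hSf, by norm_num⟩, fun G hG hfin => ?_⟩
  set N := hbSq b G ^ (1 / 2 : ℝ) with hN
  have hN2 : N ^ 2 = hbSq b G := rpow_half_sq _
  have hNf : N ≠ ∞ := ENNReal.rpow_ne_top_of_nonneg (by norm_num) hfin
  have hb0 : ∀ x, 0 < bracket x := fun x => zero_lt_one.trans_le (one_le_bracket x)
  have hL1 : ∫⁻ τ, ‖G τ‖ₑ ≤ S ^ (1 / 2 : ℝ) * N := lintegral_enorm_le_hbSq b hG
  have hint : Integrable G := integrable_of_hbSq hb hG hfin
  have hpi : 0 < 2 * Real.pi := by positivity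
  have hpi1 : (2 * Real.pi)⁻¹ ≤ 2⁻¹ := by
    gcongr; nlinarith [Real.pi_gt_three]
  refine ⟨(continuous_invF hint).measurable, fun t => ?_, fun h hh => ?_⟩
  · rw [invF, enorm_mul]
    calc _ ≤ 1 * (S ^ (1 / 2 : ℝ) * N) := by
          gcongr
          · rw [← ofReal_norm, norm_inv, Complex.norm_real, Real.norm_of_nonneg hpi.le,
              ENNReal.ofReal_le_one]
            linarith
          · refine (enorm_integral_le_lintegral_enorm _).trans (le_trans (le_of_eq ?_) hL1)
            refine lintegral_congr fun τ => ?_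
            have e : Complex.I * (t : ℂ) * (τ : ℂ) = ((t * τ : ℝ) : ℂ) * Complex.I := by
              push_cast; ring
            rw [enorm_mul, e, ← ofReal_norm, Complex.norm_exp_ofReal_mul_I]; simp
      _ ≤ _ := by rw [one_mul, add_mul]; exact le_self_add
  -- A time shift by h multiplies the transform by e^{ihτ}; the square of the difference gains 2h|τ|
  -- ≤ 2h⟨τ⟩^{2b}, using 2b ≥ 1.
  · set H : ℝ → ℂ := fun τ => (Complex.exp (Complex.I * ((h * τ : ℝ) : ℂ)) - 1) * G τ with hH
    have hHm : Measurable H := (Continuous.measurable (by fun_prop)).mul hG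
    have hH2 : ∀ τ, ‖H τ‖ₑ ^ 2 ≤ ENNReal.ofReal (2 * h) *
        (ENNReal.ofReal (bracket τ ^ (2 * b)) * ‖G τ‖ₑ ^ 2) := by
      intro τ
      rw [hH, enorm_mul, mul_pow, ← mul_assoc, ← ENNReal.ofReal_mul (by positivity)]
      gcongr
      rw [← ofReal_norm, ← ENNReal.ofReal_pow (norm_nonneg _)]
      refine ENNReal.ofReal_le_ofReal ((norm_exp_sub_one_sq_le _).trans ?_)
      rw [abs_mul, abs_of_pos hh, ← mul_assoc]
      gcongr
      have h1 : |τ| ≤ bracket τ := by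
        rw [bracket_eq_sqrt]; exact Real.abs_le_sqrt (by linarith)
      have h2 : bracket τ ^ (1 : ℝ) ≤ bracket τ ^ (2 * b) :=
        Real.rpow_le_rpow_of_exponent_le (one_le_bracket τ) (by linarith)
      rw [Real.rpow_one] at h2
      exact h1.trans h2
    have hHl : ∫⁻ τ, ‖H τ‖ₑ ^ 2 ≤ ENNReal.ofReal (2 * h) * N ^ 2 := by
      refine (lintegral_mono hH2).trans (le_of_eq ?_)
      rw [lintegral_const_mul' _ _ ENNReal.ofReal_ne_top, hN2, hbSq]
    have hexp : ∀ r : ℝ, Integrable fun τ : ℝ => Complex.exp (Complex.I * (r : ℂ) * (τ : ℂ)) * G τ := by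
      intro r
      refine hint.bdd_mul (c := 1) (Continuous.aestronglyMeasurable (by fun_prop))
        (Eventually.of_forall fun τ => ?_)
      have e : Complex.I * (r : ℂ) * (τ : ℂ) = ((r * τ : ℝ) : ℂ) * Complex.I := by push_cast; ring
      rw [e, Complex.norm_exp_ofReal_mul_I]
    have hHint : Integrable H := by
      have := (hexp h).sub hint
      refine this.congr (Eventually.of_forall fun τ => ?_)
      simp only [hH, Pi.sub_apply]
      push_cast; ring_nf
    have hHmem : MemLp H 2 := by
      refine ⟨hHm.aestronglyMeasurable, ?_⟩
      refine lt_top_iff_ne_top.2 fun htop => ?_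
      have h1 := eLpNorm_two_sq volume H
      rw [htop] at h1
      have h2 := ne_top_of_le_ne_top (ENNReal.mul_ne_top ENNReal.ofReal_ne_top
        (ENNReal.pow_ne_top hNf)) hHl
      exact h2 (by rw [← h1]; simp)
    have hdiff : ∀ t, invF G (t + h) - invF G t = invF H t := by
      intro t
      unfold invF
      rw [← mul_sub, ← integral_sub (hexp (t + h)) (hexp t)]
      congr 2; ext τ
      have e : Complex.I * ((t + h : ℝ) : ℂ) * (τ : ℂ)
          = Complex.I * (t : ℂ) * (τ : ℂ) + Complex.I * ((h * τ : ℝ) : ℂ) := by push_cast; ring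
      rw [e, Complex.exp_add]
      simp only [hH]; ring
    simp_rw [hdiff]
    calc ∫⁻ t, ‖invF H t‖ₑ ^ 2 ≤ ENNReal.ofReal (2 * Real.pi)⁻¹ * ∫⁻ x, ‖H x‖ₑ ^ 2 :=
          lintegral_invF_sq_le hHint hHmem
      _ ≤ ENNReal.ofReal 2⁻¹ * (ENNReal.ofReal (2 * h) * N ^ 2) := by gcongr
      _ = N ^ 2 * ENNReal.ofReal h := by
          rw [← mul_assoc, ← ENNReal.ofReal_mul (by norm_num), inv_mul_cancel_left₀ (by norm_num),
            mul_comm]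
      _ ≤ ((S ^ (1 / 2 : ℝ) + 1) * N) ^ 2 * ENNReal.ofReal h := by
          gcongr
          calc N = 1 * N := (one_mul N).symm
            _ ≤ _ := by gcongr; exact le_add_self

lemma le_norm_exp_sub_one_sq {x : ℝ} (h1 : 1 / 2 ≤ |x|) (h2 : |x| ≤ 1) :
    1 / 16 ≤ ‖Complex.exp (-(Complex.I * (x : ℂ))) - 1‖ ^ 2 := by
  have e : ‖Complex.exp (-(Complex.I * (x : ℂ))) - 1‖ ^ 2 = 2 - 2 * Real.cos x := by
    have : Complex.exp (-(Complex.I * (x : ℂ))) = ((Real.cos x : ℝ) : ℂ)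
        - ((Real.sin x : ℝ) : ℂ) * Complex.I := by
      rw [show -(Complex.I * (x : ℂ)) = ((-x : ℝ) : ℂ) * Complex.I by push_cast; ring,
        Complex.exp_mul_I, ← Complex.ofReal_cos, ← Complex.ofReal_sin, Real.cos_neg, Real.sin_neg]
      push_cast; ring
    rw [this, Complex.sq_norm, Complex.normSq_apply]
    simp [-Complex.ofReal_cos, -Complex.ofReal_sin]
    nlinarith [Real.sin_sq_add_cos_sq x]
  rw [e, ← Real.cos_abs]
  have hc : Real.cos |x| ≤ 1 - |x| ^ 2 / 2 + |x| ^ 4 * (5 / 96) := by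
    have := Real.cos_bound (x := |x|) (by rwa [abs_abs])
    rw [abs_le, abs_abs] at this
    linarith [this.2]
  have h3 : |x| ^ 4 ≤ |x| ^ 2 := by
    nlinarith [sq_nonneg |x|, mul_le_mul h2 h2 (abs_nonneg x) zero_le_one]
  nlinarith

/-- The lower half of the characterization of H^{9/16} by differences: 9/8 = 2 · 9/16 and 17/8 = 1 +
9/8. It suffices to integrate over h between 1/(2|τ|) and 1/|τ|, where |hτ| is of order one. -/
lemma enorm_sub_one_lower {τ : ℝ} (hτ : 1 ≤ |τ|) :
    ENNReal.ofReal (|τ| ^ (9 / 8 : ℝ)) ≤ 32 * ∫⁻ h in Ioc (0 : ℝ) 1,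
      ENNReal.ofReal (h ^ (-17 / 8 : ℝ)) *
        ‖Complex.exp (-(Complex.I * ((h * τ : ℝ) : ℂ))) - 1‖ₑ ^ 2 := by
  have hpos : 0 < |τ| := by linarith
  have hsub : Ioc (2 * |τ|)⁻¹ |τ|⁻¹ ⊆ Ioc (0 : ℝ) 1 := by
    refine Ioc_subset_Ioc (by positivity) ?_
    exact inv_le_one_of_one_le₀ hτ
  have hlow : ∫⁻ _ in Ioc (2 * |τ|)⁻¹ |τ|⁻¹, ENNReal.ofReal (|τ| ^ (17 / 8 : ℝ) * (1 / 16))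
      ≤ ∫⁻ h in Ioc (0 : ℝ) 1, ENNReal.ofReal (h ^ (-17 / 8 : ℝ)) *
        ‖Complex.exp (-(Complex.I * ((h * τ : ℝ) : ℂ))) - 1‖ₑ ^ 2 := by
    refine le_trans ?_ (lintegral_mono_set hsub)
    refine setLIntegral_mono' measurableSet_Ioc fun h hh => ?_
    have hh0 : 0 < h := (hsub hh).1
    rw [ENNReal.ofReal_mul (by positivity), ← ofReal_norm, ← ENNReal.ofReal_pow (norm_nonneg _)]
    gcongr
    · have h1 : (|τ|⁻¹) ^ (-17 / 8 : ℝ) ≤ h ^ (-17 / 8 : ℝ) :=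
        Real.rpow_le_rpow_of_nonpos hh0 hh.2 (by norm_num)
      refine le_trans (le_of_eq ?_) h1
      rw [Real.inv_rpow hpos.le, ← Real.rpow_neg hpos.le]; norm_num
    · refine le_norm_exp_sub_one_sq ?_ ?_
      · rw [abs_mul, abs_of_pos hh0]
        have := hh.1.le
        rw [inv_le_iff_one_le_mul₀ (by positivity)] at this
        linarith
      · rw [abs_mul, abs_of_pos hh0]
        have := hh.2
        rwa [le_inv_comm₀ hh0 hpos, ← one_div, le_div_iff₀ hh0, mul_comm] at this
  calc ENNReal.ofReal (|τ| ^ (9 / 8 : ℝ))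
      = 32 * ∫⁻ _ in Ioc (2 * |τ|)⁻¹ |τ|⁻¹, ENNReal.ofReal (|τ| ^ (17 / 8 : ℝ) * (1 / 16)) := by
        rw [setLIntegral_const, Real.volume_Ioc, ← ENNReal.ofReal_mul (by positivity)]
        have : (32 : ℝ≥0∞) = ENNReal.ofReal 32 := by norm_num
        rw [this, ← ENNReal.ofReal_mul (by norm_num)]
        congr 1
        have e : |τ| ^ (17 / 8 : ℝ) = |τ| ^ (9 / 8 : ℝ) * |τ| := by
          nth_rewrite 3 [← Real.rpow_one |τ|]
          rw [← Real.rpow_add hpos]; norm_num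
        rw [e]; field_simp; norm_num
    _ ≤ _ := by gcongr

/-- Compactly supported Hölder functions of exponent `5/8` lie in `H^{9/16}`. -/
lemma hbSq_fwdF_le {F : ℝ → ℂ} (hF : Continuous F) {p L B : ℝ} (hL : 0 ≤ L) (hB : 0 ≤ B)
    (hsupp : ∀ t, t ∉ Icc p (p + L) → F t = 0) (hb : ∀ t, ‖F t‖ ≤ B)
    (hh : ∀ t t', ‖F t - F t'‖ ≤ 3 * B * |t - t'| ^ (5 / 8 : ℝ)) :
    hbSq (9 / 16) (fwdF F) ≤ (ENNReal.ofReal (4 * Real.pi * L)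
      + 64 * (ENNReal.ofReal (18 * Real.pi * (L + 1)) * ∫⁻ h in Ioc (0 : ℝ) 1,
        ENNReal.ofReal (h ^ (-7 / 8 : ℝ)))) * ENNReal.ofReal B ^ 2 := by
  have hcs : HasCompactSupport F := HasCompactSupport.intro isCompact_Icc hsupp
  have hint : ∀ h : ℝ, Integrable fun t => F (t - h) := fun h =>
    (hF.integrable_of_hasCompactSupport hcs).comp_sub_right h
  have hmem : ∀ h : ℝ, MemLp (fun t => F (t - h) - F t) 2 := fun h => by
    have h1 := hF.memLp_of_hasCompactSupport (μ := volume) (p := 2) hcs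
    exact (h1.comp_measurePreserving (measurePreserving_sub_right volume h)).sub h1
  have hint0 : Integrable F := hF.integrable_of_hasCompactSupport hcs
  have hFc : Continuous (fwdF F) := continuous_fwdF hint0
  have hdiff : ∀ h τ : ℝ, fwdF (fun t => F (t - h) - F t) τ
      = (Complex.exp (-(Complex.I * ((h * τ : ℝ) : ℂ))) - 1) * fwdF F τ := by
    intro h τ
    have hexp : ∀ f : ℝ → ℂ, Integrable f →
        Integrable fun t : ℝ => Complex.exp (-(Complex.I * (t : ℂ) * (τ : ℂ))) * f t := by
      intro f hf
      refine hf.bdd_mul (c := 1) (Continuous.aestronglyMeasurable (by fun_prop))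
        (Eventually.of_forall fun t => ?_)
      have e : -(Complex.I * (t : ℂ) * (τ : ℂ)) = ((-(t * τ) : ℝ) : ℂ) * Complex.I := by
        push_cast; ring
      rw [e, Complex.norm_exp_ofReal_mul_I]
    unfold fwdF
    simp_rw [mul_sub]
    rw [integral_sub (hexp _ (hint h)) (hexp _ hint0), sub_mul, one_mul, ← integral_const_mul]
    congr 1
    rw [← integral_add_right_eq_self _ h]
    congr 1; ext t
    have e : -(Complex.I * ((t + h : ℝ) : ℂ) * (τ : ℂ))
        = -(Complex.I * ((h * τ : ℝ) : ℂ)) + -(Complex.I * (t : ℂ) * (τ : ℂ)) := by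
      push_cast; ring
    rw [e, Complex.exp_add, add_sub_cancel_right, mul_assoc]
  -- By Plancherel, the squared L² modulus of a Hölder function with bounded support is of order
  -- h^{5/4}.
  have hD : ∀ h ∈ Ioc (0 : ℝ) 1,
      ∫⁻ τ, ‖Complex.exp (-(Complex.I * ((h * τ : ℝ) : ℂ))) - 1‖ₑ ^ 2 * ‖fwdF F τ‖ₑ ^ 2
        ≤ ENNReal.ofReal (18 * Real.pi * (L + 1)) * ENNReal.ofReal B ^ 2
          * ENNReal.ofReal (h ^ (5 / 4 : ℝ)) := by
    intro h hhh
    have e1 := lintegral_fwdF_sq ((hint h).sub hint0) (hmem h)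
    have e2 : ∫⁻ τ, ‖fwdF (fun t => F (t - h) - F t) τ‖ₑ ^ 2
        = ∫⁻ τ, ‖Complex.exp (-(Complex.I * ((h * τ : ℝ) : ℂ))) - 1‖ₑ ^ 2 * ‖fwdF F τ‖ₑ ^ 2 := by
      refine lintegral_congr fun τ => ?_
      rw [hdiff, enorm_mul, mul_pow]
    have e3 : ∫⁻ t, ‖F (t - h) - F t‖ₑ ^ 2
        ≤ ENNReal.ofReal ((3 * B * h ^ (5 / 8 : ℝ)) ^ 2) * ENNReal.ofReal (L + 1) := by
      calc ∫⁻ t, ‖F (t - h) - F t‖ₑ ^ 2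
          ≤ ∫⁻ t, (Icc p (p + L + 1)).indicator
              (fun _ => ENNReal.ofReal ((3 * B * h ^ (5 / 8 : ℝ)) ^ 2)) t := by
            refine lintegral_mono fun t => ?_
            by_cases ht : t ∈ Icc p (p + L + 1)
            · rw [indicator_of_mem ht, ← ofReal_norm, ← ENNReal.ofReal_pow (norm_nonneg _)]
              apply ENNReal.ofReal_le_ofReal
              have := hh (t - h) t
              rw [sub_sub_cancel_left, abs_neg, abs_of_pos hhh.1] at this
              gcongr
            · have h1 : F t = 0 := hsupp t fun h' => ht ⟨h'.1, by linarith [h'.2]⟩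
              have h2 : F (t - h) = 0 := hsupp _ fun h' =>
                ht ⟨by linarith [h'.1, hhh.1], by linarith [h'.2, hhh.2]⟩
              rw [h1, h2]; simp
        _ = _ := by
            rw [lintegral_indicator_const measurableSet_Icc, Real.volume_Icc]
            congr 2; ring
    rw [← e2]
    refine e1.le.trans ?_
    calc _ ≤ ENNReal.ofReal (2 * Real.pi) * (ENNReal.ofReal ((3 * B * h ^ (5 / 8 : ℝ)) ^ 2)
          * ENNReal.ofReal (L + 1)) := by gcongr; exact e3
      _ = _ := by
          have hh0 := hhh.1
          rw [← ENNReal.ofReal_pow hB, ← ENNReal.ofReal_mul (by positivity),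
            ← ENNReal.ofReal_mul (by positivity), ← ENNReal.ofReal_mul (by positivity),
            ← ENNReal.ofReal_mul (by positivity)]
          congr 1
          have e : (h ^ (5 / 8 : ℝ)) ^ 2 = h ^ (5 / 4 : ℝ) := by
            rw [← Real.rpow_natCast, ← Real.rpow_mul hh0.le]; norm_num
          rw [mul_pow, e]; ring
  have hP : ∫⁻ τ, ‖fwdF F τ‖ₑ ^ 2 ≤ ENNReal.ofReal (2 * Real.pi * L) * ENNReal.ofReal B ^ 2 := by
    rw [lintegral_fwdF_sq hint0 (hF.memLp_of_hasCompactSupport hcs)]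
    calc _ ≤ ENNReal.ofReal (2 * Real.pi) * (ENNReal.ofReal B ^ 2 * ENNReal.ofReal L) := by
          gcongr
          calc ∫⁻ t, ‖F t‖ₑ ^ 2
              ≤ ∫⁻ t, (Icc p (p + L)).indicator (fun _ => ENNReal.ofReal B ^ 2) t := by
                refine lintegral_mono fun t => ?_
                by_cases ht : t ∈ Icc p (p + L)
                · rw [indicator_of_mem ht, ← ofReal_norm]
                  gcongr
                  exact hb t
                · rw [hsupp t ht]; simp
            _ = _ := by
                rw [lintegral_indicator_const measurableSet_Icc, Real.volume_Icc,
                  add_sub_cancel_left]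
      _ = _ := by
          rw [ENNReal.ofReal_mul (by positivity : (0 : ℝ) ≤ 2 * Real.pi) (q := L)]; ring
  set J : ℝ → ℝ≥0∞ := fun τ => ∫⁻ h in Ioc (0 : ℝ) 1, ENNReal.ofReal (h ^ (-17 / 8 : ℝ)) *
        ‖Complex.exp (-(Complex.I * ((h * τ : ℝ) : ℂ))) - 1‖ₑ ^ 2 with hJ
  have hpt : ∀ τ, ENNReal.ofReal (bracket τ ^ (2 * (9 / 16) : ℝ)) * ‖fwdF F τ‖ₑ ^ 2
      ≤ 2 * ‖fwdF F τ‖ₑ ^ 2 + 64 * (J τ * ‖fwdF F τ‖ₑ ^ 2) := by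
    intro τ
    have key : ENNReal.ofReal (bracket τ ^ (2 * (9 / 16) : ℝ)) ≤ 2 + 64 * J τ := by
      have hbr : bracket τ ^ (2 * (9 / 16) : ℝ) = (bracket τ ^ 2) ^ (9 / 16 : ℝ) := by
        rw [← Real.rpow_natCast, ← Real.rpow_mul (zero_le_one.trans (one_le_bracket τ))]; norm_num
      have h2 : (2 : ℝ) ^ (9 / 16 : ℝ) ≤ 2 := by
        calc (2 : ℝ) ^ (9 / 16 : ℝ) ≤ 2 ^ (1 : ℝ) :=
              Real.rpow_le_rpow_of_exponent_le (by norm_num) (by norm_num)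
          _ = 2 := Real.rpow_one 2
      rw [hbr, bracket_sq]
      rcases le_total |τ| 1 with h | h
      · refine le_trans ?_ le_self_add
        rw [show (2 : ℝ≥0∞) = ENNReal.ofReal 2 by norm_num]
        apply ENNReal.ofReal_le_ofReal
        refine le_trans (Real.rpow_le_rpow (by positivity) ?_ (by norm_num)) h2
        rw [← sq_abs]; nlinarith [abs_nonneg τ]
      · refine le_trans ?_ le_add_self
        calc ENNReal.ofReal ((1 + τ ^ 2) ^ (9 / 16 : ℝ))
            ≤ ENNReal.ofReal (2 * |τ| ^ (9 / 8 : ℝ)) := by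
              apply ENNReal.ofReal_le_ofReal
              calc (1 + τ ^ 2) ^ (9 / 16 : ℝ) ≤ (2 * |τ| ^ 2) ^ (9 / 16 : ℝ) := by
                    refine Real.rpow_le_rpow (by positivity) ?_ (by norm_num)
                    rw [← sq_abs]; nlinarith
                _ = 2 ^ (9 / 16 : ℝ) * |τ| ^ (9 / 8 : ℝ) := by
                    rw [Real.mul_rpow (by norm_num) (by positivity), ← Real.rpow_natCast,
                      ← Real.rpow_mul (abs_nonneg τ)]
                    norm_num
                _ ≤ _ := by gcongr
          _ = 2 * ENNReal.ofReal (|τ| ^ (9 / 8 : ℝ)) := by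
              rw [ENNReal.ofReal_mul (by norm_num)]; norm_num
          _ ≤ 2 * (32 * J τ) := by gcongr; exact enorm_sub_one_lower h
          _ = _ := by ring
    calc _ ≤ (2 + 64 * J τ) * ‖fwdF F τ‖ₑ ^ 2 := by gcongr
      _ = _ := by ring
  have hmeas : Measurable fun q : ℝ × ℝ => ENNReal.ofReal (q.2 ^ (-17 / 8 : ℝ)) *
        ‖Complex.exp (-(Complex.I * ((q.2 * q.1 : ℝ) : ℂ))) - 1‖ₑ ^ 2 * ‖fwdF F q.1‖ₑ ^ 2 := by
    have h1 : Measurable fun q : ℝ × ℝ => ENNReal.ofReal (q.2 ^ (-17 / 8 : ℝ)) :=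
      (measurable_snd.pow_const _).ennreal_ofReal
    have h2 : Measurable fun q : ℝ × ℝ =>
        ‖Complex.exp (-(Complex.I * ((q.2 * q.1 : ℝ) : ℂ))) - 1‖ₑ ^ 2 :=
      (Continuous.measurable (by fun_prop)).enorm.pow_const 2
    have h3 : Measurable fun q : ℝ × ℝ => ‖fwdF F q.1‖ₑ ^ 2 :=
      ((hFc.comp continuous_fst).measurable).enorm.pow_const 2
    exact (h1.mul h2).mul h3
  -- After Tonelli the integrand in h is h^{-17/8 + 5/4} = h^{-7/8}, integrable at 0; this is the
  -- room between 9/16 and 5/8.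
  have hJint : ∫⁻ τ, J τ * ‖fwdF F τ‖ₑ ^ 2 ≤ ENNReal.ofReal (18 * Real.pi * (L + 1)) *
      ENNReal.ofReal B ^ 2 * ∫⁻ h in Ioc (0 : ℝ) 1, ENNReal.ofReal (h ^ (-7 / 8 : ℝ)) := by
    calc ∫⁻ τ, J τ * ‖fwdF F τ‖ₑ ^ 2
        = ∫⁻ τ, ∫⁻ h in Ioc (0 : ℝ) 1, ENNReal.ofReal (h ^ (-17 / 8 : ℝ)) *
          ‖Complex.exp (-(Complex.I * ((h * τ : ℝ) : ℂ))) - 1‖ₑ ^ 2 * ‖fwdF F τ‖ₑ ^ 2 := by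
          refine lintegral_congr fun τ => ?_
          rw [hJ, lintegral_mul_const' _ _ (by simp)]
      _ = ∫⁻ h in Ioc (0 : ℝ) 1, ∫⁻ τ, ENNReal.ofReal (h ^ (-17 / 8 : ℝ)) *
          ‖Complex.exp (-(Complex.I * ((h * τ : ℝ) : ℂ))) - 1‖ₑ ^ 2 * ‖fwdF F τ‖ₑ ^ 2 :=
          lintegral_lintegral_swap (f := fun τ h => ENNReal.ofReal (h ^ (-17 / 8 : ℝ)) *
            ‖Complex.exp (-(Complex.I * ((h * τ : ℝ) : ℂ))) - 1‖ₑ ^ 2 * ‖fwdF F τ‖ₑ ^ 2)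
            hmeas.aemeasurable
      _ ≤ ∫⁻ h in Ioc (0 : ℝ) 1, ENNReal.ofReal (18 * Real.pi * (L + 1)) * ENNReal.ofReal B ^ 2
            * ENNReal.ofReal (h ^ (-7 / 8 : ℝ)) := by
          refine setLIntegral_mono' measurableSet_Ioc fun h hhh => ?_
          simp_rw [mul_assoc (ENNReal.ofReal (h ^ (-17 / 8 : ℝ)))]
          rw [lintegral_const_mul' _ _ ENNReal.ofReal_ne_top]
          calc _ ≤ ENNReal.ofReal (h ^ (-17 / 8 : ℝ)) * (ENNReal.ofReal (18 * Real.pi * (L + 1))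
                * ENNReal.ofReal B ^ 2 * ENNReal.ofReal (h ^ (5 / 4 : ℝ))) := by
                gcongr; exact hD h hhh
            _ = ENNReal.ofReal (18 * Real.pi * (L + 1)) * ENNReal.ofReal B ^ 2 *
                (ENNReal.ofReal (h ^ (-17 / 8 : ℝ)) * ENNReal.ofReal (h ^ (5 / 4 : ℝ))) := by ring
            _ = _ := by
                rw [← ENNReal.ofReal_mul (Real.rpow_nonneg hhh.1.le _), ← Real.rpow_add hhh.1]
                norm_num
      _ = _ := by
          rw [lintegral_const_mul' _ _ (ENNReal.mul_ne_top ENNReal.ofReal_ne_top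
            (ENNReal.pow_ne_top ENNReal.ofReal_ne_top))]
  have m1 : Measurable fun τ => 2 * ‖fwdF F τ‖ₑ ^ 2 :=
    (hFc.measurable.enorm.pow_const 2).const_mul 2
  calc hbSq (9 / 16) (fwdF F)
      ≤ ∫⁻ τ, (2 * ‖fwdF F τ‖ₑ ^ 2 + 64 * (J τ * ‖fwdF F τ‖ₑ ^ 2)) := lintegral_mono hpt
    _ = 2 * (∫⁻ τ, ‖fwdF F τ‖ₑ ^ 2) + 64 * ∫⁻ τ, J τ * ‖fwdF F τ‖ₑ ^ 2 := by
        rw [lintegral_add_left m1, lintegral_const_mul' 2 (fun τ => ‖fwdF F τ‖ₑ ^ 2) (by norm_num),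
          lintegral_const_mul' 64 (fun τ => J τ * ‖fwdF F τ‖ₑ ^ 2) (by norm_num)]
    _ ≤ 2 * (ENNReal.ofReal (2 * Real.pi * L) * ENNReal.ofReal B ^ 2)
        + 64 * (ENNReal.ofReal (18 * Real.pi * (L + 1)) *
      ENNReal.ofReal B ^ 2 * ∫⁻ h in Ioc (0 : ℝ) 1, ENNReal.ofReal (h ^ (-7 / 8 : ℝ))) :=
        add_le_add (mul_le_mul' le_rfl hP) (mul_le_mul' le_rfl hJint)
    _ = _ := by
        have : ENNReal.ofReal (4 * Real.pi * L) = 2 * ENNReal.ofReal (2 * Real.pi * L) := by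
          rw [show 4 * Real.pi * L = 2 * (2 * Real.pi * L) by ring,
            ENNReal.ofReal_mul (by norm_num)]; norm_num
        rw [this]; ring

/-- Hölder functions of exponent `5/8` on an interval extend to functions in `H^{9/16}`. -/
theorem exists_invF_of_holder {a b : ℝ} (hab : a ≤ b) :
    ∃ C : ℝ≥0∞, C ≠ ∞ ∧ ∀ (f : ℝ → ℂ) (B : ℝ), 0 ≤ B → (∀ t ∈ Icc a b, ‖f t‖ ≤ B) →
      (∀ t ∈ Icc a b, ∀ t' ∈ Icc a b, ‖f t - f t'‖ ≤ B * |t - t'| ^ (5 / 8 : ℝ)) →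
      ∃ G : ℝ → ℂ, Measurable G ∧ hbSq (9 / 16) G ≤ C * ENNReal.ofReal B ^ 2 ∧
        ∀ t ∈ Icc a b, f t = invF G t := by
  have hfin : ∫⁻ h in Ioc (0 : ℝ) 1, ENNReal.ofReal (h ^ (-7 / 8 : ℝ)) ≠ ∞ := by
    have := (intervalIntegral.intervalIntegrable_rpow' (a := 0) (b := 1) (r := -7 / 8)
      (by norm_num))
    rw [intervalIntegrable_iff_integrableOn_Ioc_of_le zero_le_one] at this
    exact this.lintegral_lt_top.ne
  refine ⟨ENNReal.ofReal (4 * Real.pi * (b - a + 2))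
      + 64 * (ENNReal.ofReal (18 * Real.pi * ((b - a + 2) + 1))
        * ∫⁻ h in Ioc (0 : ℝ) 1, ENNReal.ofReal (h ^ (-7 / 8 : ℝ))), ENNReal.add_ne_top.2 ⟨ENNReal.ofReal_ne_top, ENNReal.mul_ne_top (by norm_num)
    (ENNReal.mul_ne_top ENNReal.ofReal_ne_top hfin)⟩, fun f B hB hb hh => ?_⟩
  -- The extension: clamp t to the interval, which is 1-Lipschitz and keeps the Hölder bound, then
  -- multiply by a cutoff equal to 1 on the interval and vanishing at distance 1 from it.
  set cl : ℝ → ℝ := fun t => max a (min b t) with hcl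
  have hclm : ∀ t, cl t ∈ Icc a b := fun t => ⟨le_max_left _ _, max_le hab (min_le_left _ _)⟩
  have hcl_id : ∀ t ∈ Icc a b, cl t = t := fun t ht => by
    simp only [hcl]; rw [min_eq_right ht.2, max_eq_right ht.1]
  have hcl_lip : ∀ t t', |cl t - cl t'| ≤ |t - t'| := by
    intro t t'
    refine (abs_max_sub_max_le_max a (min b t) a (min b t')).trans ?_
    rw [sub_self, abs_zero]
    refine max_le (abs_nonneg _) ((abs_min_sub_min_le_max b t b t').trans ?_)
    rw [sub_self, abs_zero]
    exact max_le (abs_nonneg _) le_rfl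
  set χ : ℝ → ℝ := fun t => max 0 (1 - |t - cl t|) with hχ
  have hχ0 : ∀ t, 0 ≤ χ t := fun t => le_max_left _ _
  have hχ1 : ∀ t, χ t ≤ 1 := fun t => max_le zero_le_one (by linarith [abs_nonneg (t - cl t)])
  have hχ_lip : ∀ t t', |χ t - χ t'| ≤ 2 * |t - t'| := by
    intro t t'
    refine (abs_max_sub_max_le_max _ _ _ _).trans ?_
    rw [sub_self, abs_zero]
    refine max_le (by positivity) ?_
    rw [sub_sub_sub_cancel_left]
    refine (abs_abs_sub_abs_le_abs_sub _ _).trans ?_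
    rw [show t' - cl t' - (t - cl t) = (t' - t) + (cl t - cl t') by ring]
    refine (abs_add_le _ _).trans ?_
    rw [abs_sub_comm t' t]
    linarith [hcl_lip t t']
  have hχ_hol : ∀ t t', |χ t - χ t'| ≤ 2 * |t - t'| ^ (5 / 8 : ℝ) := by
    intro t t'
    rcases le_total |t - t'| 1 with h | h
    · refine (hχ_lip t t').trans ?_
      have := gain_of_le_one (abs_nonneg (t - t')) h
      have h2 : |t - t'| ≤ gain |t - t'| := le_max_right _ _
      linarith
    · have h1 : |χ t - χ t'| ≤ 1 := by
        rw [abs_le]; constructor <;> linarith [hχ0 t, hχ0 t', hχ1 t, hχ1 t']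
      have h2 : 1 ≤ |t - t'| ^ (5 / 8 : ℝ) := Real.one_le_rpow h (by norm_num)
      linarith
  set F : ℝ → ℂ := fun t => (χ t : ℂ) * f (cl t) with hFdef
  have hFb : ∀ t, ‖F t‖ ≤ B := by
    intro t
    rw [hFdef, norm_mul, Complex.norm_real, Real.norm_of_nonneg (hχ0 t)]
    exact (mul_le_of_le_one_left (norm_nonneg _) (hχ1 t)).trans (hb _ (hclm t))
  have hFh : ∀ t t', ‖F t - F t'‖ ≤ 3 * B * |t - t'| ^ (5 / 8 : ℝ) := by
    intro t t'
    have e : F t - F t' = (χ t : ℂ) * (f (cl t) - f (cl t'))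
        + ((χ t - χ t' : ℝ) : ℂ) * f (cl t') := by
      simp only [hFdef]; push_cast; ring
    rw [e]
    refine (norm_add_le _ _).trans ?_
    rw [norm_mul, norm_mul, Complex.norm_real, Complex.norm_real, Real.norm_of_nonneg (hχ0 t),
      Real.norm_eq_abs]
    have h1 : ‖f (cl t) - f (cl t')‖ ≤ B * |t - t'| ^ (5 / 8 : ℝ) := by
      refine (hh _ (hclm t) _ (hclm t')).trans ?_
      exact mul_le_mul_of_nonneg_left
        (Real.rpow_le_rpow (abs_nonneg _) (hcl_lip t t') (by norm_num)) hB
    calc _ ≤ 1 * (B * |t - t'| ^ (5 / 8 : ℝ)) + 2 * |t - t'| ^ (5 / 8 : ℝ) * B := by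
          gcongr
          · exact hχ1 t
          · exact hχ_hol t t'
          · exact hb _ (hclm t')
      _ = _ := by ring
  have hFc : Continuous F := by
    rw [continuous_iff_continuousAt]
    intro t
    rw [ContinuousAt, tendsto_iff_norm_sub_tendsto_zero]
    have hlim : Tendsto (fun x => 3 * B * |x - t| ^ (5 / 8 : ℝ)) (𝓝 t) (𝓝 0) := by
      have : Continuous fun x : ℝ => 3 * B * |x - t| ^ (5 / 8 : ℝ) :=
        continuous_const.mul ((continuous_abs.comp (continuous_id.sub continuous_const)).rpow_const
          fun _ => Or.inr (by norm_num))
      have h0 := this.tendsto t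
      simp only [sub_self, abs_zero] at h0
      rwa [Real.zero_rpow (by norm_num), mul_zero] at h0
    exact squeeze_zero (fun _ => norm_nonneg _) (fun x => hFh x t) hlim
  have hsupp : ∀ t, t ∉ Icc (a - 1) (a - 1 + (b - a + 2)) → F t = 0 := by
    intro t ht
    have h0 : χ t = 0 := by
      refine max_eq_left ?_
      by_contra hlt
      have h1 : |t - cl t| < 1 := by linarith
      rw [abs_lt] at h1
      exact ht ⟨by linarith [(hclm t).1], by linarith [(hclm t).2]⟩
    rw [hFdef]; simp [h0]
  have hle := hbSq_fwdF_le hFc (by linarith : 0 ≤ b - a + 2) hB hsupp hFb hFh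
  have hcs : HasCompactSupport F := HasCompactSupport.intro isCompact_Icc hsupp
  have hint0 : Integrable F := hFc.integrable_of_hasCompactSupport hcs
  have hmeas := (continuous_fwdF hint0).measurable
  have hG : Integrable (fwdF F) := by
    refine integrable_of_hbSq (b := 9 / 16) (by norm_num) hmeas (ne_top_of_le_ne_top ?_ hle)
    exact ENNReal.mul_ne_top (ENNReal.add_ne_top.2 ⟨ENNReal.ofReal_ne_top, ENNReal.mul_ne_top
      (by norm_num) (ENNReal.mul_ne_top ENNReal.ofReal_ne_top hfin)⟩)
      (ENNReal.pow_ne_top ENNReal.ofReal_ne_top)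
  refine ⟨fwdF F, hmeas, hle, fun t ht => ?_⟩
  rw [invF_fwdF hFc hint0 hG]
  simp [hFdef, hχ, hcl_id t ht]

/-! ### Trigonometric truncation on the torus -/

open scoped ComplexConjugate

lemma enorm_sq_eq_tsum (f : L2) : ∫⁻ x, ‖f x‖ₑ ^ 2 ∂torusMeasure = ∑' n, ‖coeff f n‖ₑ ^ 2 := by
  have h := hasSum_sq_fourierCoeff f
  have h1 : ∑' n, ‖coeff f n‖ₑ ^ 2 = ENNReal.ofReal (∫ x, ‖f x‖ ^ 2 ∂torusMeasure) := by
    rw [← h.tsum_eq, ENNReal.ofReal_tsum_of_nonneg (fun n => by positivity) h.summable]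
    refine tsum_congr fun n => ?_
    rw [ENNReal.ofReal_pow (norm_nonneg _), ofReal_norm, coeff]
  rw [h1, ofReal_integral_eq_lintegral_ofReal
    ((memLp_two_iff_integrable_sq_norm (Lp.aestronglyMeasurable f)).1 (Lp.memLp f))
    (Eventually.of_forall fun x => by positivity)]
  refine lintegral_congr fun x => ?_
  rw [ENNReal.ofReal_pow (norm_nonneg _), ofReal_norm]

lemma enorm_eq_l2 (f : L2) : ‖f‖ₑ = l2 (mag (coeff f)) := by
  have h : ‖f‖ₑ ^ 2 = l2 (mag (coeff f)) ^ 2 := by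
    rw [l2_sq, Lp.enorm_def, eLpNorm_two_sq, enorm_sq_eq_tsum]; rfl
  exact le_antisymm (le_of_sq_le h.le) (le_of_sq_le h.ge)

lemma hsNorm_eq (s : ℝ) (f : L2) : hsNorm s f = wl2 s (mag (coeff f)) := by
  unfold hsNorm wl2 l2
  congr 1
  refine tsum_congr fun n => ?_
  have hb : 0 ≤ bracket (n : ℝ) := zero_le_one.trans (one_le_bracket _)
  rw [mul_pow, wt, mag, ← ENNReal.ofReal_pow (Real.rpow_nonneg hb _), ← Real.rpow_natCast,
    ← Real.rpow_mul hb, mul_comm s]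
  norm_num

lemma coeff_eq_repr (f : L2) (n : ℤ) : coeff f n = fourierBasis.repr f n :=
  (fourierBasis_repr f n).symm

lemma coeff_sub (f g : L2) (n : ℤ) : coeff (f - g) n = coeff f n - coeff g n := by
  simp [coeff_eq_repr, map_sub]

lemma coeff_injective {f g : L2} (h : ∀ n, coeff f n = coeff g n) : f = g := by
  apply fourierBasis.repr.injective
  ext n
  rw [← coeff_eq_repr, ← coeff_eq_repr, h]

lemma exists_coeff_eq {a : ℤ → ℂ} (h : l2 (mag a) ≠ ∞) : ∃ f : L2, ∀ n, coeff f n = a n := by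
  have hm : Memℓp a 2 := by
    refine memℓp_gen ?_
    simpa using summable_of_tsum_sq h
  refine ⟨fourierBasis.repr.symm ⟨a, hm⟩, fun n => ?_⟩
  rw [coeff_eq_repr, LinearIsometryEquiv.apply_symm_apply]

lemma integral_fourier (k : ℤ) : ∫ x, fourier k x ∂torusMeasure = if k = 0 then 1 else 0 := by
  have h := congr_fun (fourierCoeff_fourier (T := 2 * Real.pi) k) 0
  rw [fourierCoeff] at h
  simp only [neg_zero, fourier_zero, one_smul] at h
  rw [h, Pi.single_apply]
  simp only [eq_comm]

/-- The frequencies of absolute value at most `N`. -/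
def window (N : ℕ) : Finset ℤ := Finset.Icc (-(N : ℤ)) N

/-- The trigonometric polynomial of degree `N` with coefficients `a`. -/
def poly (N : ℕ) (a : ℤ → ℂ) (x : Torus) : ℂ := ∑ n ∈ window N, a n * fourier n x

lemma continuous_poly (N : ℕ) (a : ℤ → ℂ) : Continuous (poly N a) := by
  unfold poly; fun_prop

/-- The cubic interactions of frequency `n` among frequencies of absolute value at most `N`. -/
def box (N : ℕ) (n : ℤ) : Finset (ℤ × ℤ) :=
  (Finset.Icc (-(N : ℤ) - n) (N - n) ×ˢ Finset.Icc (-(N : ℤ) - n) (N - n)).filter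
    fun p => n + p.1 + p.2 ∈ window N

/-- The boxes exhaust ℤ × ℤ, so sums over them converge to the sum of any summable family. -/
lemma tendsto_box (n : ℤ) : Tendsto (fun N => box N n) atTop atTop := by
  refine tendsto_atTop_finset_of_monotone (fun N M h p hp => ?_)
    fun p => ⟨(|n + p.1| + |n + p.2| + |n + p.1 + p.2|).toNat, ?_⟩
  · simp only [box, window, Finset.mem_filter, Finset.mem_product, Finset.mem_Icc] at hp ⊢
    omega
  · simp only [box, window, Finset.mem_filter, Finset.mem_product, Finset.mem_Icc]
    have h1 := abs_nonneg (n + p.1)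
    have h2 := abs_nonneg (n + p.2)
    have h3 := abs_nonneg (n + p.1 + p.2)
    have h4 := neg_abs_le (n + p.1)
    have h5 := neg_abs_le (n + p.2)
    have h6 := neg_abs_le (n + p.1 + p.2)
    have h7 := le_abs_self (n + p.1)
    have h8 := le_abs_self (n + p.2)
    have h9 := le_abs_self (n + p.1 + p.2)
    omega

/-- One cubic product of coefficients. -/
def cubTerm (a : ℤ → ℂ) (n : ℤ) (p : ℤ × ℤ) : ℂ := a (n + p.1) * conj (a (n + p.1 + p.2)) * a (n + p.2)

lemma sum_box (N : ℕ) (a : ℤ → ℂ) (n : ℤ) :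
    ∑ i ∈ window N, ∑ m ∈ window N, ∑ j ∈ window N, a i * a m * conj (a j)
      * (if j = i + m - n then 1 else 0) = ∑ p ∈ box N n, cubTerm a n p := by
  simp only [mul_ite, mul_one, mul_zero, Finset.sum_ite_eq']
  rw [← Finset.sum_product', ← Finset.sum_filter]
  refine Finset.sum_nbij' (fun q => (q.1 - n, q.2 - n)) (fun p => (n + p.1, n + p.2)) ?_ ?_ ?_ ?_ ?_
  · intro q hq
    simp only [box, window, Finset.mem_filter, Finset.mem_product, Finset.mem_Icc] at hq ⊢
    omega
  · intro q hq
    simp only [box, window, Finset.mem_filter, Finset.mem_product, Finset.mem_Icc] at hq ⊢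
    omega
  · intro q _; simp
  · intro q _; simp
  · intro q _
    have e1 : n + (q.1 - n) = q.1 := by ring
    have e2 : n + (q.2 - n) = q.2 := by ring
    have e3 : q.1 + (q.2 - n) = q.1 + q.2 - n := by ring
    simp only [cubTerm, e1, e2, e3]; ring

lemma norm_sq_mul_self (z : ℂ) : ((‖z‖ ^ 2 : ℝ) : ℂ) * z = z * z * conj z := by
  have := Complex.mul_conj z
  rw [Complex.normSq_eq_norm_sq] at this
  rw [← this]; ring

lemma fourierCoeff_cubic_poly (N : ℕ) (a : ℤ → ℂ) (n : ℤ) :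
    fourierCoeff (fun x : Torus => ((‖poly N a x‖ ^ 2 : ℝ) : ℂ) * poly N a x) n
      = ∑ p ∈ box N n, cubTerm a n p := by
  rw [← sum_box, fourierCoeff]
  have e : ∀ x : Torus, fourier (-n) x • (((‖poly N a x‖ ^ 2 : ℝ) : ℂ) * poly N a x)
      = ∑ i ∈ window N, ∑ m ∈ window N, ∑ j ∈ window N, a i * a m * conj (a j)
        * fourier (i + m - n - j) x := by
    intro x
    rw [norm_sq_mul_self, poly, map_sum, Finset.sum_mul_sum, smul_eq_mul, Finset.sum_mul,
      Finset.mul_sum]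
    refine Finset.sum_congr rfl fun i _ => ?_
    rw [Finset.sum_mul_sum, Finset.mul_sum]
    refine Finset.sum_congr rfl fun m _ => ?_
    rw [Finset.mul_sum]
    refine Finset.sum_congr rfl fun j _ => ?_
    rw [show i + m - n - j = i + m + (-n) + (-j) by ring, fourier_add, fourier_add, fourier_add,
      map_mul, ← fourier_neg]
    ring
  simp_rw [e]
  have hint : ∀ (c : ℂ) (k : ℤ), Integrable (fun x : Torus => c * fourier k x) torusMeasure :=
    fun c k => (Continuous.integrable_of_hasCompactSupport (by fun_prop)
      (HasCompactSupport.of_compactSpace _))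
  rw [integral_finsetSum _ fun i _ => integrable_finsetSum _ fun m _ =>
    integrable_finsetSum _ fun j _ => hint _ _]
  refine Finset.sum_congr rfl fun i _ => ?_
  rw [integral_finsetSum _ fun m _ => integrable_finsetSum _ fun j _ => hint _ _]
  refine Finset.sum_congr rfl fun m _ => ?_
  rw [integral_finsetSum _ fun j _ => hint _ _]
  refine Finset.sum_congr rfl fun j _ => ?_
  rw [integral_const_mul, integral_fourier]
  congr 2
  simp only [eq_iff_iff]; omega

/-- Writes the L⁴ norm of a truncation as a finite sum of quartic interactions, to which the
oscillatory bounds apply after integration in time. -/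
lemma integral_quartic_poly (N : ℕ) (a : ℤ → ℂ) :
    ((∫ x, ‖poly N a x‖ ^ 4 ∂torusMeasure : ℝ) : ℂ)
      = ∑ n ∈ window N, ∑ p ∈ box N n, cubTerm a n p * conj (a n) := by
  have e : ∀ x : Torus, ((‖poly N a x‖ ^ 4 : ℝ) : ℂ)
      = ∑ n ∈ window N, conj (a n) *
        (fourier (-n) x • (((‖poly N a x‖ ^ 2 : ℝ) : ℂ) * poly N a x)) := by
    intro x
    have h1 : ((‖poly N a x‖ ^ 4 : ℝ) : ℂ)
        = conj (poly N a x) * (((‖poly N a x‖ ^ 2 : ℝ) : ℂ) * poly N a x) := by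
      have := Complex.mul_conj (poly N a x)
      rw [Complex.normSq_eq_norm_sq] at this
      rw [mul_left_comm, mul_comm (conj _), this]; push_cast; ring
    rw [h1]
    nth_rewrite 1 [poly]
    rw [map_sum, Finset.sum_mul]
    refine Finset.sum_congr rfl fun n _ => ?_
    rw [map_mul, ← fourier_neg, smul_eq_mul]; ring
  rw [← integral_complex_ofReal]
  simp_rw [e]
  rw [integral_finsetSum]
  · refine Finset.sum_congr rfl fun n _ => ?_
    rw [integral_const_mul]
    have := fourierCoeff_cubic_poly N a n
    rw [fourierCoeff] at this
    rw [this, Finset.mul_sum]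
    exact Finset.sum_congr rfl fun p _ => mul_comm _ _
  · intro n _
    have := continuous_poly N a
    exact (Continuous.integrable_of_hasCompactSupport (by fun_prop)
      (HasCompactSupport.of_compactSpace _))

/-- The tail of an `ℓ²` sequence. -/
def tail (N : ℕ) (a : ℤ → ℝ≥0∞) : ℝ≥0∞ := l2 fun n => if n ∈ window N then 0 else a n

lemma tail_mono {N : ℕ} {a b : ℤ → ℝ≥0∞} (h : ∀ n, a n ≤ b n) : tail N a ≤ tail N b :=
  l2_mono fun n => by split_ifs; exacts [le_rfl, h n]

lemma tendsto_tail {a : ℤ → ℝ≥0∞} (h : l2 a ≠ ∞) : Tendsto (fun N => tail N a) atTop (𝓝 0) := by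
  have hW : Tendsto window atTop atTop := by
    refine tendsto_atTop_finset_of_monotone (fun N M h p hp => ?_) fun n => ⟨n.natAbs, ?_⟩
    · simp only [window, Finset.mem_Icc] at hp ⊢; omega
    · simp only [window, Finset.mem_Icc]; omega
  have h2 : ∑' n, a n ^ 2 ≠ ∞ := by rw [← l2_sq]; exact ENNReal.pow_ne_top h
  have h3 := (ENNReal.tendsto_tsum_compl_atTop_zero h2).comp hW
  have h4 : ∀ N, tail N a = (∑' n : {n // n ∉ window N}, a n ^ 2) ^ (1 / 2 : ℝ) := by
    intro N
    rw [tail, l2]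
    congr 1
    rw [← tsum_subtype_eq_of_support_subset (s := {n | n ∉ window N})]
    · refine tsum_congr fun n => ?_
      rw [if_neg n.2]
    · intro n hn hn'
      simp [hn'] at hn
  simp_rw [h4]
  have := (ENNReal.continuous_rpow_const (y := 1 / 2)).tendsto 0 |>.comp h3
  simpa [Function.comp_def] using this

lemma lintegral_sub_poly (f : L2) (N : ℕ) :
    ∫⁻ x, ‖poly N (coeff f) x - f x‖ₑ ^ 2 ∂torusMeasure = tail N (mag (coeff f)) ^ 2 := by
  set q : L2 := ∑ n ∈ window N, coeff f n • fourierLp 2 n with hq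
  have hae : (q : Torus → ℂ) =ᵐ[torusMeasure] poly N (coeff f) := by
    rw [hq]
    refine (Lp.coeFn_finsetSum _ _).trans ?_
    have : ∀ᵐ x ∂torusMeasure, ∀ n : ℤ, ((coeff f n • fourierLp 2 n : L2) : Torus → ℂ) x
        = coeff f n * fourier n x := by
      rw [ae_all_iff]
      intro n
      filter_upwards [Lp.coeFn_smul (coeff f n) (fourierLp 2 n : L2), coeFn_fourierLp 2 n]
        with x h1 h2
      rw [h1, Pi.smul_apply, h2, smul_eq_mul]
    filter_upwards [this] with x hx
    rw [Finset.sum_apply, poly]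
    exact Finset.sum_congr rfl fun n _ => hx n
  have hc : ∀ m, coeff q m = if m ∈ window N then coeff f m else 0 := by
    intro m
    rw [coeff_eq_repr, hq, map_sum, ← Finset.sum_ite_eq (window N) m fun m => coeff f m]
    simp only [lp.coeFn_sum, Finset.sum_apply]
    refine Finset.sum_congr rfl fun n _ => ?_
    rw [← coe_fourierBasis, map_smul, HilbertBasis.repr_self]
    simp [lp.single_apply, Pi.single_apply]
  rw [tail, l2_sq]
  calc ∫⁻ x, ‖poly N (coeff f) x - f x‖ₑ ^ 2 ∂torusMeasure
      = ∫⁻ x, ‖(q - f : L2) x‖ₑ ^ 2 ∂torusMeasure := by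
        refine lintegral_congr_ae ?_
        filter_upwards [hae, Lp.coeFn_sub q f] with x h1 h2
        rw [h2, Pi.sub_apply, h1]
    _ = _ := by
        rw [enorm_sq_eq_tsum]
        refine tsum_congr fun n => ?_
        rw [coeff_sub, hc]
        split_ifs <;> simp [mag]

lemma norm_cubic_sub_le (z w : ℂ) :
    ‖((‖z‖ ^ 2 : ℝ) : ℂ) * z - ((‖w‖ ^ 2 : ℝ) : ℂ) * w‖ ≤ 2 * (‖z‖ ^ 2 + ‖w‖ ^ 2) * ‖z - w‖ := by
  have e : ((‖z‖ ^ 2 : ℝ) : ℂ) * z - ((‖w‖ ^ 2 : ℝ) : ℂ) * w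
      = ((‖z‖ ^ 2 : ℝ) : ℂ) * (z - w) + (((‖z‖ - ‖w‖) * (‖z‖ + ‖w‖) : ℝ) : ℂ) * w := by
    push_cast; ring
  rw [e]
  refine (norm_add_le _ _).trans ?_
  rw [norm_mul, norm_mul, Complex.norm_real, Complex.norm_real, Real.norm_of_nonneg (by positivity),
    norm_mul, Real.norm_of_nonneg (by positivity : 0 ≤ ‖z‖ + ‖w‖), Real.norm_eq_abs]
  have h1 := abs_norm_sub_norm_le z w
  have h2 := norm_nonneg z
  have h3 := norm_nonneg w
  have h4 := norm_nonneg (z - w)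
  calc _ ≤ ‖z‖ ^ 2 * ‖z - w‖ + ‖z - w‖ * (‖z‖ + ‖w‖) * ‖w‖ := by gcongr
    _ = (‖z‖ ^ 2 + ‖z‖ * ‖w‖ + ‖w‖ ^ 2) * ‖z - w‖ := by ring
    _ ≤ _ := by gcongr; nlinarith [sq_nonneg (‖z‖ - ‖w‖)]

lemma enorm_cube_le (z : ℂ) : ‖z‖ₑ ^ 3 ≤ 1 + ‖z‖ₑ ^ 4 := by
  rcases le_total ‖z‖ₑ 1 with h | h
  · exact (pow_le_one' h 3).trans le_self_add
  · exact (pow_le_pow_right' h (by norm_num)).trans le_add_self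

lemma enorm_cubic (z : ℂ) : ‖((‖z‖ ^ 2 : ℝ) : ℂ) * z‖ₑ = ‖z‖ₑ ^ 3 := by
  rw [← ofReal_norm, norm_mul, Complex.norm_real, Real.norm_of_nonneg (by positivity), ← pow_succ,
    ENNReal.ofReal_pow (norm_nonneg _), ofReal_norm]

lemma aestronglyMeasurable_cubic {f : Torus → ℂ} (hf : AEStronglyMeasurable f torusMeasure) :
    AEStronglyMeasurable (fun x => ((‖f x‖ ^ 2 : ℝ) : ℂ) * f x) torusMeasure :=
  (Complex.continuous_ofReal.comp_aestronglyMeasurable (hf.norm.pow 2)).mul hf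

lemma lintegral_cube_le (f : Torus → ℂ) :
    ∫⁻ x, ‖f x‖ₑ ^ 3 ∂torusMeasure ≤ 1 + ∫⁻ x, ‖f x‖ₑ ^ 4 ∂torusMeasure := by
  calc _ ≤ ∫⁻ x, (1 + ‖f x‖ₑ ^ 4) ∂torusMeasure := lintegral_mono fun x => enorm_cube_le _
    _ = _ := by rw [lintegral_add_left measurable_const]; simp

lemma integrable_cubic {f : Torus → ℂ} (hf : AEStronglyMeasurable f torusMeasure)
    (h : ∫⁻ x, ‖f x‖ₑ ^ 4 ∂torusMeasure ≠ ∞) :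
    Integrable (fun x => ((‖f x‖ ^ 2 : ℝ) : ℂ) * f x) torusMeasure := by
  refine ⟨aestronglyMeasurable_cubic hf, ?_⟩
  rw [HasFiniteIntegral]
  simp_rw [enorm_cubic]
  exact (lintegral_cube_le f).trans_lt (ENNReal.add_lt_top.2 ⟨ENNReal.one_lt_top, h.lt_top⟩)

/-- Cauchy–Schwarz with |f|² + |g|² in one factor and f - g in the other: on L⁴-bounded sets the
coefficients of the cubic term are Lipschitz for the L² distance. -/
lemma enorm_sq_fourierCoeff_cubic_sub_le {f g : Torus → ℂ}
    (hf : AEStronglyMeasurable f torusMeasure) (hg : AEStronglyMeasurable g torusMeasure)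
    (hf4 : ∫⁻ x, ‖f x‖ₑ ^ 4 ∂torusMeasure ≠ ∞) (hg4 : ∫⁻ x, ‖g x‖ₑ ^ 4 ∂torusMeasure ≠ ∞) (n : ℤ) :
    ‖fourierCoeff (fun x => ((‖f x‖ ^ 2 : ℝ) : ℂ) * f x) n
        - fourierCoeff (fun x => ((‖g x‖ ^ 2 : ℝ) : ℂ) * g x) n‖ₑ ^ 2
      ≤ 8 * ((∫⁻ x, ‖f x‖ₑ ^ 4 ∂torusMeasure) + ∫⁻ x, ‖g x‖ₑ ^ 4 ∂torusMeasure)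
        * ∫⁻ x, ‖f x - g x‖ₑ ^ 2 ∂torusMeasure := by
  have hif := (integrable_cubic hf hf4).fourier_smul (-n)
  have hig := (integrable_cubic hg hg4).fourier_smul (-n)
  rw [fourierCoeff, fourierCoeff, ← integral_sub hif hig]
  have h1 : ‖∫ x, (fourier (-n) x • (((‖f x‖ ^ 2 : ℝ) : ℂ) * f x)
      - fourier (-n) x • (((‖g x‖ ^ 2 : ℝ) : ℂ) * g x)) ∂torusMeasure‖ₑ
      ≤ ∫⁻ x, (2 * (‖f x‖ₑ ^ 2 + ‖g x‖ₑ ^ 2)) * ‖f x - g x‖ₑ ∂torusMeasure := by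
    refine (enorm_integral_le_lintegral_enorm _).trans (lintegral_mono fun x => ?_)
    have hx : ‖fourier (-n) x‖ₑ = 1 := by
      rw [fourier_apply, ← ofReal_norm, Circle.norm_coe, ENNReal.ofReal_one]
    rw [← smul_sub, enorm_smul, hx, one_mul, ← ofReal_norm]
    refine (ENNReal.ofReal_le_ofReal (norm_cubic_sub_le _ _)).trans (le_of_eq ?_)
    rw [ENNReal.ofReal_mul (by positivity), ENNReal.ofReal_mul (by positivity),
      ENNReal.ofReal_add (by positivity) (by positivity), ENNReal.ofReal_pow (norm_nonneg _),
      ENNReal.ofReal_pow (norm_nonneg _), ofReal_norm, ofReal_norm, ofReal_norm]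
    norm_num
  have hfm := hf.enorm
  have hgm := hg.enorm
  have m4 : AEMeasurable (fun x => ‖f x‖ₑ ^ 4) torusMeasure := hfm.pow_const 4
  refine (pow_le_pow_left' h1 2).trans ((lintegral_mul_sq_le torusMeasure
    (((hfm.pow_const 2).add (hgm.pow_const 2)).const_mul 2) (hf.sub hg).enorm).trans ?_)
  refine mul_le_mul' ?_ le_rfl
  rw [← lintegral_add_left' m4, ← lintegral_const_mul' _ _ (by norm_num)]
  refine lintegral_mono fun x => ?_
  have h2 : ∀ y z : ℝ≥0∞, (y + z) ^ 2 ≤ 2 * (y ^ 2 + z ^ 2) := by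
    intro y z
    have := ENNReal.rpow_add_le_mul_rpow_add_rpow y z (p := 2) (by norm_num)
    norm_num at this
    exact this
  calc (2 * (‖f x‖ₑ ^ 2 + ‖g x‖ₑ ^ 2)) ^ 2 = 4 * (‖f x‖ₑ ^ 2 + ‖g x‖ₑ ^ 2) ^ 2 := by ring
    _ ≤ 4 * (2 * ((‖f x‖ₑ ^ 2) ^ 2 + (‖g x‖ₑ ^ 2) ^ 2)) := by gcongr; exact h2 _ _
    _ = _ := by ring

lemma lintegral_poly_four_ne_top (N : ℕ) (a : ℤ → ℂ) :
    ∫⁻ x, ‖poly N a x‖ₑ ^ 4 ∂torusMeasure ≠ ∞ := by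
  have h : Integrable (fun x => poly N a x ^ 4) torusMeasure :=
    (((continuous_poly N a).pow 4).integrable_of_hasCompactSupport
      (HasCompactSupport.of_compactSpace _))
  simpa only [HasFiniteIntegral, enorm_pow] using h.2.ne

lemma enorm_sq_cubicCoeff_sub_le (f : L2) (hf : ∫⁻ x, ‖f x‖ₑ ^ 4 ∂torusMeasure ≠ ∞) (N : ℕ) (n : ℤ) :
    ‖∑ p ∈ box N n, cubTerm (coeff f) n p - cubicCoeff f n‖ₑ ^ 2
      ≤ 8 * ((∫⁻ x, ‖poly N (coeff f) x‖ₑ ^ 4 ∂torusMeasure) + ∫⁻ x, ‖f x‖ₑ ^ 4 ∂torusMeasure)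
        * tail N (mag (coeff f)) ^ 2 := by
  rw [← fourierCoeff_cubic_poly, ← lintegral_sub_poly]
  exact enorm_sq_fourierCoeff_cubic_sub_le (continuous_poly N _).aestronglyMeasurable
    (Lp.aestronglyMeasurable f) (lintegral_poly_four_ne_top N _) hf n

lemma l2_mag_coeff_ne_top (f : L2) : l2 (mag (coeff f)) ≠ ∞ := by
  rw [← enorm_eq_l2]; exact enorm_ne_top

lemma tendstoInMeasure_poly (f : L2) :
    TendstoInMeasure torusMeasure (fun N => poly N (coeff f)) atTop f := by
  refine tendstoInMeasure_of_tendsto_eLpNorm (p := 2) (by norm_num)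
    (fun N => (continuous_poly N _).aestronglyMeasurable) (Lp.aestronglyMeasurable f) ?_
  have h : ∀ N, eLpNorm (poly N (coeff f) - (f : Torus → ℂ)) 2 torusMeasure = tail N (mag (coeff f)) := by
    intro N
    have h2 : eLpNorm (poly N (coeff f) - (f : Torus → ℂ)) 2 torusMeasure ^ 2 = tail N (mag (coeff f)) ^ 2 := by
      rw [eLpNorm_two_sq, ← lintegral_sub_poly]; rfl
    exact le_antisymm (le_of_sq_le h2.le) (le_of_sq_le h2.ge)
  simp_rw [h]
  exact tendsto_tail (l2_mag_coeff_ne_top f)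

/-- Fatou's lemma. Truncations converge to f in L², hence almost everywhere along a subsequence of
any subsequence chosen to approach the lower limit. -/
lemma lintegral_four_le_liminf (f : L2) : ∫⁻ x, ‖f x‖ₑ ^ 4 ∂torusMeasure
    ≤ liminf (fun N => ∫⁻ x, ‖poly N (coeff f) x‖ₑ ^ 4 ∂torusMeasure) atTop := by
  refine le_of_forall_gt fun B hB => ?_
  obtain ⟨B', hB1, hB2⟩ := exists_between hB
  obtain ⟨ψ, hψ, hle⟩ := extraction_of_frequently_atTop
    (frequently_lt_of_liminf_lt (by isBoundedDefault) hB1)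
  obtain ⟨φ, hφ, hae⟩ := ((tendstoInMeasure_poly f).comp hψ.tendsto_atTop).exists_seq_tendsto_ae
  refine lt_of_le_of_lt ?_ hB2
  calc ∫⁻ x, ‖f x‖ₑ ^ 4 ∂torusMeasure
      = ∫⁻ x, liminf (fun j => ‖poly (ψ (φ j)) (coeff f) x‖ₑ ^ 4) atTop ∂torusMeasure := by
        refine lintegral_congr_ae ?_
        filter_upwards [hae] with x hx
        exact (ENNReal.Tendsto.pow hx.enorm).liminf_eq.symm
    _ ≤ liminf (fun j => ∫⁻ x, ‖poly (ψ (φ j)) (coeff f) x‖ₑ ^ 4 ∂torusMeasure) atTop :=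
        lintegral_liminf_le fun j => (continuous_poly _ _).measurable.enorm.pow_const 4
    _ ≤ B' := by
        refine liminf_le_of_le (by isBoundedDefault) fun b hb => ?_
        obtain ⟨j, hj⟩ := hb.exists
        exact hj.trans (hle (φ j)).le

lemma ae_enorm_le_of_poly_le (f : L2) {S : ℝ≥0∞} (h : ∀ N x, ‖poly N (coeff f) x‖ₑ ≤ S) :
    ∀ᵐ x ∂torusMeasure, ‖f x‖ₑ ≤ S := by
  obtain ⟨φ, hφ, hae⟩ := (tendstoInMeasure_poly f).exists_seq_tendsto_ae
  filter_upwards [hae] with x hx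
  exact le_of_tendsto hx.enorm (Eventually.of_forall fun j => h _ _)

/-- Convergence in `L¹` to a function that is not known to be measurable. -/
lemma tendsto_lintegral_of_enorm_sub_le {α : Type*} [MeasurableSpace α] {μ : Measure α}
    {C : ℕ → α → ℂ} {c : α → ℂ} {E : ℕ → α → ℝ≥0∞} (hC : ∀ N, Integrable (C N) μ)
    (hE : ∀ N, AEMeasurable (E N) μ) (hle : ∀ N, ∀ᵐ t ∂μ, ‖C N t - c t‖ₑ ≤ E N t)
    (h0 : Tendsto (fun N => ∫⁻ t, E N t ∂μ) atTop (𝓝 0)) :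
    Integrable c μ ∧ Tendsto (fun N => ∫⁻ t, ‖C N t - c t‖ₑ ∂μ) atTop (𝓝 0) := by
  have hlim : Tendsto (fun N => ∫⁻ t, ‖C N t - c t‖ₑ ∂μ) atTop (𝓝 0) :=
    tendsto_of_tendsto_of_tendsto_of_le_of_le tendsto_const_nhds h0 (fun _ => zero_le)
      fun N => lintegral_mono_ae (hle N)
  -- Markov's inequality for the measurable majorants E gives convergence in measure, which
  -- transfers measurability to c.
  have hm : AEStronglyMeasurable c μ := by
    refine TendstoInMeasure.aestronglyMeasurable (u := atTop) (fun N => (hC N).1) ?_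
    refine tendstoInMeasure_of_ne_top fun ε hε hε' => ?_
    have h1 : Tendsto (fun N => (∫⁻ t, E N t ∂μ) / ε) atTop (𝓝 0) := by
      simpa using ENNReal.Tendsto.div_const h0 (Or.inr hε.ne')
    refine tendsto_of_tendsto_of_tendsto_of_le_of_le tendsto_const_nhds h1 (fun _ => zero_le)
      fun N => ?_
    refine le_trans (measure_mono_ae ?_) (meas_ge_le_lintegral_div (hE N) hε.ne' hε')
    filter_upwards [hle N] with t ht hεt
    have h2 : ε ≤ edist (C N t) (c t) := hεt
    rw [edist_eq_enorm_sub] at h2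
    exact h2.trans ht
  refine ⟨⟨hm, ?_⟩, hlim⟩
  obtain ⟨N, hN⟩ := (hlim.eventually_lt_const ENNReal.zero_lt_top).exists
  have := ((hC N).sub ⟨(hC N).1.sub hm, hN⟩).2
  simpa [HasFiniteIntegral] using this

/-! ### The space-time L⁴ bound and the Duhamel integral -/

/-- The Fourier coefficients of `u` in the interaction representation. -/
def inter (u : ℝ → L2) : Family :=
  fun n t => Complex.exp (Complex.I * (((n : ℝ) ^ 4 * t : ℝ) : ℂ)) * coeff (u t) n

lemma enorm_exp_I_mul (x : ℝ) : ‖Complex.exp (Complex.I * (x : ℂ))‖ₑ = 1 := by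
  rw [← ofReal_norm, mul_comm, Complex.norm_exp_ofReal_mul_I, ENNReal.ofReal_one]

lemma mag_inter (u : ℝ → L2) (t : ℝ) : mag (fun n => inter u n t) = mag (coeff (u t)) := by
  ext n
  rw [mag, mag, inter, enorm_mul, enorm_exp_I_mul, one_mul]

/-- The resonance phase is built so that the three factors of the interaction representation cancel
against it and leave e^{i n⁴ r}. -/
lemma exp_phase_mul_cub (u : ℝ → L2) (n : ℤ) (p : ℤ × ℤ) (r : ℝ) :
    Complex.exp (Complex.I * ((phase n p.1 p.2 * r : ℝ) : ℂ))
        * cub (inter u) (inter u) (inter u) n p r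
      = Complex.exp (Complex.I * (((n : ℝ) ^ 4 * r : ℝ) : ℂ)) * cubTerm (coeff (u r)) n p := by
  have e : Complex.exp (Complex.I * ((phase n p.1 p.2 * r : ℝ) : ℂ))
      * Complex.exp (Complex.I * ((((n + p.1 : ℤ) : ℝ) ^ 4 * r : ℝ) : ℂ))
      * Complex.exp (-(Complex.I * ((((n + p.1 + p.2 : ℤ) : ℝ) ^ 4 * r : ℝ) : ℂ)))
      * Complex.exp (Complex.I * ((((n + p.2 : ℤ) : ℝ) ^ 4 * r : ℝ) : ℂ))
      = Complex.exp (Complex.I * (((n : ℝ) ^ 4 * r : ℝ) : ℂ)) := by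
    rw [← Complex.exp_add, ← Complex.exp_add, ← Complex.exp_add]
    congr 1
    unfold phase
    push_cast
    ring
  rw [← e]
  simp only [cub, inter, cubTerm, map_mul, ← Complex.exp_conj, Complex.conj_I, Complex.conj_ofReal,
    neg_mul]
  ring

lemma cubTerm_mul_conj (u : ℝ → L2) (n : ℤ) (p : ℤ × ℤ) (r : ℝ) :
    Complex.exp (Complex.I * ((phase n p.1 p.2 * r : ℝ) : ℂ))
        * (cub (inter u) (inter u) (inter u) n p r * conj (inter u n r))
      = cubTerm (coeff (u r)) n p * conj (coeff (u r) n) := by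
  rw [← mul_assoc, exp_phase_mul_cub, inter, map_mul, ← Complex.exp_conj, map_mul, Complex.conj_I,
    Complex.conj_ofReal]
  have e : Complex.exp (Complex.I * (((n : ℝ) ^ 4 * r : ℝ) : ℂ))
      * Complex.exp (-Complex.I * (((n : ℝ) ^ 4 * r : ℝ) : ℂ)) = 1 := by
    rw [← Complex.exp_add]; simp
  calc _ = (Complex.exp (Complex.I * (((n : ℝ) ^ 4 * r : ℝ) : ℂ))
      * Complex.exp (-Complex.I * (((n : ℝ) ^ 4 * r : ℝ) : ℂ)))
        * (cubTerm (coeff (u r)) n p * conj (coeff (u r) n)) := by ring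
    _ = _ := by rw [e, one_mul]

lemma intervalIntegrable_sum {ι : Type*} (S : Finset ι) {f : ι → ℝ → ℂ} {s t : ℝ}
    (h : ∀ i, IntervalIntegrable (f i) volume s t) :
    IntervalIntegrable (fun r => ∑ i ∈ S, f i r) volume s t := by
  simpa only [← Finset.sum_apply] using IntervalIntegrable.sum S fun i _ => h i

lemma aemeasurable_liminf {μ : Measure ℝ} {f : ℕ → ℝ → ℝ≥0∞} (h : ∀ N, AEMeasurable (f N) μ) :
    AEMeasurable (fun t => liminf (fun N => f N t) atTop) μ := by
  refine ⟨fun t => liminf (fun N => (h N).mk (f N) t) atTop,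
    Measurable.liminf fun N => (h N).measurable_mk, ?_⟩
  filter_upwards [ae_all_iff.2 fun N => (h N).ae_eq_mk] with t ht
  simp_rw [ht]

section bridge

variable {u : ℝ → L2} {a b : ℝ}

/-- The fourth power of the `L⁴` norm of the truncation. -/
def polyFour (u : ℝ → L2) (N : ℕ) (t : ℝ) : ℝ≥0∞ :=
  ∫⁻ x, ‖poly N (coeff (u t)) x‖ₑ ^ 4 ∂torusMeasure

/-- The bound for the space-time `L⁴` norm. -/
def quartBound (a b : ℝ) (v : Family) : ℝ≥0∞ :=
  32 * ENNReal.ofReal (gain |b - a|) * (l2 (trilin (yn v) (yn v) (yn v)) * l2 (yn v))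

lemma quartBound_ne_top {v : Family} (h : l2 (yn v) ≠ ∞) (a b : ℝ) : quartBound a b v ≠ ∞ :=
  ENNReal.mul_ne_top (ENNReal.mul_ne_top (by norm_num) ENNReal.ofReal_ne_top)
    (ENNReal.mul_ne_top (l2_trilin_ne_top h h h) h)

/-- The integral in time is a finite partial sum of the absolutely convergent quartic series, so the
bound is uniform in N. It plays the role of an L⁴ Strichartz estimate. -/
lemma lintegral_polyFour_le (hab : a ≤ b) (h : l2 (yn (cut a b (inter u))) ≠ ∞) (N : ℕ) :
    AEMeasurable (polyFour u N) (volume.restrict (Icc a b)) ∧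
      ∫⁻ t in Icc a b, polyFour u N t ≤ quartBound a b (cut a b (inter u)) := by
  set V := cut a b (inter u) with hV
  set Q : ℝ → ℂ := fun r => ∑ n ∈ window N, ∑ p ∈ box N n,
    Complex.exp (Complex.I * ((phase n p.1 p.2 * r : ℝ) : ℂ))
      * (cub V V V n p r * conj (V n r)) with hQ
  have hi : ∀ n p, IntervalIntegrable (fun r => Complex.exp (Complex.I *
      ((phase n p.1 p.2 * r : ℝ) : ℂ)) * (cub V V V n p r * conj (V n r))) volume a b := fun n p =>
    intervalIntegrable_exp_mul (halfReg_quart h h n p).1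
      (halfReg_quart h h n p).2.1 (quart_const_ne_top h h n p) (phase n p.1 p.2) a b
  have hQi : IntervalIntegrable Q volume a b := by
    rw [hQ]
    exact intervalIntegrable_sum _ fun n => intervalIntegrable_sum _ fun p => hi n p
  have hQI : Integrable Q (volume.restrict (Icc a b)) := by
    rw [intervalIntegrable_iff_integrableOn_Icc_of_le hab] at hQi
    exact hQi
  -- All phases cancel in the quartic products, so Q is the fourth power of the spatial L⁴ norm.
  -- This also supplies measurability in time, which is not assumed of u.
  have hQe : ∀ r ∈ Icc a b, Q r
      = ((∫ x, ‖poly N (coeff (u r)) x‖ ^ 4 ∂torusMeasure : ℝ) : ℂ) := by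
    intro r hr
    rw [integral_quartic_poly, hQ]
    refine Finset.sum_congr rfl fun n _ => Finset.sum_congr rfl fun p _ => ?_
    rw [← cubTerm_mul_conj]
    simp only [cub, hV, cut_eqOn a b _ _ hr]
  have hpe : ∀ r ∈ Icc a b, polyFour u N r = ENNReal.ofReal (Q r).re := by
    intro r hr
    have hi4 : Integrable (fun x => ‖poly N (coeff (u r)) x‖ ^ 4) torusMeasure :=
      (((continuous_poly N _).norm.pow 4).integrable_of_hasCompactSupport
        (HasCompactSupport.of_compactSpace _))
    rw [hQe r hr, Complex.ofReal_re, ofReal_integral_eq_lintegral_ofReal hi4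
      (Eventually.of_forall fun x => by positivity), polyFour]
    refine lintegral_congr fun x => ?_
    rw [ENNReal.ofReal_pow (norm_nonneg _), ofReal_norm]
  have hae : polyFour u N =ᵐ[volume.restrict (Icc a b)] fun r => ENNReal.ofReal (Q r).re := by
    filter_upwards [ae_restrict_mem measurableSet_Icc] with r hr using hpe r hr
  refine ⟨AEMeasurable.congr (hQI.re.aestronglyMeasurable.aemeasurable.ennreal_ofReal) hae.symm, ?_⟩
  have hnn : 0 ≤ᵐ[volume.restrict (Icc a b)] fun r => (Q r).re := by
    filter_upwards [ae_restrict_mem measurableSet_Icc] with r hr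
    rw [hQe r hr, Complex.ofReal_re]
    exact integral_nonneg fun x => by positivity
  have hre := integral_re (𝕜 := ℂ) hQI
  simp only [RCLike.re_to_complex] at hre
  have hint : ∫ r in Icc a b, Q r = ∑ n ∈ window N, ∑ p ∈ box N n, quart V V n p a b := by
    rw [integral_Icc_eq_integral_Ioc, ← intervalIntegral.integral_of_le hab, hQ,
      intervalIntegral.integral_finsetSum fun n _ => intervalIntegrable_sum _ fun p => hi n p]
    refine Finset.sum_congr rfl fun n _ => ?_
    rw [intervalIntegral.integral_finsetSum fun p _ => hi n p]
    rfl
  calc ∫⁻ t in Icc a b, polyFour u N t = ∫⁻ t in Icc a b, ENNReal.ofReal (Q t).re :=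
        lintegral_congr_ae hae
    _ = ENNReal.ofReal (∫ r in Icc a b, Q r).re := by
        rw [← hre]; exact (ofReal_integral_eq_lintegral_ofReal hQI.re hnn).symm
    _ ≤ ‖∫ r in Icc a b, Q r‖ₑ := by
        rw [← ofReal_norm]; exact ENNReal.ofReal_le_ofReal (Complex.re_le_norm _)
    _ ≤ ∑ n ∈ window N, ∑ p ∈ box N n, ‖quart V V n p a b‖ₑ := by
        rw [hint]
        exact (enorm_sum_le _ _).trans (Finset.sum_le_sum fun n _ => enorm_sum_le _ _)
    _ ≤ ∑ n ∈ window N, ∑' p, ‖quart V V n p a b‖ₑ :=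
        Finset.sum_le_sum fun n _ => ENNReal.sum_le_tsum _
    _ ≤ ∑' n, ∑' p, ‖quart V V n p a b‖ₑ := ENNReal.sum_le_tsum _
    _ ≤ _ := tsum_tsum_enorm_quart_le h h a b

lemma lintegral_liminf_polyFour_le (hab : a ≤ b) (h : l2 (yn (cut a b (inter u))) ≠ ∞) :
    ∫⁻ t in Icc a b, liminf (fun N => polyFour u N t) atTop
      ≤ quartBound a b (cut a b (inter u)) := by
  refine (lintegral_liminf_le' fun N => (lintegral_polyFour_le hab h N).1).trans ?_
  refine liminf_le_of_le (by isBoundedDefault) fun c hc => ?_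
  obtain ⟨N, hN⟩ := hc.exists
  exact hN.trans (lintegral_polyFour_le hab h N).2

lemma lintegral_cube_lt_top (hab : a ≤ b) (h : l2 (yn (cut a b (inter u))) ≠ ∞) :
    ∫⁻ t in Icc a b, ∫⁻ x, ‖u t x‖ₑ ^ 3 ∂torusMeasure < ∞ := by
  calc _ ≤ ∫⁻ t in Icc a b, (1 + liminf (fun N => polyFour u N t) atTop) :=
        lintegral_mono fun t => (lintegral_cube_le _).trans
          (add_le_add le_rfl (lintegral_four_le_liminf (u t)))
    _ = ENNReal.ofReal (b - a) + ∫⁻ t in Icc a b, liminf (fun N => polyFour u N t) atTop := by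
        rw [lintegral_add_left measurable_const]; simp
    _ < ∞ := ENNReal.add_lt_top.2 ⟨ENNReal.ofReal_lt_top, (lintegral_liminf_polyFour_le hab
        h).trans_lt (quartBound_ne_top h a b).lt_top⟩

/-- The time-integrated cubic nonlinearity is the sum of its interactions. -/
theorem integral_cubicCoeff_eq_gam (hab : a ≤ b) (h : l2 (yn (cut a b (inter u))) ≠ ∞) (n : ℤ) :
    IntegrableOn (fun r => Complex.exp (Complex.I * (((n : ℝ) ^ 4 * r : ℝ) : ℂ))
      * cubicCoeff (u r) n) (Icc a b) ∧
    ∀ s ∈ Icc a b, ∀ t ∈ Icc a b, ∫ r in s..t, Complex.exp (Complex.I * (((n : ℝ) ^ 4 * r : ℝ) : ℂ))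
      * cubicCoeff (u r) n
        = gam (cut a b (inter u)) (cut a b (inter u)) (cut a b (inter u)) n s t := by
  set V := cut a b (inter u) with hV
  set c : ℝ → ℂ := fun r => Complex.exp (Complex.I * (((n : ℝ) ^ 4 * r : ℝ) : ℂ))
      * cubicCoeff (u r) n with hc
  set L : ℝ → ℝ≥0∞ := fun t => liminf (fun N => polyFour u N t) atTop with hL
  have hLi : ∫⁻ t in Icc a b, L t ≤ quartBound a b V := lintegral_liminf_polyFour_le hab h
  have hMt := quartBound_ne_top h a b
  have hLm : AEMeasurable L (volume.restrict (Icc a b)) :=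
    aemeasurable_liminf fun N => (lintegral_polyFour_le hab h N).1
  set C : ℕ → ℝ → ℂ := fun N r => ∑ p ∈ box N n,
    Complex.exp (Complex.I * ((phase n p.1 p.2 * r : ℝ) : ℂ)) * cub V V V n p r with hC
  -- The Cauchy–Schwarz bound has the form 8X · tail²; its root is bounded by 4 · tail · (1 + X),
  -- linear in X because the time integral of X is what is controlled.
  set E : ℕ → ℝ → ℝ≥0∞ := fun N r => 4 * tail N (yn V) * (1 + (polyFour u N r + L r)) with hE
  have hCi : ∀ N s t, IntervalIntegrable (C N) volume s t := fun N s t =>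
    intervalIntegrable_sum _ fun p => intervalIntegrable_osc h h h n p s t
  have hCI : ∀ N, Integrable (C N) (volume.restrict (Icc a b)) := fun N => by
    have := hCi N a b
    rw [intervalIntegrable_iff_integrableOn_Icc_of_le hab] at this
    exact this
  have hEm : ∀ N, AEMeasurable (E N) (volume.restrict (Icc a b)) := fun N =>
    (((lintegral_polyFour_le hab h N).1.add hLm).const_add 1).const_mul _
  have htail : ∀ N, tail N (yn V) ≠ ∞ := fun N =>
    ne_top_of_le_ne_top h (l2_mono fun m => by split_ifs; exacts [zero_le, le_rfl])
  have hle : ∀ N, ∀ᵐ t ∂(volume.restrict (Icc a b)), ‖C N t - c t‖ₑ ≤ E N t := by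
    intro N
    filter_upwards [ae_restrict_mem measurableSet_Icc,
      ae_lt_top' hLm (ne_top_of_le_ne_top hMt hLi)] with r hr hLr
    have e : C N r - c r = Complex.exp (Complex.I * (((n : ℝ) ^ 4 * r : ℝ) : ℂ))
        * (∑ p ∈ box N n, cubTerm (coeff (u r)) n p - cubicCoeff (u r) n) := by
      rw [mul_sub, Finset.mul_sum, hC, hc]
      congr 1
      refine Finset.sum_congr rfl fun p _ => ?_
      rw [← exp_phase_mul_cub]
      simp only [cub, hV, cut_eqOn a b _ _ hr]
    rw [e, enorm_mul, enorm_exp_I_mul, one_mul]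
    have hf := lintegral_four_le_liminf (u r)
    have ht : tail N (mag (coeff (u r))) ≤ tail N (yn V) := by
      rw [← mag_inter]; exact tail_mono fun m => mag_le_yn_cut hr _ m
    refine le_of_sq_le ((enorm_sq_cubicCoeff_sub_le (u r) (ne_top_of_le_ne_top hLr.ne hf)
      N n).trans ?_)
    set X := polyFour u N r + L r with hX
    calc _ ≤ 8 * X * tail N (yn V) ^ 2 := by
          rw [hX]; gcongr
          · exact le_rfl
          · exact hf
      _ ≤ 16 * (1 + X) ^ 2 * tail N (yn V) ^ 2 := by
          gcongr
          · norm_num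
          · calc X ≤ 1 + X := le_add_self
              _ ≤ _ := le_self_pow le_self_add (by norm_num)
      _ = _ := by rw [hE]; ring
  have h0 : Tendsto (fun N => ∫⁻ t in Icc a b, E N t) atTop (𝓝 0) := by
    have hb : ∀ N, ∫⁻ t in Icc a b, E N t ≤ 4 * tail N (yn V) *
        (ENNReal.ofReal (b - a) + (quartBound a b V + quartBound a b V)) := by
      intro N
      rw [hE]
      simp only
      rw [lintegral_const_mul' _ _ (ENNReal.mul_ne_top (by norm_num) (htail N)),
        lintegral_add_left measurable_const, lintegral_add_left' (lintegral_polyFour_le hab h N).1]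
      refine mul_le_mul' le_rfl (add_le_add (by simp) (add_le_add
        (lintegral_polyFour_le hab h N).2 hLi))
    have hlim : Tendsto (fun N => 4 * tail N (yn V) *
        (ENNReal.ofReal (b - a) + (quartBound a b V + quartBound a b V))) atTop (𝓝 0) := by
      have h1 := ENNReal.Tendsto.const_mul (tendsto_tail h) (a := 4) (Or.inr (by norm_num))
      have h2 := ENNReal.Tendsto.mul_const h1 (b := ENNReal.ofReal (b - a)
        + (quartBound a b V + quartBound a b V)) (Or.inr (ENNReal.add_ne_top.2
        ⟨ENNReal.ofReal_ne_top, ENNReal.add_ne_top.2 ⟨hMt, hMt⟩⟩))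
      simpa using h2
    exact tendsto_of_tendsto_of_tendsto_of_le_of_le tendsto_const_nhds hlim (fun _ => zero_le) hb
  obtain ⟨hcI, hconv⟩ := tendsto_lintegral_of_enorm_sub_le hCI hEm hle h0
  refine ⟨hcI, fun s hs t ht => ?_⟩
  have hsub : ∀ s ∈ Icc a b, ∀ t ∈ Icc a b,
      Tendsto (fun N => ∫ r in Ioc s t, C N r) atTop (𝓝 (∫ r in Ioc s t, c r)) := by
    intro s hs t ht
    have hss : Ioc s t ⊆ Icc a b := Ioc_subset_Icc_self.trans (Icc_subset_Icc hs.1 ht.2)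
    have hμ := Measure.restrict_mono_set volume hss
    refine tendsto_integral_of_L1 c (hcI.mono_measure hμ).1
      (Eventually.of_forall fun N => (hCI N).mono_measure hμ) ?_
    exact tendsto_of_tendsto_of_tendsto_of_le_of_le tendsto_const_nhds hconv (fun _ => zero_le)
      fun N => lintegral_mono' hμ le_rfl
  have h1 : Tendsto (fun N => ∫ r in s..t, C N r) atTop (𝓝 (∫ r in s..t, c r)) :=
    (hsub s hs t ht).sub (hsub t ht s hs)
  have h2 : Tendsto (fun N => ∫ r in s..t, C N r) atTop (𝓝 (gam V V V n s t)) := by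
    have := (summable_osc h h h n s t).hasSum.comp (tendsto_box n)
    refine this.congr fun N => ?_
    rw [hC, intervalIntegral.integral_finsetSum fun p _ => intervalIntegrable_osc h h h n p s t]
    rfl
  exact tendsto_nhds_unique h1 h2

end bridge

lemma propagator_eq (t : ℝ) (n : ℤ) :
    propagator t n = Complex.exp (-(Complex.I * (((n : ℝ) ^ 4 * t : ℝ) : ℂ))) := by
  rw [propagator]; push_cast; ring_nf

lemma propagator_mul_inter (u : ℝ → L2) (n : ℤ) (t : ℝ) :
    propagator t n * inter u n t = coeff (u t) n := by
  rw [propagator_eq, inter, ← mul_assoc, ← Complex.exp_add]; simp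

lemma exp_mul_propagator (t : ℝ) (n : ℤ) :
    Complex.exp (Complex.I * (((n : ℝ) ^ 4 * t : ℝ) : ℂ)) * propagator t n = 1 := by
  rw [propagator_eq, ← Complex.exp_add]; simp

lemma enorm_propagator (t : ℝ) (n : ℤ) : ‖propagator t n‖ₑ = 1 := by
  have := congr_arg (‖·‖ₑ) (exp_mul_propagator t n)
  simpa only [enorm_mul, enorm_exp_I_mul, one_mul, enorm_one] using this

lemma continuous_propagator (n : ℤ) : Continuous fun t => propagator t n := by
  unfold propagator; fun_prop

lemma duhamel_iff (ε : ℝ) (u : ℝ → L2) (c₀ : ℂ) (t : ℝ) (n : ℤ) :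
    coeff (u t) n = propagator t n * c₀
      - Complex.I * (ε : ℂ) * ∫ r in (0 : ℝ)..t, propagator (t - r) n * cubicCoeff (u r) n
    ↔ inter u n t = c₀ + -(Complex.I * (ε : ℂ)) * ∫ r in (0 : ℝ)..t,
      Complex.exp (Complex.I * (((n : ℝ) ^ 4 * r : ℝ) : ℂ)) * cubicCoeff (u r) n := by
  have e : ∫ r in (0 : ℝ)..t, propagator (t - r) n * cubicCoeff (u r) n
      = propagator t n * ∫ r in (0 : ℝ)..t,
        Complex.exp (Complex.I * (((n : ℝ) ^ 4 * r : ℝ) : ℂ)) * cubicCoeff (u r) n := by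
    rw [← intervalIntegral.integral_const_mul]
    congr 1; ext r
    rw [← mul_assoc, propagator_eq, propagator_eq, ← Complex.exp_add]
    congr 2; push_cast; ring
  have h := exp_mul_propagator t n
  rw [e]
  constructor
  · intro h1
    rw [inter, h1]
    linear_combination (c₀ - Complex.I * (ε : ℂ) * ∫ r in (0 : ℝ)..t,
        Complex.exp (Complex.I * (((n : ℝ) ^ 4 * r : ℝ) : ℂ)) * cubicCoeff (u r) n) * h
  · intro h1
    rw [← propagator_mul_inter, h1]; ring

/-! ### Solutions of the equation and of its interaction form -/

section correspondence

variable {ε s a b : ℝ} {u : ℝ → L2} {u₀ : L2}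

lemma IsSolution.inter_zero (h0 : (0 : ℝ) ∈ Icc a b) (hu : IsSolution ε s (Icc a b) u₀ u) (n : ℤ) :
    inter u n 0 = coeff u₀ n := by
  have := (duhamel_iff ε u _ 0 n).1 (hu.duhamel 0 h0 n)
  simpa using this

lemma IsSolution.isSol (h0 : (0 : ℝ) ∈ Icc a b) (hu : IsSolution ε s (Icc a b) u₀ u)
    (h : l2 (yn (cut a b (inter u))) ≠ ∞) : IsSol (-(Complex.I * ε)) a b (inter u) := by
  refine ⟨h, fun n s hs t ht => ?_⟩
  have hg := (integral_cubicCoeff_eq_gam (h0.1.trans h0.2) h n).2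
  have key : ∀ t ∈ Icc a b, inter u n t = coeff u₀ n + -(Complex.I * (ε : ℂ))
      * gam (cut a b (inter u)) (cut a b (inter u)) (cut a b (inter u)) n 0 t := fun t ht => by
    rw [← hg 0 h0 t ht]; exact (duhamel_iff ε u _ t n).1 (hu.duhamel t ht n)
  rw [key t ht, key s hs, ← gam_add_adjacent h h h n 0 s t]
  ring

/-- Dominated convergence for sums of nonnegative terms. -/
lemma tendsto_tsum_zero {α : Type*} {l : Filter α} [l.IsCountablyGenerated] {f : α → ℤ → ℝ≥0∞}
    {g : ℤ → ℝ≥0∞} (hg : ∑' n, g n ≠ ∞) (hle : ∀ᶠ x in l, ∀ n, f x n ≤ g n)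
    (h0 : ∀ n, Tendsto (fun x => f x n) l (𝓝 0)) : Tendsto (fun x => ∑' n, f x n) l (𝓝 0) := by
  let _ : MeasurableSpace ℤ := ⊤
  have := tendsto_lintegral_filter_of_dominated_convergence (μ := Measure.count) (l := l)
    (F := f) (f := fun _ => 0) g (Eventually.of_forall fun _ => measurable_from_top)
    (hle.mono fun x hx => Eventually.of_forall hx) (by rwa [lintegral_count])
    (Eventually.of_forall h0)
  simpa only [lintegral_count, tsum_zero] using this

lemma IsSol.tendsto_inter {c : ℂ} {v : Family} (hv : IsSol c a b v) (n : ℤ) {t₀ : ℝ}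
    (ht₀ : t₀ ∈ Icc a b) : Tendsto (v n) (𝓝[Icc a b] t₀) (𝓝 (v n t₀)) := by
  rw [tendsto_iff_edist_tendsto_0]
  set X := trilin (yn (cut a b v)) (yn (cut a b v)) (yn (cut a b v)) n
  have hX : X ≠ ∞ := trilin_ne_top hv.fin hv.fin hv.fin n
  have hgain : Tendsto (fun t => gain |t - t₀|) (𝓝[Icc a b] t₀) (𝓝 0) := by
    have hc : Continuous fun t => gain |t - t₀| := by
      unfold gain
      exact ((continuous_abs.comp (continuous_id.sub continuous_const)).rpow_const
        fun _ => Or.inr (by norm_num)).max (continuous_abs.comp (continuous_id.sub continuous_const))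
    have := hc.tendsto t₀
    have e : gain |t₀ - t₀| = 0 := by
      rw [sub_self, abs_zero, gain, Real.zero_rpow (by norm_num), max_self]
    rw [e] at this
    exact this.mono_left nhdsWithin_le_nhds
  have hlim : Tendsto (fun t => ‖c‖ₑ * (16 * ENNReal.ofReal (gain |t - t₀|) * X))
      (𝓝[Icc a b] t₀) (𝓝 0) := by
    have h1 := ENNReal.tendsto_ofReal hgain
    have h2 := ENNReal.Tendsto.const_mul h1 (a := 16) (Or.inr (by norm_num))
    have h3 := ENNReal.Tendsto.mul_const h2 (b := X) (Or.inr hX)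
    have h4 := ENNReal.Tendsto.const_mul h3 (a := ‖c‖ₑ) (Or.inr enorm_ne_top)
    simpa using h4
  refine tendsto_of_tendsto_of_tendsto_of_le_of_le' tendsto_const_nhds hlim
    (Eventually.of_forall fun _ => zero_le) ?_
  filter_upwards [self_mem_nhdsWithin] with t ht
  rw [edist_eq_enorm_sub, hv.eq n t₀ ht₀ t ht, enorm_mul]
  gcongr
  exact enorm_gam_le hv.fin hv.fin hv.fin n t₀ t

/-- Each coefficient is continuous in time, and the norms `yn` furnish a majorant, summable over
frequencies and independent of time, for dominated convergence. -/
lemma IsSol.contInHs {c : ℂ} (hv : IsSol c a b (inter u))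
    (h : wl2 s (yn (cut a b (inter u))) ≠ ∞) : ContInHs s (Icc a b) u := by
  have hmag : ∀ t ∈ Icc a b, ∀ n, mag (coeff (u t)) n ≤ yn (cut a b (inter u)) n := by
    intro t ht n
    rw [← mag_inter]; exact mag_le_yn_cut ht _ n
  refine ⟨fun t ht => ?_, fun t₀ ht₀ => ?_⟩
  · rw [MemHs, hsNorm_eq]
    exact (wl2_mono (hmag t ht)).trans_lt h.lt_top
  · have h2 : ∑' n, (2 * (wt s n * yn (cut a b (inter u)) n)) ^ 2 ≠ ∞ := by
      simp_rw [mul_pow (2 : ℝ≥0∞)]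
      rw [ENNReal.tsum_mul_left, ← l2_sq]
      exact ENNReal.mul_ne_top (by norm_num) (ENNReal.pow_ne_top h)
    have h3 : Tendsto (fun t => ∑' n, (wt s n * mag (coeff (u t - u t₀)) n) ^ 2)
        (𝓝[Icc a b] t₀) (𝓝 0) := by
      refine tendsto_tsum_zero h2 ?_ fun n => ?_
      · filter_upwards [self_mem_nhdsWithin] with t ht n
        rw [mag, coeff_sub, mul_left_comm]
        gcongr
        rw [two_mul]
        exact (enorm_sub_le).trans (add_le_add (hmag t ht n) (hmag t₀ ht₀ n))
      · have h4 : Tendsto (fun t => coeff (u t - u t₀) n) (𝓝[Icc a b] t₀) (𝓝 0) := by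
          have h5 : Tendsto (fun t => coeff (u t) n) (𝓝[Icc a b] t₀) (𝓝 (coeff (u t₀) n)) := by
            simp_rw [← propagator_mul_inter]
            exact (((continuous_propagator n).tendsto t₀).mono_left nhdsWithin_le_nhds).mul
              (hv.tendsto_inter n ht₀)
          simp_rw [coeff_sub]
          simpa using h5.sub_const (coeff (u t₀) n)
        have h6 := ENNReal.Tendsto.pow (n := 2) (ENNReal.Tendsto.const_mul h4.enorm
          (Or.inr (wt_ne_top s n)))
        simpa [mag] using h6
    have h7 := (ENNReal.continuous_rpow_const (y := 1 / 2)).tendsto 0 |>.comp h3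
    simp only [Function.comp_def] at h7
    rw [ENNReal.zero_rpow_of_pos (by norm_num)] at h7
    refine h7.congr fun t => ?_
    rw [hsNorm_eq, wl2, l2]

lemma IsSol.isSolution (h0 : (0 : ℝ) ∈ Icc a b) (hv : IsSol (-(Complex.I * ε)) a b (inter u))
    (h : wl2 s (yn (cut a b (inter u))) ≠ ∞) (hz : ∀ n, inter u n 0 = coeff u₀ n) :
    IsSolution ε s (Icc a b) u₀ u := by
  have hab := h0.1.trans h0.2
  refine ⟨hv.contInHs h, lintegral_cube_lt_top hab hv.fin, fun t ht n => ?_⟩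
  rw [duhamel_iff, (integral_cubicCoeff_eq_gam hab hv.fin n).2 0 h0 t ht, ← hv.eq n 0 h0 t ht, hz]
  ring

/-- Membership in `X^{s,b}` for `b > 1/2` controls the coefficients in the interaction
representation. -/
lemma l2_yn_inter_ne_top_of_xsbNorm {d : ℝ} (hd : 1 / 2 < d) (hs : 0 ≤ s)
    (h : xsbNorm s d (Icc a b) u < ∞) : l2 (yn (cut a b (inter u))) ≠ ∞ := by
  rw [xsbNorm] at h
  simp only [iInf_lt_iff] at h
  obtain ⟨g, ⟨hgm, hge⟩, hg⟩ := h
  obtain ⟨C, hC, hreg⟩ := exists_halfReg_invF hd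
  -- Passing to the interaction representation translates the time frequency by n⁴, which turns the
  -- weight ⟨τ + n⁴⟩ into ⟨σ⟩.
  set G : ℤ → ℝ → ℂ := fun n σ => g n (σ - (n : ℝ) ^ 4) with hG
  have hGm : ∀ n, Measurable (G n) := fun n => (hgm n).comp (measurable_id.sub_const _)
  have hsq : ∀ n, hbSq d (G n) = ∫⁻ τ, ENNReal.ofReal (bracket (τ + (n : ℝ) ^ 4) ^ (2 * d))
      * ‖g n τ‖ₑ ^ 2 := by
    intro n
    rw [hbSq, ← lintegral_add_right_eq_self _ ((n : ℝ) ^ 4)]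
    simp only [hG, add_sub_cancel_right]
  have hle : ∑' n, hbSq d (G n) ≤ xsbFourierNorm s d g ^ 2 := by
    rw [xsbFourierNorm, rpow_half_sq]
    refine ENNReal.tsum_le_tsum fun n => ?_
    rw [hsq]
    refine lintegral_mono fun τ => ?_
    gcongr
    exact le_mul_of_one_le_left (Real.rpow_nonneg (zero_le_one.trans (one_le_bracket _)) _)
      (Real.one_le_rpow (one_le_bracket _) (by positivity))
  have hfin : ∑' n, hbSq d (G n) ≠ ∞ := ne_top_of_le_ne_top (ENNReal.pow_ne_top hg.ne) hle
  have hv : ∀ n, ∀ t ∈ Icc a b, inter u n t = invF (G n) t := by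
    intro n t ht
    rw [inter, hge t ht n, invF, mul_left_comm]
    congr 1
    rw [← integral_add_right_eq_self (fun τ : ℝ => Complex.exp (Complex.I * (t : ℂ) * (τ : ℂ)) * G n τ)
      ((n : ℝ) ^ 4), ← integral_const_mul]
    congr 1; ext τ
    simp only [hG, add_sub_cancel_right]
    rw [← mul_assoc, ← Complex.exp_add]
    congr 2; push_cast; ring
  have hcut : cut a b (inter u) = cut a b fun n => invF (G n) := by
    ext n t
    by_cases ht : t ∈ Icc a b
    · simp only [cut, indicator_of_mem ht, hv n t ht]
    · simp only [cut, indicator_of_notMem ht]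
  have hyn : ∀ n, yn (cut a b (inter u)) n ≤ 4 * C * hbSq d (G n) ^ (1 / 2 : ℝ) := by
    intro n
    rw [hcut, mul_assoc]
    refine (yn_cut_le a b _ n).trans (mul_le_mul' le_rfl (yNorm_le (hreg (G n) (hGm n) ?_)))
    exact ne_top_of_le_ne_top hfin (ENNReal.le_tsum n)
  refine ne_top_of_le_ne_top ?_ (l2_mono hyn)
  rw [l2_const_mul]
  refine ENNReal.mul_ne_top (ENNReal.mul_ne_top (by norm_num) hC) ?_
  rw [l2]
  simp_rw [rpow_half_sq]
  exact ENNReal.rpow_ne_top_of_nonneg (by norm_num) hfin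

end correspondence

/-! ### Regularity above s = 1/2 -/

lemma tsum_enorm_sq_fourierCoeff {F : Torus → ℂ} (hF : MemLp F 2 torusMeasure) :
    ∑' n, ‖fourierCoeff F n‖ₑ ^ 2 = ∫⁻ x, ‖F x‖ₑ ^ 2 ∂torusMeasure := by
  have h := enorm_sq_eq_tsum (hF.toLp F)
  have h1 : ∀ n, coeff (hF.toLp F) n = fourierCoeff F n := fun n =>
    congr_fun (fourierCoeff_congr_ae hF.coeFn_toLp) n
  simp_rw [h1] at h
  rw [← h]
  refine lintegral_congr_ae ?_
  filter_upwards [hF.coeFn_toLp] with x hx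
  rw [hx]

/-- The one place where s > 1/2 is used quantitatively: it makes the Fourier series of an H^s
function absolutely convergent. -/
lemma l2_inv_wt_ne_top {s : ℝ} (hs : 1 / 2 < s) : l2 (fun n => (wt s n)⁻¹) ≠ ∞ := by
  have h2 : Summable fun n : ℤ => |(n : ℝ)| ^ (-(2 * s)) + if n = 0 then (1 : ℝ) else 0 :=
    (Real.summable_abs_int_rpow (by linarith)).add
      (summable_of_ne_finset_zero (s := {0}) fun n hn => by simpa using hn)
  refine ENNReal.rpow_ne_top_of_nonneg (by norm_num) (ne_top_of_le_ne_top
    h2.tsum_ofReal_ne_top (ENNReal.tsum_le_tsum fun n => ?_))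
  have hb := one_le_bracket (n : ℝ)
  have hb0 : 0 < bracket (n : ℝ) := by linarith
  simp only [wt]
  rw [← ENNReal.ofReal_inv_of_pos (by positivity), ← ENNReal.ofReal_pow (by positivity)]
  apply ENNReal.ofReal_le_ofReal
  have e : ((bracket (n : ℝ) ^ s)⁻¹) ^ 2 = bracket (n : ℝ) ^ (-(2 * s)) := by
    rw [← Real.rpow_neg hb0.le, ← Real.rpow_natCast, ← Real.rpow_mul hb0.le]
    congr 1; push_cast; ring
  rw [e]
  by_cases hn : n = 0
  · rw [if_pos hn]
    have := Real.rpow_le_one_of_one_le_of_nonpos hb (by linarith : -(2 * s) ≤ 0)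
    have h3 : 0 ≤ |(n : ℝ)| ^ (-(2 * s)) := by positivity
    linarith
  · rw [if_neg hn, add_zero]
    refine Real.rpow_le_rpow_of_nonpos (by positivity) ?_ (by linarith)
    refine abs_le_of_sq_le_sq ?_ hb0.le
    rw [bracket_sq]; linarith

lemma tsum_coeff_le {s : ℝ} (f : L2) :
    ∑' n, ‖coeff f n‖ₑ ≤ l2 (fun n => (wt s n)⁻¹) * hsNorm s f := by
  rw [hsNorm_eq]
  refine le_trans (le_of_eq (tsum_congr fun n => ?_)) (tsum_mul_le_l2 _ _)
  have h0 : wt s n ≠ 0 := by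
    have := Real.rpow_pos_of_pos (zero_lt_one.trans_le (one_le_bracket (n : ℝ))) s
    rw [wt]; simpa using this
  rw [mag, ← mul_assoc, ENNReal.inv_mul_cancel h0 (wt_ne_top s n), one_mul]

lemma enorm_poly_le (N : ℕ) (a : ℤ → ℂ) (x : Torus) : ‖poly N a x‖ₑ ≤ ∑' n, ‖a n‖ₑ := by
  refine (enorm_sum_le _ _).trans (le_trans (le_of_eq (Finset.sum_congr rfl fun n _ => ?_))
    (ENNReal.sum_le_tsum (window N)))
  have hx : ‖fourier n x‖ₑ = 1 := by
    rw [fourier_apply, ← ofReal_norm, Circle.norm_coe, ENNReal.ofReal_one]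
  rw [enorm_mul, hx, mul_one]

lemma lintegral_pow_le_of_ae_le {f : Torus → ℂ} {S : ℝ≥0∞} (h : ∀ᵐ x ∂torusMeasure, ‖f x‖ₑ ≤ S)
    (k : ℕ) : ∫⁻ x, ‖f x‖ₑ ^ k ∂torusMeasure ≤ S ^ k := by
  calc _ ≤ ∫⁻ _, S ^ k ∂torusMeasure := lintegral_mono_ae (h.mono fun x hx => by gcongr)
    _ = _ := by simp

lemma tsum_enorm_sq_cubicCoeff_le (f : L2) {S : ℝ≥0∞} (hS : S ≠ ∞)
    (h : ∀ᵐ x ∂torusMeasure, ‖f x‖ₑ ≤ S) : ∑' n, ‖cubicCoeff f n‖ₑ ^ 2 ≤ S ^ 6 := by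
  have h2 : ∫⁻ x, ‖((‖f x‖ ^ 2 : ℝ) : ℂ) * f x‖ₑ ^ 2 ∂torusMeasure ≤ S ^ 6 := by
    simp_rw [enorm_cubic, ← pow_mul]
    exact lintegral_pow_le_of_ae_le h 6
  have hm : MemLp (fun x => ((‖f x‖ ^ 2 : ℝ) : ℂ) * f x) 2 torusMeasure := by
    refine ⟨aestronglyMeasurable_cubic (Lp.aestronglyMeasurable f), ?_⟩
    rw [← eLpNorm_two_sq] at h2
    exact (ENNReal.pow_lt_top_iff.1 (h2.trans_lt (ENNReal.pow_lt_top hS.lt_top))).resolve_right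
      (by norm_num)
  exact (tsum_enorm_sq_fourierCoeff hm).trans_le h2

section regular

variable {ε s a b : ℝ} {u : ℝ → L2} {u₀ : L2}

lemma hsNorm_le_add (s : ℝ) (f g : L2) : hsNorm s f ≤ hsNorm s (f - g) + hsNorm s g := by
  rw [hsNorm_eq, hsNorm_eq, hsNorm_eq]
  refine (wl2_mono fun n => ?_).trans (wl2_add_le s _ _)
  simp only [mag, coeff_sub]
  calc ‖coeff f n‖ₑ = ‖(coeff f n - coeff g n) + coeff g n‖ₑ := by rw [sub_add_cancel]
    _ ≤ _ := enorm_add_le _ _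

/-- Local bounds follow from smallness of the differences, and compactness of the interval joins
finitely many of them. -/
lemma ContInHs.exists_bound (hu : ContInHs s (Icc a b) u) :
    ∃ M : ℝ≥0∞, M ≠ ∞ ∧ ∀ t ∈ Icc a b, hsNorm s (u t) ≤ M := by
  refine isCompact_Icc.induction_on (p := fun S => ∃ M : ℝ≥0∞, M ≠ ∞ ∧ ∀ t ∈ S, hsNorm s (u t) ≤ M)
    ⟨0, by simp⟩ (fun S T hST ⟨M, hM, h⟩ => ⟨M, hM, fun t ht => h t (hST ht)⟩)
    (fun S T ⟨M, hM, h⟩ ⟨M', hM', h'⟩ => ⟨max M M', by simp [hM, hM'], fun t ht => ?_⟩)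
    fun t₀ ht₀ => ?_
  · rcases ht with ht | ht
    · exact (h t ht).trans (le_max_left _ _)
    · exact (h' t ht).trans (le_max_right _ _)
  · refine ⟨{t | hsNorm s (u t - u t₀) < 1}, (hu.2 t₀ ht₀).eventually_lt_const zero_lt_one,
      1 + hsNorm s (u t₀), ENNReal.add_ne_top.2 ⟨ENNReal.one_ne_top, (hu.1 t₀ ht₀).ne⟩,
      fun t ht => ?_⟩
    have h1 : hsNorm s (u t - u t₀) < 1 := ht
    exact (hsNorm_le_add s (u t) (u t₀)).trans (add_le_add h1.le le_rfl)

lemma ContInHs.continuousOn_coeff (hs : 0 ≤ s) (hu : ContInHs s (Icc a b) u) (n : ℤ) :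
    ContinuousOn (fun t => coeff (u t) n) (Icc a b) := by
  intro t₀ ht₀
  rw [ContinuousWithinAt, tendsto_iff_edist_tendsto_0]
  refine tendsto_of_tendsto_of_tendsto_of_le_of_le tendsto_const_nhds (hu.2 t₀ ht₀)
    (fun _ => zero_le) fun t => ?_
  rw [edist_eq_enorm_sub, ← coeff_sub, hsNorm_eq]
  exact (le_l2 (mag (coeff (u t - u t₀))) n).trans (l2_le_wl2 hs _)

/-- The truncated cubic coefficients are continuous in time and converge pointwise, since absolute
summability bounds all truncations uniformly. -/
lemma ContInHs.aestronglyMeasurable_cubicCoeff (hs : 0 ≤ s) (hu : ContInHs s (Icc a b) u)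
    {S : ℝ≥0∞} (hS : S ≠ ∞) (h : ∀ t ∈ Icc a b, ∑' n, ‖coeff (u t) n‖ₑ ≤ S) (n : ℤ) :
    AEStronglyMeasurable (fun t => cubicCoeff (u t) n) (volume.restrict (Icc a b)) := by
  refine aestronglyMeasurable_of_tendsto_ae atTop
    (f := fun N t => ∑ p ∈ box N n, cubTerm (coeff (u t)) n p) (fun N => ?_) ?_
  · refine ContinuousOn.aestronglyMeasurable ?_ measurableSet_Icc
    refine continuousOn_finsetSum _ fun p _ => ?_
    exact ((hu.continuousOn_coeff hs _).mul (Complex.continuous_conj.comp_continuousOn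
      (hu.continuousOn_coeff hs _))).mul (hu.continuousOn_coeff hs _)
  · filter_upwards [ae_restrict_mem measurableSet_Icc] with t ht
    have hp : ∀ N x, ‖poly N (coeff (u t)) x‖ₑ ≤ S := fun N x => (enorm_poly_le _ _ x).trans (h t ht)
    have h4 : ∫⁻ x, ‖u t x‖ₑ ^ 4 ∂torusMeasure ≤ S ^ 4 :=
      lintegral_pow_le_of_ae_le (ae_enorm_le_of_poly_le _ hp) 4
    rw [tendsto_iff_edist_tendsto_0]
    have hlim := ENNReal.Tendsto.const_mul (a := 4 * S ^ 2)
      (tendsto_tail (l2_mag_coeff_ne_top (u t)))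
      (Or.inr (ENNReal.mul_ne_top (by norm_num) (ENNReal.pow_ne_top hS)))
    rw [mul_zero] at hlim
    refine tendsto_of_tendsto_of_tendsto_of_le_of_le tendsto_const_nhds hlim
      (fun _ => zero_le) fun N => ?_
    rw [edist_eq_enorm_sub]
    refine le_of_sq_le ((enorm_sq_cubicCoeff_sub_le (u t) (ne_top_of_le_ne_top
      (ENNReal.pow_ne_top hS) h4) N n).trans ?_)
    calc _ ≤ 8 * (S ^ 4 + S ^ 4) * tail N (mag (coeff (u t))) ^ 2 := by
          gcongr
          exact lintegral_pow_le_of_ae_le (Eventually.of_forall (hp N)) 4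
      _ = _ := by ring

/-- For `s > 1/2`, continuity in `H^s` controls the coefficients in the interaction
representation. -/
lemma l2_yn_inter_ne_top_of_contInHs (hs : 1 / 2 < s) (h0 : (0 : ℝ) ∈ Icc a b)
    (hu : IsSolution ε s (Icc a b) u₀ u) : l2 (yn (cut a b (inter u))) ≠ ∞ := by
  have hs0 : 0 ≤ s := by linarith
  have hab := h0.1.trans h0.2
  obtain ⟨M, hM, hMb⟩ := hu.cont.exists_bound
  set S := l2 (fun n => (wt s n)⁻¹) * M with hSdef
  have hS : S ≠ ∞ := ENNReal.mul_ne_top (l2_inv_wt_ne_top hs) hM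
  have hsum : ∀ t ∈ Icc a b, ∑' n, ‖coeff (u t) n‖ₑ ≤ S := fun t ht =>
    (tsum_coeff_le (u t)).trans (by rw [hSdef]; gcongr; exact hMb t ht)
  have hcub : ∀ t ∈ Icc a b, ∑' n, ‖cubicCoeff (u t) n‖ₑ ^ 2 ≤ S ^ 6 := fun t ht =>
    tsum_enorm_sq_cubicCoeff_le (u t) hS (ae_enorm_le_of_poly_le _ fun N x =>
      (enorm_poly_le _ _ x).trans (hsum t ht))
  set c : ℤ → ℝ → ℂ := fun n r => Complex.exp (Complex.I * (((n : ℝ) ^ 4 * r : ℝ) : ℂ))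
    * cubicCoeff (u r) n with hc
  have hce : ∀ n r, ‖c n r‖ₑ = ‖cubicCoeff (u r) n‖ₑ := fun n r => by
    rw [hc]; simp only [enorm_mul, enorm_exp_I_mul, one_mul]
  have hcm : ∀ n, AEStronglyMeasurable (c n) (volume.restrict (Icc a b)) := fun n =>
    (Continuous.aestronglyMeasurable (by fun_prop)).mul
      (hu.cont.aestronglyMeasurable_cubicCoeff hs0 hS hsum n)
  -- The L² norm in time of each forcing coefficient. Interchanging sum and integral, these are
  -- square summable by Parseval for the bounded function |u|²u.
  set B : ℤ → ℝ≥0∞ := fun n => (∫⁻ r in Icc a b, ‖c n r‖ₑ ^ 2) ^ (1 / 2 : ℝ) with hB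
  have hBl : l2 B ≠ ∞ := by
    rw [l2]
    refine ENNReal.rpow_ne_top_of_nonneg (by norm_num) ?_
    simp_rw [hB, rpow_half_sq]
    rw [← lintegral_tsum fun n => (hcm n).enorm.pow_const 2]
    refine ne_top_of_le_ne_top (b := S ^ 6 * volume (Icc a b)) (ENNReal.mul_ne_top
      (ENNReal.pow_ne_top hS) (by simp)) ?_
    rw [← setLIntegral_const]
    refine setLIntegral_mono' measurableSet_Icc fun r hr => ?_
    simp_rw [hce]
    exact hcub r hr
  have hBn : ∀ n, B n ≠ ∞ := fun n => ne_top_of_le_ne_top hBl (le_l2 B n)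
  -- Cauchy–Schwarz in time gives Hölder order 1/2, the borderline exponent accepted by
  -- `halfReg_of_holder`.
  have hcs : ∀ n, ∀ r ∈ Icc a b, ∀ t ∈ Icc a b, r ≤ t →
      ∫⁻ x in Ioc r t, ‖c n x‖ₑ ≤ ENNReal.ofReal ((t - r) ^ (1 / 2 : ℝ)) * B n := by
    intro n r hr t ht hrt
    have hss : Ioc r t ⊆ Icc a b := Ioc_subset_Icc_self.trans (Icc_subset_Icc hr.1 ht.2)
    have hm := (hcm n).mono_measure (Measure.restrict_mono_set volume hss)
    refine le_of_sq_le ?_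
    have h1 := lintegral_mul_sq_le (volume.restrict (Ioc r t)) (f := fun _ => 1)
      (g := fun x => ‖c n x‖ₑ) aemeasurable_const hm.enorm
    simp only [one_mul, one_pow, lintegral_one, Measure.restrict_apply_univ, Real.volume_Ioc] at h1
    refine h1.trans ?_
    rw [mul_pow, hB, rpow_half_sq, ← ENNReal.ofReal_pow (Real.rpow_nonneg (by linarith) _),
      ← Real.rpow_natCast, ← Real.rpow_mul (by linarith)]
    norm_num
    gcongr
  have hci : ∀ n, ∀ r ∈ Icc a b, ∀ t ∈ Icc a b, IntervalIntegrable (c n) volume r t := by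
    intro n r hr t ht
    have hI : IntegrableOn (c n) (Icc a b) := by
      refine ⟨hcm n, ?_⟩
      rw [HasFiniteIntegral, setLIntegral_congr Ioc_ae_eq_Icc.symm]
      exact (hcs n a (left_mem_Icc.2 hab) b (right_mem_Icc.2 hab) hab).trans_lt
        (ENNReal.mul_lt_top ENNReal.ofReal_lt_top (hBn n).lt_top)
    rw [intervalIntegrable_iff]
    exact hI.mono_set (uIoc_subset_uIcc.trans (uIcc_subset_Icc hr ht))
  have hdiff : ∀ n, ∀ r ∈ Icc a b, ∀ t ∈ Icc a b,
      inter u n t - inter u n r = -(Complex.I * (ε : ℂ)) * ∫ x in r..t, c n x := by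
    intro n r hr t ht
    rw [(duhamel_iff ε u _ t n).1 (hu.duhamel t ht n), (duhamel_iff ε u _ r n).1 (hu.duhamel r hr n),
      ← intervalIntegral.integral_add_adjacent_intervals (hci n 0 h0 r hr) (hci n r hr t ht)]
    ring
  have hhol : ∀ n, ∀ r ∈ Icc a b, ∀ t ∈ Icc a b,
      ‖inter u n t - inter u n r‖ ≤ (|ε| * (B n).toReal) * |t - r| ^ (1 / 2 : ℝ) := by
    intro n r hr t ht
    wlog hrt : r ≤ t generalizing r t
    · rw [norm_sub_rev, abs_sub_comm]; exact this t ht r hr (le_of_not_ge hrt)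
    rw [hdiff n r hr t ht, norm_mul, abs_of_nonneg (by linarith : 0 ≤ t - r), mul_assoc]
    have h1 : ‖-(Complex.I * (ε : ℂ))‖ = |ε| := by simp
    rw [h1]
    gcongr
    rw [intervalIntegral.integral_of_le hrt, ← toReal_enorm]
    refine (ENNReal.toReal_mono (ENNReal.mul_ne_top ENNReal.ofReal_ne_top (hBn n))
      ((enorm_integral_le_lintegral_enorm _).trans (hcs n r hr t ht hrt))).trans (le_of_eq ?_)
    rw [ENNReal.toReal_mul, ENNReal.toReal_ofReal (Real.rpow_nonneg (by linarith) _), mul_comm]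
  have hyn : ∀ n, yn (cut a b (inter u)) n ≤ 2 * mag (coeff (u a)) n
      + ENNReal.ofReal (2 * |ε| * (b - a) ^ (1 / 2 : ℝ)) * B n := by
    intro n
    have e : cut a b (inter u) n = fun t => inter u n a * (Icc a b).indicator (fun _ => 1) t
        + (Icc a b).indicator (fun t => inter u n t - inter u n a) t := by
      ext t
      by_cases ht : t ∈ Icc a b
      · simp only [cut, indicator_of_mem ht]; ring
      · simp only [cut, indicator_of_notMem ht]; ring
    rw [yn, e]
    refine (yNorm_add_le _ _).trans (add_le_add ?_ ?_)
    · rw [← mag_inter, mul_comm]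
      exact yNorm_le ((halfReg_indicator_one measurableSet_Icc Ioo_subset_Icc_self
        subset_rfl).const_mul _)
    · refine (yNorm_le (halfReg_of_holder (θ := 1 / 2) le_rfl (B := |ε| * (B n).toReal) (by positivity)
        (left_mem_Icc.2 hab) (sub_self _) fun r hr r' hr' => ?_)).trans (le_of_eq ?_)
      · rw [sub_sub_sub_cancel_right]; exact hhol n r' hr' r hr
      · have hL : 0 ≤ (b - a) ^ (1 / 2 : ℝ) := Real.rpow_nonneg (by linarith) _
        nth_rewrite 2 [← ENNReal.ofReal_toReal (hBn n)]
        rw [← ENNReal.ofReal_mul (by positivity)]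
        congr 1; ring
  refine ne_top_of_le_ne_top ?_ ((l2_mono hyn).trans (l2_add_le _ _))
  rw [l2_const_mul, l2_const_mul]
  exact ENNReal.add_ne_top.2 ⟨ENNReal.mul_ne_top (by norm_num) (l2_mag_coeff_ne_top _),
    ENNReal.mul_ne_top ENNReal.ofReal_ne_top hBl⟩

end regular

/-- Solutions in the uniqueness class are solutions in the interaction representation. -/
theorem InUniquenessClass.isSol {ε s d a b : ℝ} (hd : 1 / 2 < d) (hs : 0 ≤ s)
    (h0 : (0 : ℝ) ∈ Icc a b) {u₀ : L2} {u : ℝ → L2}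
    (hu : InUniquenessClass ε s d (Icc a b) u₀ u) :
    IsSol (-(Complex.I * ε)) a b (inter u) := by
  refine hu.1.isSol h0 ?_
  rcases le_or_gt s (1 / 2) with h | h
  · exact l2_yn_inter_ne_top_of_xsbNorm hd hs (hu.2 h)
  · exact l2_yn_inter_ne_top_of_contInHs h h0 hu.1

lemma gain_le {d l : ℝ} (hd : 0 ≤ d) (hdl : d ≤ l) :
    gain d ≤ (1 + l ^ (3 / 8 : ℝ)) * d ^ (5 / 8 : ℝ) := by
  have hl : 0 ≤ l ^ (3 / 8 : ℝ) := Real.rpow_nonneg (hd.trans hdl) _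
  have hd' : 0 ≤ d ^ (5 / 8 : ℝ) := Real.rpow_nonneg hd _
  refine max_le (by nlinarith) ?_
  rcases hd.eq_or_lt with rfl | h
  · positivity
  · have e : d = d ^ (3 / 8 : ℝ) * d ^ (5 / 8 : ℝ) := by
      rw [← Real.rpow_add h]; norm_num
    have h1 : d ^ (3 / 8 : ℝ) ≤ l ^ (3 / 8 : ℝ) := Real.rpow_le_rpow hd hdl (by norm_num)
    calc d = d ^ (3 / 8 : ℝ) * d ^ (5 / 8 : ℝ) := e
      _ ≤ _ := by gcongr; linarith

/-! ### Existence in X^{s,b}, growth and Lipschitz dependence -/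

section existence

variable {s a b : ℝ} {u v : ℝ → L2}

/-- Solutions in the interaction representation belong to `X^{s, 9/16}`. -/
theorem IsSol.xsbNorm_lt_top {c : ℂ} (hc : ‖c‖ₑ ≤ 1) (hs : 0 ≤ s) (hab : a ≤ b)
    (hu : IsSol c a b (inter u)) (h : wl2 s (yn (cut a b (inter u))) ≠ ∞) :
    xsbNorm s (9 / 16) (Icc a b) u < ∞ := by
  set V := cut a b (inter u) with hV
  have hf := hu.fin
  set κ : ℝ := 1 + (b - a) ^ (3 / 8 : ℝ) with hκ
  have hκ0 : 0 ≤ κ := by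
    have : 0 ≤ (b - a) ^ (3 / 8 : ℝ) := Real.rpow_nonneg (by linarith) _
    positivity
  set X := trilin (yn V) (yn V) (yn V) with hX
  have hXt : ∀ n, X n ≠ ∞ := fun n => trilin_ne_top hf hf hf n
  -- One sequence dominating both the sup bounds and the Hölder constants; the trilinear estimate
  -- keeps its weighted norm finite.
  set B : ℤ → ℝ≥0∞ := fun n => yn V n + 16 * ENNReal.ofReal κ * X n with hB
  have hBw : wl2 s B ≠ ∞ := by
    refine ne_top_of_le_ne_top ?_ (wl2_add_le s _ _)
    rw [wl2_const_mul]
    refine ENNReal.add_ne_top.2 ⟨h, ENNReal.mul_ne_top (ENNReal.mul_ne_top (by norm_num)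
      ENNReal.ofReal_ne_top) (ne_top_of_le_ne_top ?_ (wl2_trilin_le hs _ _ _))⟩
    exact ENNReal.mul_ne_top (ENNReal.mul_ne_top ENNReal.ofReal_ne_top trilinConst_ne_top)
      (ENNReal.add_ne_top.2 ⟨ENNReal.add_ne_top.2 ⟨ENNReal.mul_ne_top (ENNReal.mul_ne_top h hf) hf,
        ENNReal.mul_ne_top (ENNReal.mul_ne_top hf h) hf⟩,
        ENNReal.mul_ne_top (ENNReal.mul_ne_top hf hf) h⟩)
  have hBt : ∀ n, B n ≠ ∞ := fun n =>
    ne_top_of_le_ne_top hBw ((le_l2 B n).trans (l2_le_wl2 hs B))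
  obtain ⟨C, hC, hext⟩ := exists_invF_of_holder hab
  have hsup : ∀ n, ∀ t ∈ Icc a b, ‖inter u n t‖ ≤ (B n).toReal := fun n t ht => by
    rw [← toReal_enorm]
    exact ENNReal.toReal_mono (hBt n) ((mag_le_yn_cut ht (inter u) n).trans le_self_add)
  have hhol : ∀ n, ∀ t ∈ Icc a b, ∀ t' ∈ Icc a b,
      ‖inter u n t - inter u n t'‖ ≤ (B n).toReal * |t - t'| ^ (5 / 8 : ℝ) := by
    intro n t ht t' ht'
    have hd : |t - t'| ≤ b - a := by
      rw [abs_le]; constructor <;> linarith [ht.1, ht.2, ht'.1, ht'.2]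
    have hd0 : 0 ≤ |t - t'| ^ (5 / 8 : ℝ) := by positivity
    have h1 : ‖inter u n t - inter u n t'‖ₑ ≤ B n * ENNReal.ofReal (|t - t'| ^ (5 / 8 : ℝ)) := by
      rw [hu.eq n t' ht' t ht, enorm_mul]
      calc ‖c‖ₑ * ‖gam V V V n t' t‖ₑ ≤ 1 * (16 * ENNReal.ofReal (gain |t - t'|) * X n) := by
            gcongr; exact enorm_gam_le hf hf hf n t' t
        _ ≤ 1 * (16 * (ENNReal.ofReal κ * ENNReal.ofReal (|t - t'| ^ (5 / 8 : ℝ))) * X n) := by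
            rw [← ENNReal.ofReal_mul hκ0]
            gcongr
            exact gain_le (abs_nonneg _) hd
        _ = 16 * ENNReal.ofReal κ * X n * ENNReal.ofReal (|t - t'| ^ (5 / 8 : ℝ)) := by ring
        _ ≤ _ := by rw [hB]; gcongr; exact le_add_self
    have h2 := ENNReal.toReal_mono (ENNReal.mul_ne_top (hBt n) ENNReal.ofReal_ne_top) h1
    rwa [toReal_enorm, ENNReal.toReal_mul, ENNReal.toReal_ofReal hd0] at h2
  choose G hGm hGb hGe using fun n =>
    hext (inter u n) (B n).toReal ENNReal.toReal_nonneg (hsup n) (hhol n)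
  set g : ℤ → ℝ → ℂ := fun n τ => G n (τ + (n : ℝ) ^ 4) with hg
  have hE : Extends (Icc a b) u g := by
    refine ⟨fun n => (hGm n).comp (measurable_id.add_const _), fun t ht n => ?_⟩
    rw [← propagator_mul_inter, hGe n t ht, invF, mul_left_comm]
    congr 1
    rw [← integral_add_right_eq_self (fun τ : ℝ => Complex.exp (Complex.I * (t : ℂ) * (τ : ℂ)) * G n τ)
      ((n : ℝ) ^ 4), ← integral_const_mul]
    congr 1; ext τ
    rw [← mul_assoc, propagator, ← Complex.exp_add]
    congr 2; push_cast; ring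
  rw [xsbNorm]
  refine (iInf₂_le g hE).trans_lt ?_
  rw [xsbFourierNorm]
  refine ENNReal.rpow_lt_top_of_nonneg (by norm_num) (ne_top_of_le_ne_top
    (ENNReal.mul_ne_top hC (ENNReal.pow_ne_top (n := 2) hBw)) ?_)
  rw [wl2, l2_sq, ← ENNReal.tsum_mul_left]
  refine ENNReal.tsum_le_tsum fun n => ?_
  have hb : 0 ≤ bracket (n : ℝ) := zero_le_one.trans (one_le_bracket _)
  have hw : ENNReal.ofReal (bracket (n : ℝ) ^ (2 * s)) = wt s n ^ 2 := by
    rw [wt, ← ENNReal.ofReal_pow (Real.rpow_nonneg hb _), ← Real.rpow_natCast, ← Real.rpow_mul hb,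
      mul_comm s]
    norm_num
  calc ∫⁻ τ : ℝ, ENNReal.ofReal (bracket (n : ℝ) ^ (2 * s)
        * bracket (τ + (n : ℝ) ^ 4) ^ (2 * (9 / 16) : ℝ)) * ‖g n τ‖ₑ ^ 2
      = wt s n ^ 2 * ∫⁻ τ : ℝ, ENNReal.ofReal (bracket (τ + (n : ℝ) ^ 4) ^ (2 * (9 / 16) : ℝ))
          * ‖G n (τ + (n : ℝ) ^ 4)‖ₑ ^ 2 := by
        rw [← lintegral_const_mul' _ _ (ENNReal.pow_ne_top (wt_ne_top s n))]
        refine lintegral_congr fun τ => ?_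
        rw [ENNReal.ofReal_mul (Real.rpow_nonneg hb _), hw, mul_assoc]
    _ = wt s n ^ 2 * hbSq (9 / 16) (G n) := by
        rw [hbSq, ← lintegral_add_right_eq_self (fun τ : ℝ =>
          ENNReal.ofReal (bracket τ ^ (2 * (9 / 16) : ℝ)) * ‖G n τ‖ₑ ^ 2) ((n : ℝ) ^ 4)]
    _ ≤ wt s n ^ 2 * (C * ENNReal.ofReal (B n).toReal ^ 2) := by gcongr; exact hGb n
    _ = _ := by rw [ENNReal.ofReal_toReal (hBt n)]; ring

lemma eqOn_of_inter_eqOn (h : ∀ n, EqOn (inter v n) (inter u n) (Icc a b)) :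
    EqOn v u (Icc a b) := fun t ht =>
  coeff_injective fun n => by rw [← propagator_mul_inter, ← propagator_mul_inter, h n ht]

lemma hsNorm_eq_inter (s : ℝ) (u : ℝ → L2) (t : ℝ) :
    hsNorm s (u t) = wl2 s (mag fun n => inter u n t) := by rw [hsNorm_eq, mag_inter]

lemma hsNorm_sub_eq_inter (s : ℝ) (u v : ℝ → L2) (t : ℝ) :
    hsNorm s (u t - v t) = wl2 s (mag fun n => inter u n t - inter v n t) := by
  rw [hsNorm_eq]
  congr 1; ext n
  rw [mag, mag, coeff_sub, inter, inter, ← mul_sub, enorm_mul, enorm_exp_I_mul, one_mul]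

/-- Global solutions in `H^s`. -/
theorem exists_isSolution_global {ε : ℝ} (hε : |ε| ≤ 1) (hs : 0 ≤ s) {u₀ : L2} (hu₀ : MemHs s u₀) :
    ∃ u : ℝ → L2, (∀ τ : ℝ, 0 ≤ τ → IsSol (-(Complex.I * ε)) (-τ) τ (inter u) ∧
        IsSolution ε s (Icc (-τ) τ) u₀ u ∧ xsbNorm s (9 / 16) (Icc (-τ) τ) u < ∞ ∧
        ∀ v : ℝ → L2, InUniquenessClass ε s (9 / 16) (Icc (-τ) τ) u₀ v → EqOn v u (Icc (-τ) τ)) ∧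
      u 0 = u₀ ∧ ∀ t : ℝ, ‖u t‖ = ‖u₀‖ := by
  have hc := enorm_coeff_le hε
  rw [MemHs, hsNorm_eq] at hu₀
  obtain ⟨v, hv0, hv⟩ := exists_isSol_global hε hs hu₀.ne
  have hmem : ∀ t : ℝ, t ∈ Icc (-|t|) |t| := fun t => ⟨neg_abs_le t, le_abs_self t⟩
  have hex : ∀ t, ∃ f : L2, ∀ n, coeff f n = propagator t n * v n t := by
    intro t
    refine exists_coeff_eq ?_
    have e : mag (fun n => propagator t n * v n t) = mag fun n => v n t := by
      ext n; rw [mag, mag, enorm_mul, enorm_propagator, one_mul]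
    rw [e]
    exact (hv |t| (abs_nonneg t)).1.l2_mag_ne_top (hmem t)
  choose u hu using hex
  have hi : inter u = v := by
    ext n t
    rw [inter, hu, ← mul_assoc, exp_mul_propagator, one_mul]
  have h00 : ∀ n, inter u n 0 = coeff u₀ n := by rw [hi]; exact hv0
  have hu0 : u 0 = u₀ := coeff_injective fun n => by
    rw [← propagator_mul_inter, h00, propagator]; simp
  refine ⟨u, fun τ hτ => ?_, hu0, fun t => ?_⟩
  · have hz : (0 : ℝ) ∈ Icc (-τ) τ := ⟨by linarith, hτ⟩
    obtain ⟨h1, h2⟩ := hv τ hτ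
    rw [← hi] at h1 h2
    refine ⟨h1, h1.isSolution hz h2 h00, h1.xsbNorm_lt_top hc hs (by linarith) h2, fun w hw => ?_⟩
    refine eqOn_of_inter_eqOn fun n => ?_
    refine IsSol.eqOn hc (hw.isSol (by norm_num) hs hz) h1 hz (fun n => ?_) n
    rw [h00, hw.1.inter_zero hz]
  · have h1 := (hv |t| (abs_nonneg t)).1
    rw [← hi] at h1
    have h2 := h1.l2_mag_eq hε (hmem t) ⟨by linarith [abs_nonneg t], abs_nonneg t⟩ (s := t)
    rw [mag_inter, mag_inter, ← enorm_eq_l2, ← enorm_eq_l2, hu0] at h2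
    rw [← toReal_enorm, h2, toReal_enorm]

/-- Growth of the `H^s` norm over several time steps. -/
theorem IsSol.wl2_mag_le_pow {ε : ℝ} (hε : |ε| ≤ 1) (hs : 0 ≤ s) {v : Family}
    (hv : IsSol (-(Complex.I * ε)) a b v) {K : ℝ≥0∞} (hK : K ≠ ∞)
    (hvK : ∀ t ∈ Icc a b, l2 (mag fun n => v n t) ≤ K) (m : ℕ) {t t' : ℝ} (ht : t ∈ Icc a b)
    (ht' : t' ∈ Icc a b) (hm : |t - t'| ≤ m * stepTime s K.toReal) :
    wl2 s (mag fun n => v n t) ≤ 4 ^ m * wl2 s (mag fun n => v n t') := by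
  refine le_pow_mul_of_step (e := fun t => wl2 s (mag fun n => v n t))
    (fun t ht t' ht' hd => ?_) m t ht t' ht' hm
  have m1 : t ∈ Icc (min t t') (max t t') := ⟨min_le_left _ _, le_max_left _ _⟩
  have m2 : t' ∈ Icc (min t t') (max t t') := ⟨min_le_right _ _, le_max_right _ _⟩
  refine (wl2_mono (mag_le_yn_cut m1 v)).trans (hv.wl2_yn_cut_le_data hε hs hK (hvK t' ht')
    (Icc_subset_Icc (le_min ht.1 ht'.1) (max_le ht.2 ht'.2)) m2 ?_)
  rwa [max_sub_min_eq_abs, abs_sub_comm]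

/-- Lipschitz dependence on the data. -/
theorem exists_lipschitz_const {ε : ℝ} (hε : |ε| ≤ 1) {d : ℝ} (hd : 1 / 2 < d) (hs : 0 ≤ s) {τ : ℝ}
    (hτ : 0 < τ) (R : ℝ≥0) : ∃ L : ℝ≥0, ∀ (u₀ v₀ : L2) (u v : ℝ → L2),
      hsNorm s u₀ ≤ R → hsNorm s v₀ ≤ R →
      InUniquenessClass ε s d (Icc (-τ) τ) u₀ u → InUniquenessClass ε s d (Icc (-τ) τ) v₀ v →
      ∀ t ∈ Icc (-τ) τ, hsNorm s (u t - v t) ≤ L * hsNorm s (u₀ - v₀) := by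
  have hz : (0 : ℝ) ∈ Icc (-τ) τ := ⟨by linarith, hτ.le⟩
  have hR : (R : ℝ≥0∞) ≠ ∞ := ENNReal.coe_ne_top
  have hτ' : ∀ t ∈ Icc (-τ) τ, |t - 0| ≤ τ := fun t ht => by rw [sub_zero]; exact abs_le.2 ht
  obtain ⟨m₀, hm₀⟩ := exists_nat_mul_ge (stepTime_pos hs (R : ℝ≥0∞).toReal) τ
  -- The H^s norm at any time is at most 4^m₀ R, after m₀ steps of growth by 4; the outer 4 passes
  -- from a value to the norm on a short interval.
  set M : ℝ≥0∞ := 4 * (4 ^ m₀ * R) with hM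
  have hMt : M ≠ ∞ := ENNReal.mul_ne_top (by norm_num) (ENNReal.mul_ne_top (by simp) hR)
  -- The first bound on the step serves persistence of regularity, where the mass counts; the second
  -- serves the difference estimate, where the full H^s size M counts.
  set δ := min (stepTime s (R : ℝ≥0∞).toReal) (stepTime s M.toReal) with hδ
  obtain ⟨m, hm⟩ := exists_nat_mul_ge (lt_min (stepTime_pos hs (R : ℝ≥0∞).toReal)
    (stepTime_pos hs M.toReal)) τ
  have hbound : ∀ (u₀ : L2) (u : ℝ → L2), hsNorm s u₀ ≤ R →
      InUniquenessClass ε s d (Icc (-τ) τ) u₀ u → ∀ a' b', a' ≤ b' → b' - a' ≤ δ →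
      Icc a' b' ⊆ Icc (-τ) τ → wl2 s (yn (cut a' b' (inter u))) ≤ M := by
    intro u₀ u hu₀ hu a' b' hab hlen hsub
    have hsol := hu.isSol hd hs hz
    have h0 : (mag fun n => inter u n 0) = mag (coeff u₀) := by
      ext n; rw [mag, mag, hu.1.inter_zero hz]
    have hmass : ∀ t ∈ Icc (-τ) τ, l2 (mag fun n => inter u n t) ≤ R := by
      intro t ht
      rw [hsol.l2_mag_eq hε ht hz, h0]
      exact (l2_le_wl2 hs _).trans (by rwa [← hsNorm_eq])
    have ha := left_mem_Icc.2 hab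
    refine (hsol.wl2_yn_cut_le_data hε hs hR (hmass a' (hsub ha)) hsub ha
      (hlen.trans (min_le_left _ _))).trans (mul_le_mul' le_rfl ?_)
    refine (hsol.wl2_mag_le_pow hε hs hR hmass m₀ (hsub ha) hz
      ((hτ' a' (hsub ha)).trans hm₀)).trans (mul_le_mul' le_rfl ?_)
    rwa [h0, ← hsNorm_eq]
  refine ⟨4 ^ m, fun u₀ v₀ u v hu₀ hv₀ hu hv t ht => ?_⟩
  have key := IsSol.wl2_sub_le_pow (enorm_coeff_le hε) hs (hu.isSol hd hs hz) (hv.isSol hd hs hz)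
    hMt (min_le_right _ _) (hbound u₀ u hu₀ hu) (hbound v₀ v hv₀ hv) m ht hz ((hτ' t ht).trans hm)
  have h0 : wl2 s (mag fun n => inter u n 0 - inter v n 0) = hsNorm s (u₀ - v₀) := by
    rw [hsNorm_eq]
    congr 1; ext n
    rw [mag, mag, hu.1.inter_zero hz, hv.1.inter_zero hz, coeff_sub]
  rw [h0, ← hsNorm_sub_eq_inter] at key
  simpa using key

end existence

end FourthOrderNLS

end

/-! ### The well-posedness theorem -/

theorem proposition1p1 (ε : ℝ) (hε : ε = 1 ∨ ε = -1) :
    ∃ b : ℝ, 1 / 2 < b ∧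
      -- local well-posedness on `[-T, T]`, where `T` depends only on the `L²` norm of the data
      (∃ T : ℝ → ℝ, (∀ K, 0 < T K) ∧
        ∀ s : ℝ, 0 ≤ s → ∃ C : ℝ≥0, ∀ u₀ : FourthOrderNLS.L2, FourthOrderNLS.MemHs s u₀ →
          ∃ u : ℝ → FourthOrderNLS.L2,
            FourthOrderNLS.IsSolution ε s (Icc (-T ‖u₀‖) (T ‖u₀‖)) u₀ u ∧
            FourthOrderNLS.xsbNorm s b (Icc (-T ‖u₀‖) (T ‖u₀‖)) u < ∞ ∧
            (∀ t ∈ Icc (-T ‖u₀‖) (T ‖u₀‖),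
              FourthOrderNLS.hsNorm s (u t) ≤ C * FourthOrderNLS.hsNorm s u₀) ∧
            ∀ v : ℝ → FourthOrderNLS.L2,
              FourthOrderNLS.InUniquenessClass ε s b (Icc (-T ‖u₀‖) (T ‖u₀‖)) u₀ v →
              EqOn v u (Icc (-T ‖u₀‖) (T ‖u₀‖))) ∧
      -- global existence, uniqueness on every time interval, conservation of mass
      (∀ s : ℝ, 0 ≤ s → ∀ u₀ : FourthOrderNLS.L2, FourthOrderNLS.MemHs s u₀ →
        ∃ u : ℝ → FourthOrderNLS.L2,
          (∀ τ : ℝ, 0 < τ →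
            FourthOrderNLS.IsSolution ε s (Icc (-τ) τ) u₀ u ∧
            FourthOrderNLS.xsbNorm s b (Icc (-τ) τ) u < ∞ ∧
            ∀ v : ℝ → FourthOrderNLS.L2,
              FourthOrderNLS.InUniquenessClass ε s b (Icc (-τ) τ) u₀ v →
              EqOn v u (Icc (-τ) τ)) ∧
          ∀ t : ℝ, ‖u t‖ = ‖u₀‖) ∧
      -- Lipschitz dependence on the data, on bounded sets of `H^s` and bounded time intervals
      (∀ s : ℝ, 0 ≤ s → ∀ τ : ℝ, 0 < τ → ∀ R : ℝ≥0, ∃ L : ℝ≥0,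
        ∀ (u₀ v₀ : FourthOrderNLS.L2) (u v : ℝ → FourthOrderNLS.L2),
          FourthOrderNLS.hsNorm s u₀ ≤ R → FourthOrderNLS.hsNorm s v₀ ≤ R →
          FourthOrderNLS.InUniquenessClass ε s b (Icc (-τ) τ) u₀ u →
          FourthOrderNLS.InUniquenessClass ε s b (Icc (-τ) τ) v₀ v →
          ∀ t ∈ Icc (-τ) τ,
            FourthOrderNLS.hsNorm s (u t - v t) ≤ L * FourthOrderNLS.hsNorm s (u₀ - v₀)) := by
  have hε' : |ε| ≤ 1 := by rcases hε with rfl | rfl <;> simp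
  have hc := FourthOrderNLS.enorm_coeff_le hε'
  -- Any b strictly between 1/2 and 5/8 is within reach of the time regularity; 9/16 is the
  -- midpoint. The time T is the step at regularity 0, so it does not depend on s.
  refine ⟨9 / 16, by norm_num, ⟨FourthOrderNLS.stepTime 0, FourthOrderNLS.stepTime_pos le_rfl,
    fun s hs => ?_⟩, fun s hs u₀ hu₀ => ?_, fun s hs τ hτ R => ?_⟩
  -- The number of H^s steps that cover the L² step, a function of s alone; each step costs a factor
  -- 4 in the H^s norm.
  · obtain ⟨m, hm⟩ := exists_nat_ge
      (((FourthOrderNLS.locConst s).toReal / (FourthOrderNLS.locConst 0).toReal) ^ (8 / 5 : ℝ))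
    refine ⟨4 ^ m, fun u₀ hu₀ => ?_⟩
    obtain ⟨u, hu, hu0, hmass⟩ := FourthOrderNLS.exists_isSolution_global hε' hs hu₀
    have hT := FourthOrderNLS.stepTime_pos le_rfl ‖u₀‖
    obtain ⟨h1, h2, h3, h4⟩ := hu _ hT.le
    refine ⟨u, h2, h3, fun t ht => ?_, h4⟩
    have hK : ‖u₀‖ₑ ≠ ∞ := enorm_ne_top
    have key := h1.wl2_mag_le_pow hε' hs hK (fun t _ => ?_) m ht
      (show (0 : ℝ) ∈ Icc _ _ from ⟨by linarith, hT.le⟩) ?_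
    · rw [← FourthOrderNLS.hsNorm_eq_inter, ← FourthOrderNLS.hsNorm_eq_inter, hu0] at key
      simpa using key
    · rw [FourthOrderNLS.mag_inter, ← FourthOrderNLS.enorm_eq_l2, ← ofReal_norm, ← ofReal_norm,
        hmass]
    · rw [sub_zero, toReal_enorm]
      refine (abs_le.2 ht).trans ?_
      rw [FourthOrderNLS.stepTime_zero_eq hs]
      exact mul_le_mul_of_nonneg_right hm (FourthOrderNLS.stepTime_pos hs _).le
  · obtain ⟨u, hu, -, hmass⟩ := FourthOrderNLS.exists_isSolution_global hε' hs hu₀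
    exact ⟨u, fun τ hτ => (hu τ hτ.le).2, hmass⟩
  · exact FourthOrderNLS.exists_lipschitz_const hε' (by norm_num) hs hτ R
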